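/- Let $\mathbb K$ be a field, $V$ a finite-dimensional vector space over $\mathbb K$, and $q\in\mathbb K^\times$ not a root of unity. Let $R:V^{\otimes 2}\to V^{\otimes 2}$ be a Hecke symmetry, i.e. $R_{12}R_{23}R_{12}=R_{23}R_{12}R_{23}$ and $(q\,\mathrm{id}-R)(q^{-1}\mathrm{id}+R)=0$. Suppose that $R$ is even of rank $p\ge 1$: the degree-$l$ component of $\Lambda_-(V)=T(V)/\langle \mathrm{Im}(q^{-1}\mathrm{id}+R)\rangle$ vanishes for $l>p$ and is one-dimensional for $l=p$. Let $H_m$ be the Hecke algebra with generators $\sigma_1,\dots,\sigma_{m-1}$ and parameter $q$, and $\rho_R:H_m\to\mathrm{End}(V^{\otimes m})$, $\sigma_i\mapsto R_{i,i+1}$. For a standard Young tableau $T$ of shape $\lambda\vdash m$ let $Y_T\in H_m$ be the corresponding primitive idempotent (the projector onto the common eigenspace of the Jucys–Murphy elements $J_1=1$, $J_{k+1}=\sigma_kJ_k\sigma_k$ with eigenvalues $q^{2c_k(T)}$, where $c_k(T)$ is the content, column minus row, of the box containing $k$). Put $V_\lambda(T)=\mathrm{Im}\,\rho_R(Y_T)\subset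 V^{\otimes m}$. The spaces $V_\lambda(T)$ with the same $\lambda$ are isomorphic, and $V_\lambda$ denotes any of them; $V_\lambda=\mathbb K$ if $m=0$. Write $\rho_R(A^{(p)})=v\circ u$ with $u:V^{\otimes p}\to\mathbb K$, $v:\mathbb K\to V^{\otimes p}$ and $u\circ v=1$, where $A^{(p)}$ is the idempotent of the tableau of shape $(1^p)$. Put $k_q=(q^k-q^{-k})/(q-q^{-1})$ and suppose that for some $a\in\mathbb K^\times$ $$(-1)^{p-1}q\,p_q\,(\mathrm{id}_V\otimes u)(v\otimes \mathrm{id}_V)=(-1)^{p-1}q\,p_q\,(u\otimes \mathrm{id}_V)(\mathrm{id}_V\otimes v)=a\,\mathrm{id}_V .$$ The Schur–Weyl category $\mathrm{SW}(V)$ has as objects the finite direct sums of basic objects $V_\lambda$ (and of tensor products of these, which decompose into such sums). Its morphisms are the linear maps whose components are restrictions of maps $V^{\otimes k}\to V^{\otimes l}$ generated under linear combinations, composition and tensor products by all $\rho_R(\tau)$, $\tau\in H_k$, and by $u$ and $v$. Thus $V_{(1^p)}\cong\mathbb K$. An additive-multiplicative functional is a map $f:\mathrm{Ob}(\mathrm{SW}(V))\to\mathbb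 K$, constant on isomorphism classes, with $f(U\oplus W)=f(U)+f(W)$ and $f(U\otimes W)=f(U)f(W)$ for all objects $U,W$. Let $f$ be an additive-multiplicative functional with $f(\mathbb K)=f(V_{(1^p)})=1$. Put $f_k=f(V_{(1^k)})$ and $$\phi(t)=t^p+f_1t^{p-1}+\dots+f_{p-1}t+1 .$$ 1. Let $-\alpha_1,\dots,-\alpha_p$ be the roots of $\phi$, with multiplicity, in $\mathbb K$ or in an extension field of $\mathbb K$. Then for every partition $\lambda$ $$f(V_\lambda)=s_\lambda(\alpha_1,\dots,\alpha_p),$$ where $s_\lambda$ is the Schur polynomial in $p$ variables ($s_\lambda=0$ if $\lambda$ has more than $p$ rows). 2. Consequently $f$ is determined by the $p-1$ values $f_1,\dots,f_{p-1}$: if $g$ is another additive-multiplicative functional with $g(\mathbb K)=g(V_{(1^p)})=1$ and $g(V_{(1^k)})=f_k$ for $1\le k\le p-1$, then $g(U)=f(U)$ for every object $U$. -/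

import Mathlib

open scoped TensorProduct
open CategoryTheory

namespace SchurWeyl

universe u v

/-! ### Young tableaux and Schur polynomials -/

/-- The alternant `det (x_i ^ k_j)` in the variables `x_1, …, x_p`. -/
noncomputable def alternant {p : ℕ} (k : Fin p → ℕ) : MvPolynomial (Fin p) ℤ :=
  Matrix.det (Matrix.of fun i j : Fin p => (MvPolynomial.X i : MvPolynomial (Fin p) ℤ) ^ k j)

/-- Every alternant is divisible by the Vandermonde alternant `det (x_i ^ (p - j))`. -/
theorem alternant_dvd {p : ℕ} (k : Fin p → ℕ) :
    alternant (fun j : Fin p => p - 1 - (j : ℕ)) ∣ alternant k := by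
  classical
  let P : Polynomial (MvPolynomial (Fin p) ℤ) :=
    ∏ i : Fin p, (Polynomial.X - Polynomial.C (MvPolynomial.X i))
  have hP : P.Monic := Polynomial.monic_prod_of_monic _ _ fun i _ => Polynomial.monic_X_sub_C _
  have hdeg : P.natDegree = p := by
    simp [P, Polynomial.natDegree_prod_of_monic Finset.univ (fun i : Fin p =>
      (Polynomial.X - Polynomial.C (MvPolynomial.X i : MvPolynomial (Fin p) ℤ)))
      fun i _ => Polynomial.monic_X_sub_C _]
  let C : Matrix (Fin p) (Fin p) (MvPolynomial (Fin p) ℤ) :=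
    Matrix.of fun l j => (Polynomial.X ^ k j %ₘ P).coeff (p - 1 - (l : ℕ))
  have hmul : (Matrix.of fun i j : Fin p => (MvPolynomial.X i : MvPolynomial (Fin p) ℤ) ^ k j) =
      (Matrix.of fun i j : Fin p =>
        (MvPolynomial.X i : MvPolynomial (Fin p) ℤ) ^ (p - 1 - (j : ℕ))) * C := by
    ext1 i j
    have hp : 0 < p := i.pos
    have hroot : Polynomial.eval (MvPolynomial.X i) P = 0 := by
      simp only [P, Polynomial.eval_prod]
      exact Finset.prod_eq_zero (Finset.mem_univ i) (by simp)
    have h1 : (MvPolynomial.X i : MvPolynomial (Fin p) ℤ) ^ k j =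
        Polynomial.eval (MvPolynomial.X i) (Polynomial.X ^ k j %ₘ P) := by
      have := congrArg (Polynomial.eval (MvPolynomial.X i))
        (Polynomial.modByMonic_add_div (Polynomial.X ^ k j) P)
      simpa [hroot] using this.symm
    have hlt : (Polynomial.X ^ k j %ₘ P).natDegree < p := by
      have := Polynomial.natDegree_modByMonic_lt (Polynomial.X ^ k j) hP
        (by intro h; rw [h] at hdeg; simp at hdeg; omega)
      omega
    rw [Matrix.of_apply, h1, Polynomial.eval_eq_sum_range' hlt, Matrix.mul_apply,
      ← Finset.sum_range_reflect, Finset.sum_range]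
    exact Finset.sum_congr rfl fun l _ => by simp [C, mul_comm]
  exact ⟨C.det, by rw [alternant, alternant, hmul, Matrix.det_mul]⟩

/-- The Schur polynomial `s_λ(x_1, …, x_p)`: for `ℓ(λ) ≤ p` the quotient of the alternants
`det (x_i ^ (λ_j + p - j))` and `det (x_i ^ (p - j))` (unique, as `ℤ[x_1, …, x_p]` is a domain),
and `0` for `ℓ(λ) > p`. -/
noncomputable def schur (p : ℕ) (lam : YoungDiagram) : MvPolynomial (Fin p) ℤ :=
  if lam.colLen 0 ≤ p then
    (alternant_dvd fun j : Fin p => lam.rowLen j + (p - 1 - (j : ℕ))).choose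
  else 0

/-- A standard Young tableau of shape `λ`: the number `k + 1` sits in the box `pos k`
(row, column), and the entries increase along rows and down columns. -/
structure StdTableau (lam : YoungDiagram) where
  pos : Fin lam.card ≃ {c : ℕ × ℕ // c ∈ lam.cells}
  mono : ∀ a b, (pos a).1 ≤ (pos b).1 → a ≤ b

/-- The column-by-column order of boxes. -/
def swapLex : ℕ × ℕ ↪ ℕ ×ₗ ℕ :=
  ⟨fun c => toLex (c.2, c.1), fun a b h => by
    have := congrArg ofLex h; simp at this; exact Prod.ext this.2 this.1⟩

/-- The boxes of `λ` listed in the column-by-column order. -/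
def swapEquiv (lam : YoungDiagram) :
    {z : ℕ ×ₗ ℕ // z ∈ lam.cells.map swapLex} ≃ {c : ℕ × ℕ // c ∈ lam.cells} where
  toFun z := ⟨((ofLex z.1).2, (ofLex z.1).1), by
    obtain ⟨c, hc, h⟩ := Finset.mem_map.1 z.2
    rw [← h]
    exact hc⟩
  invFun c := ⟨swapLex c.1, Finset.mem_map_of_mem _ c.2⟩
  left_inv _ := rfl
  right_inv _ := rfl

/-- The standard tableau whose entries increase by `1` going down each column in turn. -/
noncomputable def colTableau (lam : YoungDiagram) : StdTableau lam where
  pos :=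
    ((lam.cells.map swapLex).orderIsoOfFin (Finset.card_map _)).toEquiv.trans (swapEquiv lam)
  mono a b h := by
    rw [← ((lam.cells.map swapLex).orderIsoOfFin (Finset.card_map _)).le_iff_le]
    obtain ⟨h1, h2⟩ := Prod.le_def.1 h
    exact Prod.Lex.toLex_mono (Prod.mk_le_mk.2 ⟨h2, h1⟩)

/-- The one-column diagram `(1^k)`. -/
def column (k : ℕ) : YoungDiagram :=
  YoungDiagram.ofRowLens (List.replicate k 1)
    (List.Pairwise.sortedGE (List.pairwise_replicate.2 (Or.inr le_rfl)))
/-! ### Operators on tensor powers -/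

section Operators

variable {K : Type u} {V : Type v} [Field K] [AddCommGroup V] [Module K V]

/-- The tensor product of maps `V^{⊗a} → V^{⊗b}` and `V^{⊗a'} → V^{⊗b'}`. -/
noncomputable def tens {a a' b b' : ℕ} (f : ⨂[K]^a V →ₗ[K] ⨂[K]^b V)
    (g : ⨂[K]^a' V →ₗ[K] ⨂[K]^b' V) : ⨂[K]^(a + a') V →ₗ[K] ⨂[K]^(b + b') V :=
  TensorPower.mulEquiv.toLinearMap ∘ₗ TensorProduct.map f g ∘ₗ TensorPower.mulEquiv.symm.toLinearMap

/-- The identification of `V ⊗ V` with `V^{⊗2}`, `x ⊗ y ↦ x ⊗ y`. -/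
noncomputable def tensorSq : V ⊗[K] V ≃ₗ[K] ⨂[K]^2 V :=
  (TensorProduct.congr (PiTensorProduct.subsingletonEquiv (R := K) (0 : Fin 1)).symm
    (PiTensorProduct.subsingletonEquiv (R := K) (0 : Fin 1)).symm).trans
    (TensorPower.mulEquiv (n := 1) (m := 1))

theorem tensorSq_tmul (x y : V) : tensorSq (x ⊗ₜ[K] y) = PiTensorProduct.tprod K ![x, y] := by
  have h : ∀ z : V, (PiTensorProduct.subsingletonEquiv (R := K) (s := fun _ => V) (0 : Fin 1)).symm z =
      PiTensorProduct.tprod K (fun _ => z) := fun z => by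
    rw [LinearEquiv.symm_apply_eq]; simp
  rw [tensorSq, LinearEquiv.trans_apply, TensorProduct.congr_tmul, h, h]
  have := TensorPower.tprod_mul_tprod K (fun _ : Fin 1 => x) (fun _ : Fin 1 => y)
  rw [TensorPower.gMul_def] at this
  rw [this]
  congr 1
  ext i
  fin_cases i <;> rfl

/-- `R_{i+1,i+2} = id_i ⊗ R ⊗ id_{m-2-i}` on `V^{⊗m}` (the index `i` starts at `0`). -/
noncomputable def localOp (R : V ⊗[K] V →ₗ[K] V ⊗[K] V) (m : ℕ) (i : Fin (m - 1)) :
    Module.End K (⨂[K]^m V) :=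
  (TensorPower.cast K V (show (i : ℕ) + (2 + (m - 2 - i)) = m by omega)).conj
    (tens LinearMap.id
      (tens (tensorSq.conj R) LinearMap.id))

/-- The family `v` with the entries `i, …, i + n - 1` replaced by `b`. -/
def overwrite {m : ℕ} (v : Fin m → V) (i : ℕ) {n : ℕ} (b : Fin n → V) (j : Fin m) : V :=
  if h : i ≤ j ∧ (j : ℕ) < i + n then b ⟨j - i, by omega⟩ else v j

/-- `y ↦ v_1 ⊗ ⋯ ⊗ v_i ⊗ y ⊗ v_{i+n+1} ⊗ ⋯ ⊗ v_m`. -/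
noncomputable def ins {m : ℕ} (v : Fin m → V) (i n : ℕ) (h : i + n ≤ m) :
    ⨂[K]^n V →ₗ[K] ⨂[K]^m V :=
  (TensorPower.cast K V (show i + (n + (m - n - i)) = m by omega)).toLinearMap ∘ₗ
    TensorPower.mulEquiv.toLinearMap ∘ₗ
    TensorProduct.mk K _ _ (PiTensorProduct.tprod K fun j : Fin i => v ⟨j, by omega⟩) ∘ₗ
    TensorPower.mulEquiv.toLinearMap ∘ₗ
    (TensorProduct.mk K _ _).flip (PiTensorProduct.tprod K fun j : Fin (m - n - i) =>
      v ⟨i + n + j, by omega⟩)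

theorem ins_tprod {m : ℕ} (v : Fin m → V) (i n : ℕ) (h : i + n ≤ m) (b : Fin n → V) :
    ins (K := K) v i n h (PiTensorProduct.tprod K b) = PiTensorProduct.tprod K (overwrite v i b) := by
  have e1 := TensorPower.tprod_mul_tprod K b
    (fun j : Fin (m - n - i) => v ⟨i + n + j, by omega⟩)
  have e2 := TensorPower.tprod_mul_tprod K (fun j : Fin i => v ⟨j, by omega⟩)
    (Fin.append b (fun j : Fin (m - n - i) => v ⟨i + n + j, by omega⟩))
  rw [TensorPower.gMul_def] at e1 e2
  simp only [ins, LinearMap.comp_apply, LinearMap.flip_apply, TensorProduct.mk_apply,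
    LinearEquiv.coe_coe]
  rw [e1, e2, TensorPower.cast_tprod]
  congr 1
  ext j
  simp only [Function.comp_apply, overwrite, Fin.append, Fin.addCases]
  have h1 : ((Fin.cast (show i + (n + (m - n - i)) = m by omega).symm j : Fin _) : ℕ) = j := rfl
  simp only [eq_rec_constant]
  clear e1 e2
  split_ifs <;> first
    | (exfalso; simp at *; omega)
    | (rename_i x y z
       have x' : ¬ (j : ℕ) < i := x
       have y' : (j : ℕ) - i < n := y
       exact absurd (by omega) z)
    | rfl
    | (congr 1; apply Fin.ext; simp; done)
    | (congr 1; apply Fin.ext; simp; omega)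

theorem localOp_ins (R : V ⊗[K] V →ₗ[K] V ⊗[K] V) {m : ℕ} (i : Fin (m - 1)) (v : Fin m → V)
    (y : ⨂[K]^2 V) :
    localOp R m i (ins v i 2 (by omega) y) = ins v i 2 (by omega) (tensorSq.conj R y) := by
  simp [localOp, ins, tens, LinearEquiv.conj_apply]

theorem eq_ins {m : ℕ} (v : Fin m → V) (i n : ℕ) (h : i + n ≤ m) :
    PiTensorProduct.tprod K v =
      ins v i n h (PiTensorProduct.tprod K fun j : Fin n => v ⟨i + j, by omega⟩) := by
  rw [ins_tprod]
  congr 1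
  ext j
  simp only [overwrite]
  split_ifs with h1
  · congr 1; apply Fin.ext; simp; omega
  · rfl

theorem ins_ins {m : ℕ} (v : Fin m → V) (i n : ℕ) (h : i + n ≤ m) (b : Fin n → V) (j k : ℕ)
    (h' : j + k ≤ n) (y : ⨂[K]^k V) :
    ins v i n h (ins b j k h' y) = ins (overwrite v i b) (i + j) k (by omega) y := by
  have : ins v i n h ∘ₗ ins b j k h' = ins (K := K) (overwrite v i b) (i + j) k (by omega) := by
    apply PiTensorProduct.ext
    ext c
    simp only [LinearMap.compMultilinearMap_apply, LinearMap.comp_apply, ins_tprod]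
    congr 1
    ext l
    simp only [overwrite]
    split_ifs <;> first | rfl | (exfalso; omega) | (congr 1; apply Fin.ext; simp; omega)
  exact LinearMap.congr_fun this y

theorem localOp_mul_add (R : V ⊗[K] V →ₗ[K] V ⊗[K] V) (a b : K)
    (h : (a • (1 : Module.End K (V ⊗[K] V)) - R) * (b • (1 : Module.End K (V ⊗[K] V)) + R) = 0)
    (m : ℕ) (i : Fin (m - 1)) :
    (localOp R m i - algebraMap K _ a) * (localOp R m i + algebraMap K _ b) = 0 := by
  have hR : ∀ y : ⨂[K]^2 V, tensorSq.conj R (tensorSq.conj R y) + b • tensorSq.conj R y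
      - a • (tensorSq.conj R y + b • y) = 0 := by
    intro y
    obtain ⟨z, rfl⟩ := tensorSq.surjective y
    have := congrArg tensorSq (LinearMap.congr_fun h z)
    simp [LinearEquiv.conj_apply] at this ⊢
    rw [← neg_eq_zero, ← this]
    module
  apply PiTensorProduct.ext
  ext v
  simp only [LinearMap.compMultilinearMap_apply]
  rw [eq_ins v i 2 (by omega)]
  generalize (PiTensorProduct.tprod K fun j : Fin 2 => v ⟨i + j, by omega⟩) = y
  have := congrArg (ins v i 2 (by omega)) (hR y)
  simp only [map_sub, map_add, map_smul, map_zero] at this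
  simp only [Module.End.mul_apply, localOp_ins, Module.algebraMap_end_apply, LinearMap.sub_apply,
    LinearMap.add_apply, map_add, map_smul, LinearMap.zero_apply]
  rw [← this]
  module

theorem localOp_ins_three (R : V ⊗[K] V →ₗ[K] V ⊗[K] V) {m : ℕ} (i j : ℕ) (h : i + 3 ≤ m)
    (hj : j < 2) (v : Fin m → V) (y : ⨂[K]^3 V) :
    localOp R m ⟨i + j, by omega⟩ (ins v i 3 h y) =
      ins v i 3 h (localOp R 3 ⟨j, by omega⟩ y) := by
  have : localOp R m ⟨i + j, by omega⟩ ∘ₗ ins v i 3 h =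
      ins v i 3 h ∘ₗ localOp R 3 ⟨j, by omega⟩ := by
    apply PiTensorProduct.ext
    ext b
    simp only [LinearMap.compMultilinearMap_apply, LinearMap.comp_apply]
    rw [eq_ins b j 2 (by omega), localOp_ins (i := ⟨j, by omega⟩), ins_ins, ins_ins,
      localOp_ins (i := ⟨i + j, by omega⟩)]
  exact LinearMap.congr_fun this y

theorem localOp_braid (R : V ⊗[K] V →ₗ[K] V ⊗[K] V)
    (h : localOp R 3 0 * localOp R 3 1 * localOp R 3 0 =
      localOp R 3 1 * localOp R 3 0 * localOp R 3 1)
    (m : ℕ) (i : ℕ) (hi : i + 1 < m - 1) :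
    localOp R m ⟨i, by omega⟩ * localOp R m ⟨i + 1, hi⟩ * localOp R m ⟨i, by omega⟩ =
      localOp R m ⟨i + 1, hi⟩ * localOp R m ⟨i, by omega⟩ * localOp R m ⟨i + 1, hi⟩ := by
  apply PiTensorProduct.ext
  ext v
  simp only [LinearMap.compMultilinearMap_apply, Module.End.mul_apply]
  rw [eq_ins v i 3 (by omega)]
  have h0 := localOp_ins_three R i 0 (by omega) (by omega) v
  have h1 := localOp_ins_three R i 1 (by omega) (by omega) v
  simp only [add_zero] at h0
  simp only [h0, h1]
  exact congrArg _ (LinearMap.congr_fun h _)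

theorem mul_ins_left {s t : ℕ} (a : Fin s → V) (c : Fin t → V) (i : ℕ) (h : i + 2 ≤ s)
    (y : ⨂[K]^2 V) :
    TensorPower.mulEquiv (ins a i 2 h y ⊗ₜ[K] PiTensorProduct.tprod K c) =
      ins (Fin.append a c) i 2 (by omega) y := by
  have : TensorPower.mulEquiv.toLinearMap ∘ₗ
      (TensorProduct.mk K _ _).flip (PiTensorProduct.tprod K c) ∘ₗ ins a i 2 h =
      ins (K := K) (Fin.append a c) i 2 (by omega) := by
    apply PiTensorProduct.ext
    ext b
    simp only [LinearMap.compMultilinearMap_apply, LinearMap.comp_apply, ins_tprod,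
      LinearMap.flip_apply, TensorProduct.mk_apply, LinearEquiv.coe_coe]
    have e := TensorPower.tprod_mul_tprod K (overwrite a i b) c
    rw [TensorPower.gMul_def] at e
    rw [e]
    congr 1
    ext l
    refine Fin.addCases (fun l => ?_) (fun l => ?_) l
    · simp [overwrite]
    · simp only [overwrite, Fin.append_right, Fin.val_natAdd]
      rw [dif_neg (by omega)]
  exact LinearMap.congr_fun this y

theorem mul_ins_right {s t : ℕ} (a : Fin s → V) (c : Fin t → V) (i : ℕ) (h : i + 2 ≤ t)
    (y : ⨂[K]^2 V) :
    TensorPower.mulEquiv (PiTensorProduct.tprod K a ⊗ₜ[K] ins c i 2 h y) =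
      ins (Fin.append a c) (s + i) 2 (by omega) y := by
  have : TensorPower.mulEquiv.toLinearMap ∘ₗ
      TensorProduct.mk K _ _ (PiTensorProduct.tprod K a) ∘ₗ ins c i 2 h =
      ins (K := K) (Fin.append a c) (s + i) 2 (by omega) := by
    apply PiTensorProduct.ext
    ext b
    simp only [LinearMap.compMultilinearMap_apply, LinearMap.comp_apply, ins_tprod,
      TensorProduct.mk_apply, LinearEquiv.coe_coe]
    have e := TensorPower.tprod_mul_tprod K a (overwrite c i b)
    rw [TensorPower.gMul_def] at e
    rw [e]
    congr 1
    ext l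
    refine Fin.addCases (fun l => ?_) (fun l => ?_) l
    · simp only [overwrite, Fin.append_left, Fin.val_castAdd]
      rw [dif_neg (by omega)]
    · simp only [overwrite, Fin.append_right, Fin.val_natAdd]
      split_ifs <;> first | rfl | (exfalso; omega) | (congr 1; apply Fin.ext; simp; omega)
  exact LinearMap.congr_fun this y

theorem localOp_comm (R : V ⊗[K] V →ₗ[K] V ⊗[K] V) (m : ℕ) (i j : Fin (m - 1))
    (h : (i : ℕ) + 2 ≤ j) : localOp R m i * localOp R m j = localOp R m j * localOp R m i := by
  obtain ⟨i, hi⟩ := i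
  obtain ⟨j, hj⟩ := j
  obtain ⟨k, rfl⟩ : ∃ k, j = i + 2 + k := ⟨j - (i + 2), by simp at h; omega⟩
  obtain ⟨t, rfl⟩ : ∃ t, m = i + 2 + t := ⟨m - (i + 2), by omega⟩
  have hl : ∀ (a : Fin (i + 2) → V) (y : ⨂[K]^2 V) (z : ⨂[K]^t V),
      localOp R (i + 2 + t) ⟨i, hi⟩ (TensorPower.mulEquiv (ins a i 2 le_rfl y ⊗ₜ[K] z)) =
        TensorPower.mulEquiv (ins a i 2 le_rfl (tensorSq.conj R y) ⊗ₜ[K] z) := by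
    intro a y z
    have : localOp R (i + 2 + t) ⟨i, hi⟩ ∘ₗ TensorPower.mulEquiv.toLinearMap ∘ₗ
        TensorProduct.mk K _ _ (ins a i 2 le_rfl y) =
        TensorPower.mulEquiv.toLinearMap ∘ₗ
          TensorProduct.mk K _ _ (ins a i 2 le_rfl (tensorSq.conj R y)) := by
      apply PiTensorProduct.ext
      ext c
      simp only [LinearMap.compMultilinearMap_apply, LinearMap.comp_apply,
        TensorProduct.mk_apply, LinearEquiv.coe_coe, mul_ins_left]
      exact localOp_ins R ⟨i, hi⟩ _ y
    exact LinearMap.congr_fun this z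
  have hr : ∀ (c : Fin t → V) (y : ⨂[K]^2 V) (x : ⨂[K]^(i + 2) V),
      localOp R (i + 2 + t) ⟨i + 2 + k, hj⟩
          (TensorPower.mulEquiv (x ⊗ₜ[K] ins c k 2 (by omega) y)) =
        TensorPower.mulEquiv (x ⊗ₜ[K] ins c k 2 (by omega) (tensorSq.conj R y)) := by
    intro c y x
    have : localOp R (i + 2 + t) ⟨i + 2 + k, hj⟩ ∘ₗ TensorPower.mulEquiv.toLinearMap ∘ₗ
        (TensorProduct.mk K _ _).flip (ins c k 2 (by omega) y) =
        TensorPower.mulEquiv.toLinearMap ∘ₗ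
          (TensorProduct.mk K _ _).flip (ins c k 2 (by omega) (tensorSq.conj R y)) := by
      apply PiTensorProduct.ext
      ext a
      simp only [LinearMap.compMultilinearMap_apply, LinearMap.comp_apply, LinearMap.flip_apply,
        TensorProduct.mk_apply, LinearEquiv.coe_coe, mul_ins_right]
      exact localOp_ins R ⟨i + 2 + k, hj⟩ _ y
    exact LinearMap.congr_fun this x
  apply PiTensorProduct.ext
  ext v
  simp only [LinearMap.compMultilinearMap_apply, Module.End.mul_apply]
  have e := TensorPower.tprod_mul_tprod K (fun l => v (Fin.castAdd t l))
    (fun l => v (Fin.natAdd (i + 2) l))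
  rw [TensorPower.gMul_def, Fin.append_castAdd_natAdd] at e
  rw [← e, eq_ins (fun l => v (Fin.castAdd t l)) i 2 le_rfl,
    eq_ins (fun l => v (Fin.natAdd (i + 2) l)) k 2 (by omega), hl, hr, hr, hl]
end Operators

/-! ### Hecke algebras -/

section Hecke

variable {K : Type u} [Field K]

/-- The defining relations of the Hecke algebra `H_m`. -/
inductive HeckeRel (q : K) (m : ℕ) :
    FreeAlgebra K (Fin (m - 1)) → FreeAlgebra K (Fin (m - 1)) → Prop
  | braid (i : ℕ) (h : i + 1 < m - 1) : HeckeRel q m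
      (FreeAlgebra.ι K ⟨i, by omega⟩ * FreeAlgebra.ι K ⟨i + 1, h⟩ * FreeAlgebra.ι K ⟨i, by omega⟩)
      (FreeAlgebra.ι K ⟨i + 1, h⟩ * FreeAlgebra.ι K ⟨i, by omega⟩ * FreeAlgebra.ι K ⟨i + 1, h⟩)
  | comm (i j : Fin (m - 1)) (h : (i : ℕ) + 2 ≤ j) : HeckeRel q m
      (FreeAlgebra.ι K i * FreeAlgebra.ι K j) (FreeAlgebra.ι K j * FreeAlgebra.ι K i)
  | quad (i : Fin (m - 1)) : HeckeRel q m
      ((FreeAlgebra.ι K i - algebraMap K _ q) * (FreeAlgebra.ι K i + algebraMap K _ q⁻¹)) 0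

/-- The Hecke algebra `H_m` with generators `σ_1, …, σ_{m-1}`. -/
abbrev HeckeAlg (q : K) (m : ℕ) : Type u := RingQuot (HeckeRel q m)

/-- The generator `σ_{i+1}` of `H_m`. -/
noncomputable def gen (q : K) (m : ℕ) (i : Fin (m - 1)) : HeckeAlg q m :=
  RingQuot.mkAlgHom K (HeckeRel q m) (FreeAlgebra.ι K i)

/-- The Jucys--Murphy elements `J_1 = 1`, `J_{k+1} = σ_k J_k σ_k` of `H_m`;
`jucysMurphy q m k` is `J_{k+1}` for `k < m`. -/
noncomputable def jucysMurphy (q : K) (m : ℕ) : ℕ → HeckeAlg q m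
  | 0 => 1
  | k + 1 => if h : k < m - 1 then gen q m ⟨k, h⟩ * jucysMurphy q m k * gen q m ⟨k, h⟩ else 1

/-- The content (column minus row) of the box containing `k + 1`. -/
def StdTableau.content {lam : YoungDiagram} (T : StdTableau lam) (k : Fin lam.card) : ℤ :=
  ((T.pos k).1.2 : ℤ) - ((T.pos k).1.1 : ℤ)

/-- The primitive idempotent of `H_m` attached to a standard tableau `T` of shape `λ ⊢ m`,
`∏_k ∏_{c ≠ c_k, -m < c < m} (J_k - q^{2c}) / (q^{2 c_k} - q^{2c})`,
where `c_k` is the content of the box of `T` containing `k`. -/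
noncomputable def youngIdem (q : K) {lam : YoungDiagram} (T : StdTableau lam) :
    HeckeAlg q lam.card :=
  (List.ofFn fun k : Fin lam.card =>
    Polynomial.aeval (jucysMurphy q lam.card k)
      (Lagrange.basis (Finset.Ioo (-(lam.card : ℤ)) lam.card)
        (fun c : ℤ => q ^ (2 * c)) (T.content k))).prod

end Hecke

/-! ### Hecke symmetries -/

section Symmetry

variable {K : Type u} {V : Type v} [Field K] [AddCommGroup V] [Module K V]

/-- `R` is a Hecke symmetry with generic parameter `q`. -/
structure IsHeckeSymmetry (q : K) (R : V ⊗[K] V →ₗ[K] V ⊗[K] V) : Prop where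
  q_ne_zero : q ≠ 0
  q_generic : ∀ k : ℕ, 1 ≤ k → q ^ k ≠ 1
  yang_baxter : localOp R 3 0 * localOp R 3 1 * localOp R 3 0 =
    localOp R 3 1 * localOp R 3 0 * localOp R 3 1
  hecke : (q • (1 : Module.End K (V ⊗[K] V)) - R) *
    (q⁻¹ • (1 : Module.End K (V ⊗[K] V)) + R) = 0

variable {q : K} {R : V ⊗[K] V →ₗ[K] V ⊗[K] V}

/-- The local representation `ρ_R` of `H_m` on `V^{⊗m}`, `σ_i ↦ R_{i,i+1}`. -/
noncomputable def rho (hR : IsHeckeSymmetry q R) (m : ℕ) :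
    HeckeAlg q m →ₐ[K] Module.End K (⨂[K]^m V) :=
  RingQuot.liftAlgHom K ⟨FreeAlgebra.lift K (localOp R m), by
    intro a b h
    induction h with
    | braid i h => simpa using localOp_braid R hR.yang_baxter m i h
    | comm i j h => simpa using localOp_comm R m i j h
    | quad i =>
      simpa only [map_mul, map_sub, map_add, map_zero, FreeAlgebra.lift_ι_apply,
        AlgHom.commutes] using localOp_mul_add R q q⁻¹ hR.hecke m i⟩

/-- The two-sided ideal of `T(V)` generated by `Im (q⁻¹ + R) ⊆ V ⊗ V`, as a subspace. -/
noncomputable def skewIdeal (q : K) (R : V ⊗[K] V →ₗ[K] V ⊗[K] V) :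
    Submodule K (TensorAlgebra K V) :=
  Submodule.span K {z | ∃ (a b : TensorAlgebra K V) (x : V ⊗[K] V),
    z = a * LinearMap.mul' K (TensorAlgebra K V)
      (TensorProduct.map (TensorAlgebra.ι K) (TensorAlgebra.ι K) (q⁻¹ • x + R x)) * b}

/-- The component `Λ_-^l(V)` of degree `l` of `Λ_-(V) = T(V) / {Im (q⁻¹ + R)}`. -/
noncomputable def skewComponent (q : K) (R : V ⊗[K] V →ₗ[K] V ⊗[K] V) (l : ℕ) :
    Submodule K (TensorAlgebra K V ⧸ skewIdeal q R) :=
  (LinearMap.range (TensorAlgebra.ι K (M := V)) ^ l).map (skewIdeal q R).mkQ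

/-- The Hecke symmetry `R` is even of rank `p`. -/
structure IsEvenOfRank (q : K) (R : V ⊗[K] V →ₗ[K] V ⊗[K] V) (p : ℕ) : Prop where
  rank_pos : 0 < p
  component_eq_bot : ∀ l, p < l → skewComponent q R l = ⊥
  finrank_component : Module.finrank K (skewComponent q R p) = 1

/-- The image `ρ_R(A^{(p)})` of the antisymmetrizer, the primitive idempotent for `(1^p)`. -/
noncomputable def antisymmetrizer (hR : IsHeckeSymmetry q R) (p : ℕ) :
    Module.End K (⨂[K]^((column p).card) V) :=
  rho hR _ (youngIdem q (colTableau (column p)))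

/-- A factorization of the antisymmetrizer `ρ_R(A^{(p)})` through the field `K = V^{⊗0}`:
`u` restricted to `V_{(1^p)}` is an isomorphism `ψ : V_{(1^p)} → K` with inverse `v`. -/
structure IsFactorization (hR : IsHeckeSymmetry q R) (p : ℕ)
    (u : ⨂[K]^((column p).card) V →ₗ[K] ⨂[K]^0 V)
    (v : ⨂[K]^0 V →ₗ[K] ⨂[K]^((column p).card) V) : Prop where
  comp_eq : v ∘ₗ u = antisymmetrizer hR p
  comp_eq_id : u ∘ₗ v = LinearMap.id

/-- The `q`-number `k_q`. -/
noncomputable def qNumber (q : K) (k : ℕ) : K := (q ^ k - q⁻¹ ^ k) / (q - q⁻¹)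

/-- `N^i_j = (-1)^{p-1} q p_q ∑ u_{a_2 … a_p j} v^{i a_2 … a_p}`, that is, up to the scalar,
`(id ⊗ u) ∘ (v ⊗ id)`. -/
noncomputable def matN (q : K) (p : ℕ) {d : ℕ} (u : ⨂[K]^d V →ₗ[K] ⨂[K]^0 V)
    (v : ⨂[K]^0 V →ₗ[K] ⨂[K]^d V) : ⨂[K]^(0 + 1) V →ₗ[K] ⨂[K]^(1 + 0) V :=
  ((-1) ^ (p - 1) * q * qNumber q p) •
    (tens (LinearMap.id : ⨂[K]^1 V →ₗ[K] ⨂[K]^1 V) u ∘ₗ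
      (TensorPower.cast K V (Nat.add_comm d 1)).toLinearMap ∘ₗ
      tens v (LinearMap.id : ⨂[K]^1 V →ₗ[K] ⨂[K]^1 V))

/-- `M^i_j = (-1)^{p-1} q p_q ∑ u_{j a_2 … a_p} v^{a_2 … a_p i}`, that is, up to the scalar,
`(u ⊗ id) ∘ (id ⊗ v)`. -/
noncomputable def matM (q : K) (p : ℕ) {d : ℕ} (u : ⨂[K]^d V →ₗ[K] ⨂[K]^0 V)
    (v : ⨂[K]^0 V →ₗ[K] ⨂[K]^d V) : ⨂[K]^(1 + 0) V →ₗ[K] ⨂[K]^(0 + 1) V :=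
  ((-1) ^ (p - 1) * q * qNumber q p) •
    (tens u (LinearMap.id : ⨂[K]^1 V →ₗ[K] ⨂[K]^1 V) ∘ₗ
      (TensorPower.cast K V (Nat.add_comm 1 d)).toLinearMap ∘ₗ
      tens (LinearMap.id : ⨂[K]^1 V →ₗ[K] ⨂[K]^1 V) v)

/-- The condition `M = N = a I` with `a ≠ 0`, under which `ψ` is natural with respect to a
rescaled braiding. It does not depend on the factorization `u`, `v`. -/
def IsBalanced (hR : IsHeckeSymmetry q R) (p : ℕ) : Prop :=
  ∃ a : K, a ≠ 0 ∧ ∀ u v, IsFactorization hR p u v →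
    (∀ x : ⨂[K]^1 V, matN q p u v x = a • x) ∧ (∀ x : ⨂[K]^1 V, matM q p u v x = a • x)

end Symmetry

/-! ### The Schur--Weyl category -/

section Category

variable {K : Type u} {V : Type v} [Field K] [AddCommGroup V] [Module K V]
  {q : K} {R : V ⊗[K] V →ₗ[K] V ⊗[K] V}

/-- A label of a space `V_λ(i) ⊆ V^{⊗m}`: a partition `λ ⊢ m` with a standard tableau. -/
abbrev Label : Type := Σ lam : YoungDiagram, StdTableau lam

/-- The tensor degree of `V_{λ₁}(T₁) ⊗ ⋯ ⊗ V_{λ_r}(T_r)`. -/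
def degree : List Label → ℕ
  | [] => 0
  | T :: w => T.1.card + degree w

/-- The projector `ρ_R(Y_{T₁}) ⊗ ⋯ ⊗ ρ_R(Y_{T_r})`. -/
noncomputable def projector (hR : IsHeckeSymmetry q R) :
    (w : List Label) → Module.End K (⨂[K]^(degree w) V)
  | [] => LinearMap.id
  | T :: w => tens (rho hR T.1.card (youngIdem q T.2)) (projector hR w)

/-- The space `V_{λ₁}(T₁) ⊗ ⋯ ⊗ V_{λ_r}(T_r)` with its embedding in a tensor power of `V`, where
`V_λ(T) = Im ρ_R(Y_T)`. It is `K` for the empty product. -/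
noncomputable def wordSpace (hR : IsHeckeSymmetry q R) (w : List Label) :
    Submodule K (⨂[K]^(degree w) V) :=
  LinearMap.range (projector hR w)

/-- The linear maps between tensor powers of `V` that induce the categorical morphisms: those
generated by the morphisms of the first kind `ρ_R(τ)`, `τ ∈ H_k`, and of the second kind,
`ψ : V_{(1^p)} → K` and `ψ⁻¹`, under linear combinations, composition and tensor products. -/
inductive Mor (hR : IsHeckeSymmetry q R) (p : ℕ) :
    (k l : ℕ) → (⨂[K]^k V →ₗ[K] ⨂[K]^l V) → Prop
  | first (k : ℕ) (τ : HeckeAlg q k) : Mor hR p k k (rho hR k τ)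
  | psi (u v) (h : IsFactorization hR p u v) : Mor hR p _ _ u
  | psiInv (u v) (h : IsFactorization hR p u v) : Mor hR p _ _ v
  | zero (k l : ℕ) : Mor hR p k l 0
  | add {k l : ℕ} {f g : ⨂[K]^k V →ₗ[K] ⨂[K]^l V} :
      Mor hR p k l f → Mor hR p k l g → Mor hR p k l (f + g)
  | smul {k l : ℕ} (a : K) {f : ⨂[K]^k V →ₗ[K] ⨂[K]^l V} :
      Mor hR p k l f → Mor hR p k l (a • f)
  | comp {k l m : ℕ} {f : ⨂[K]^k V →ₗ[K] ⨂[K]^l V} {g : ⨂[K]^l V →ₗ[K] ⨂[K]^m V} :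
      Mor hR p k l f → Mor hR p l m g → Mor hR p k m (g ∘ₗ f)
  | tens {k l k' l' : ℕ} {f : ⨂[K]^k V →ₗ[K] ⨂[K]^l V} {g : ⨂[K]^k' V →ₗ[K] ⨂[K]^l' V} :
      Mor hR p k l f → Mor hR p k' l' g → Mor hR p (k + k') (l + l') (tens f g)

/-- A linear map `V_{λ₁}(T₁) ⊗ ⋯ → V_{μ₁}(S₁) ⊗ ⋯` is a categorical morphism if it is the
restriction of a map in `Mor`. -/
def IsWordMor (hR : IsHeckeSymmetry q R) (p : ℕ) {w w' : List Label}
    (f : wordSpace hR w →ₗ[K] wordSpace hR w') : Prop :=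
  ∃ g, Mor hR p (degree w) (degree w') g ∧ ∀ x : wordSpace hR w, g x = f x

/-- The objects of `SW(V)`: finite direct sums of tensor products of the spaces `V_λ(T)`.
(Each such tensor product is isomorphic in `SW(V)` to a finite direct sum of basic objects.) -/
structure SW (hR : IsHeckeSymmetry q R) (p : ℕ) : Type where
  summands : List (List Label)

namespace SW

variable {hR : IsHeckeSymmetry q R} {p : ℕ}

/-- The underlying vector space of an object. -/
abbrev Space (U : SW hR p) : Type (max u v) :=
  (i : Fin U.summands.length) → wordSpace hR (U.summands.get i)

/-- The categorical morphisms: the linear maps all of whose components with respect to the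
direct sum decompositions are categorical morphisms. -/
@[ext]
structure Hom (U W : SW hR p) : Type (max u v) where
  toLin : U.Space →ₗ[K] W.Space
  isMor : ∀ i j, IsWordMor hR p (LinearMap.proj j ∘ₗ toLin ∘ₗ LinearMap.single K (fun i => wordSpace hR (U.summands.get i)) i)

theorem isWordMor_zero {w w' : List Label} :
    IsWordMor hR p (0 : wordSpace hR w →ₗ[K] wordSpace hR w') :=
  ⟨0, .zero _ _, fun x => by simp⟩

theorem isWordMor_sum {w w' : List Label} {ι : Type} (s : Finset ι)
    (f : ι → wordSpace hR w →ₗ[K] wordSpace hR w') (h : ∀ i ∈ s, IsWordMor hR p (f i)) :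
    IsWordMor hR p (∑ i ∈ s, f i) := by
  classical
  induction s using Finset.induction_on with
  | empty => exact isWordMor_zero
  | insert a s ha ih =>
    obtain ⟨g, hg, hg'⟩ := h a (Finset.mem_insert_self a s)
    obtain ⟨g', hg1, hg2⟩ := ih fun i hi => h i (Finset.mem_insert_of_mem hi)
    exact ⟨g + g', .add hg hg1, fun x => by
      rw [Finset.sum_insert ha]
      simp only [LinearMap.add_apply, Submodule.coe_add, hg', hg2]⟩

/-- The identity morphism. -/
noncomputable def Hom.id (U : SW hR p) : Hom U U where
  toLin := LinearMap.id
  isMor i j := by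
    by_cases h : i = j
    · subst h
      exact ⟨_, .first _ 1, fun x => by simp⟩
    · convert isWordMor_zero using 1
      ext x
      simp [Pi.single_eq_of_ne (Ne.symm h)]

/-- Composition of morphisms. -/
noncomputable def Hom.comp {U W Z : SW hR p} (f : Hom U W) (g : Hom W Z) : Hom U Z where
  toLin := g.toLin ∘ₗ f.toLin
  isMor i k := by
    have : LinearMap.proj k ∘ₗ (g.toLin ∘ₗ f.toLin) ∘ₗ LinearMap.single K (fun i => wordSpace hR (U.summands.get i)) i =
        ∑ j, (LinearMap.proj k ∘ₗ g.toLin ∘ₗ LinearMap.single K (fun j => wordSpace hR (W.summands.get j)) j) ∘ₗ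
          (LinearMap.proj j ∘ₗ f.toLin ∘ₗ LinearMap.single K (fun i => wordSpace hR (U.summands.get i)) i) := by
      ext1 x
      simp only [LinearMap.comp_apply, LinearMap.sum_apply, LinearMap.proj_apply,
        LinearMap.coe_single]
      rw [← Finset.sum_apply, ← map_sum, Finset.univ_sum_single]
    rw [this]
    refine isWordMor_sum _ _ fun j _ => ?_
    obtain ⟨a, ha, ha'⟩ := f.isMor i j
    obtain ⟨b, hb, hb'⟩ := g.isMor j k
    exact ⟨_, .comp ha hb, fun x => by
      rw [LinearMap.comp_apply, ha', hb']
      rfl⟩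

noncomputable instance : Category.{max u v} (SW hR p) where
  Hom := Hom
  id := Hom.id
  comp := Hom.comp

/-- The direct sum of two objects. -/
def oplus (U W : SW hR p) : SW hR p := ⟨U.summands ++ W.summands⟩

/-- The tensor product of two objects: `⊗` distributes over the summands, and is strictly
associative, being the tensor product of subspaces of the tensor powers of `V`. -/
def otimes (U W : SW hR p) : SW hR p :=
  ⟨U.summands.flatMap fun a => W.summands.map fun b => a ++ b⟩

/-- The unit object `K`. -/
def unit : SW hR p := ⟨[[]]⟩

/-- The space `V_λ(T) = Im ρ_R(Y_T)` as an object. -/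
def basicAt {lam : YoungDiagram} (T : StdTableau lam) : SW hR p := ⟨[[⟨lam, T⟩]]⟩

/-- The basic object `V_λ`, realized as `V_λ(T)` for the column-by-column tableau `T`. -/
noncomputable def basic (lam : YoungDiagram) : SW hR p := basicAt (colTableau lam)

/-- `f` is an additive-multiplicative functional on the objects of `SW(V)`
(isomorphic objects being identified). -/
structure IsAMFunctional (f : SW hR p → K) : Prop where
  iso : ∀ U W : SW hR p, Nonempty (U ≅ W) → f U = f W
  add : ∀ U W : SW hR p, f (U.oplus W) = f U + f W
  mul : ∀ U W : SW hR p, f (U.otimes W) = f U * f W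

/-- `φ(t) = t^p + f_1 t^{p-1} + ⋯ + f_{p-1} t + 1` with `f_k = f(V_{(1^k)})`. -/
noncomputable def charPoly (f : SW hR p → K) : Polynomial K :=
  Polynomial.X ^ p +
    ∑ k ∈ Finset.Ico 1 p, Polynomial.C (f (basic (column k))) * Polynomial.X ^ (p - k) + 1

end SW

end Category

end SchurWeyl

namespace SchurWeyl

universe w u v

/-! The values of `f` on the basic objects obey the Pieri rule: f(V_λ) f_k is the sum of f(V_μ) over
the diagrams μ obtained from λ by adding a vertical strip of k boxes. Schur polynomials obey the
same rule with the elementary symmetric polynomials e_k in place of f_k (`isPieri_schur`), and the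
rule determines all values from the one at the empty diagram (`IsPieri.unique`). So it is enough
that f_k = e_k(α). For k ≤ p this is Vieta's formula for φ; for k > p both sides vanish, because
evenness of rank p kills the antisymmetrizer (`asym_eq_zero`). The uniqueness of `f` follows in the
same way, since every object is a direct sum of tensor products of spaces V_λ(T).

The Pieri rule for `f` expresses an isomorphism of V_λ ⊗ V_(1^k) with the direct sum of the V_μ,
that is, a decomposition of the idempotent Y_T ⊗ A^(k) inside the image of the Hecke algebra. It is
derived from the Jucys–Murphy elements in an arbitrary algebra satisfying the Hecke relations. A
standard tableau is recorded by the list of its contents and a diagram by its beads. Only addable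
contents can occur as the next eigenvalue (`HeckeGens.specAt`), and the intertwiners s - `diagCoeff`
identify the weight spaces of tableaux of one shape (`HeckeGens.linked_of_state_eq`).

For the decomposition itself (`HeckeGens.pieri`), let p be the antisymmetrizer on the last k
strands. Symmetric functions of the last k Jucys–Murphy elements commute with p, so different strips
are separated by their multisets of contents. Each strip is tested on a single weight, the one whose
boxes are added from top to bottom. A nonzero vector fixed by p has a nonzero component of this kind
(`HeckeGens.exists_sorted_component`), and p kills no vector of such a weight
(`HeckeGens.eq_zero_of_asym_mul`); finite dimension then turns injectivity into bijectivity.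
`map_split` converts the decomposition into additivity of `f`. -/

/-! ### Paths of contents -/

/-- The bead configuration reached by a list of contents (latest step first): adding a box of
content `c` moves a bead from `c` to `c + 1`. -/
def state : List ℤ → Set ℤ
  | [] => Set.Iic 0
  | c :: l => insert (c + 1) (state l \ {c})

/-- Every step of the list of contents (latest step first) moves a bead to a free place. -/
def IsPath : List ℤ → Prop
  | [] => True
  | c :: l => IsPath l ∧ c ∈ state l ∧ c + 1 ∉ state l

theorem mem_state_nil {c : ℤ} : c ∈ state [] ↔ c ≤ 0 := Iff.rfl

theorem mem_state_cons {c d : ℤ} {l : List ℤ} :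
    c ∈ state (d :: l) ↔ c = d + 1 ∨ (c ∈ state l ∧ c ≠ d) := Iff.rfl

theorem isPath_cons {c : ℤ} {l : List ℤ} :
    IsPath (c :: l) ↔ IsPath l ∧ c ∈ state l ∧ c + 1 ∉ state l := Iff.rfl

theorem state_cons_congr {c : ℤ} {l l' : List ℤ} (h : state l = state l') :
    state (c :: l) = state (c :: l') := by
  simp only [state, h]

theorem IsPath.cons_congr {c : ℤ} {l l' : List ℤ} (hl : IsPath (c :: l)) (hl' : IsPath l')
    (h : state l = state l') : IsPath (c :: l') :=
  ⟨hl', h ▸ hl.2.1, h ▸ hl.2.2⟩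

/-- Each step shifts one bead by one place, so the initial filling is disturbed only within distance
`l.length` of the origin. -/
theorem IsPath.bounds {l : List ℤ} (hl : IsPath l) :
    (∀ c : ℤ, c ≤ -l.length → c ∈ state l) ∧ (∀ c ∈ state l, c ≤ l.length) := by
  induction l with
  | nil => exact ⟨fun c hc => by simpa [mem_state_nil] using hc, fun c hc => by simpa [mem_state_nil] using hc⟩
  | cons d l ih =>
    obtain ⟨h1, h2, h3⟩ := hl
    obtain ⟨i1, i2⟩ := ih h1
    have hd : -(l.length : ℤ) ≤ d := by
      by_contra h
      exact h3 (i1 _ (by omega))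
    have := i2 d h2
    refine ⟨fun c hc => ?_, fun c hc => ?_⟩
    · rw [mem_state_cons]
      simp only [List.length_cons] at hc
      push_cast at hc
      exact Or.inr ⟨i1 c (by omega), by omega⟩
    · rw [mem_state_cons] at hc
      simp only [List.length_cons]
      push_cast
      rcases hc with rfl | ⟨hc, -⟩
      · omega
      · have := i2 c hc
        omega

/-- Thanks to this bound a single finite interval of interpolation nodes serves all contents of a
path. -/
theorem IsPath.content_bounds {c : ℤ} {l : List ℤ} (hl : IsPath (c :: l)) :
    -(l.length : ℤ) ≤ c ∧ c ≤ l.length := by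
  refine ⟨?_, hl.1.bounds.2 c hl.2.1⟩
  by_contra h
  exact hl.2.2 (hl.1.bounds.1 _ (by omega))

/-- Steps whose contents are not neighbours concern disjoint pairs of places and do not interfere.
-/
theorem state_swap {c d : ℤ} {l : List ℤ} (h1 : c ≠ d + 1) (h2 : d ≠ c + 1) :
    state (c :: d :: l) = state (d :: c :: l) := by
  ext x
  simp only [mem_state_cons]
  constructor <;> intro h <;> grind

theorem IsPath.swap {c d : ℤ} {l : List ℤ} (h : IsPath (c :: d :: l)) (h1 : c ≠ d + 1)
    (h2 : d ≠ c + 1) : IsPath (d :: c :: l) := by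
  simp only [isPath_cons, mem_state_cons] at h ⊢
  grind

/-- A removable box may be chosen as the last one. If the last content d differs from c, the box of
content c is already removable before that step; it is made last there and then commuted past d. -/
theorem exists_path_of_removable {l : List ℤ} (hl : IsPath l) {c : ℤ} (h1 : c + 1 ∈ state l)
    (h2 : c ∉ state l) : ∃ l', IsPath (c :: l') ∧ state (c :: l') = state l ∧
      l'.length + 1 = l.length := by
  induction l with
  | nil => simp only [mem_state_nil] at h1 h2; omega
  | cons d l ih =>
    by_cases hcd : c = d
    · subst hcd
      exact ⟨l, hl, rfl, rfl⟩
    · simp only [isPath_cons, mem_state_cons] at hl h1 h2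
      obtain ⟨l', p1, p2, p3⟩ := ih hl.1 (by grind) (by grind)
      have e := fun x => Set.ext_iff.1 p2 x
      have q1 : IsPath (d :: l') := by
        have e1 := e d
        have e2 := e (d + 1)
        simp only [isPath_cons, mem_state_cons] at p1 e1 e2 ⊢
        grind
      have q2 : IsPath (c :: d :: l') := by
        simp only [isPath_cons, mem_state_cons] at p1 q1 ⊢
        grind
      refine ⟨d :: l', q2, ?_, by simp [← p3]⟩
      rw [state_swap (by grind) (by grind)]
      exact state_cons_congr p2

/-- The contents of the boxes that can be added. -/
noncomputable def addable (l : List ℤ) : Finset ℤ :=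
  open Classical in
  (Finset.Icc (-(l.length : ℤ)) l.length).filter fun c => c ∈ state l ∧ c + 1 ∉ state l

theorem mem_addable {l : List ℤ} (hl : IsPath l) {c : ℤ} :
    c ∈ addable l ↔ c ∈ state l ∧ c + 1 ∉ state l := by
  simp only [addable, Finset.mem_filter, Finset.mem_Icc, and_iff_right_iff_imp]
  exact fun h => IsPath.content_bounds ⟨hl, h⟩

theorem mem_addable' {l : List ℤ} (hl : IsPath l) {c : ℤ} :
    c ∈ addable l ↔ IsPath (c :: l) := by
  rw [mem_addable hl, isPath_cons, and_iff_right hl]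

/-! ### Hecke generators and Jucys--Murphy elements -/

/-- `q` is neither zero nor a root of unity. -/
structure Generic {K : Type*} [Field K] (q : K) : Prop where
  ne_zero : q ≠ 0
  pow_ne_one : ∀ k : ℕ, 1 ≤ k → q ^ k ≠ 1

section Generic

variable {K : Type*} [Field K] {q : K}

theorem Generic.zpow_ne_one (hq : Generic q) {c : ℤ} (hc : c ≠ 0) : q ^ c ≠ 1 := by
  obtain ⟨n, rfl | rfl⟩ := c.eq_nat_or_neg
  · rw [zpow_natCast]
    exact hq.pow_ne_one n (by omega)
  · rw [zpow_neg, zpow_natCast, Ne, inv_eq_one]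
    exact hq.pow_ne_one n (by omega)

theorem Generic.zpow_inj (hq : Generic q) {a b : ℤ} : q ^ a = q ^ b ↔ a = b := by
  refine ⟨fun h => ?_, fun h => h ▸ rfl⟩
  by_contra hab
  refine hq.zpow_ne_one (c := a - b) (by omega) ?_
  rw [zpow_sub₀ hq.ne_zero, h, div_self (zpow_ne_zero _ hq.ne_zero)]

theorem Generic.two_zpow_inj (hq : Generic q) {a b : ℤ} : q ^ (2 * a) = q ^ (2 * b) ↔ a = b := by
  rw [hq.zpow_inj]
  omega

theorem Generic.add_inv_ne_zero (hq : Generic q) : q + q⁻¹ ≠ 0 := by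
  intro h
  have h0 := hq.ne_zero
  have : q ^ 2 = -1 := by
    field_simp at h
    linear_combination h
  refine hq.pow_ne_one 4 (by norm_num) ?_
  linear_combination (q ^ 2 - 1) * this

end Generic

section Hecke

variable {K : Type*} [Field K] {A : Type*} [Ring A] [Algebra K A]

/-- The elements `s 0, …, s (n - 2)` satisfy the relations of the Hecke algebra `H_n`. -/
structure HeckeGens (q : K) (n : ℕ) (s : ℕ → A) : Prop where
  quad : ∀ i, i + 1 < n → s i * s i = (q - q⁻¹) • s i + 1
  braid : ∀ i, i + 2 < n → s i * s (i + 1) * s i = s (i + 1) * s i * s (i + 1)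
  comm : ∀ i j, i + 2 ≤ j → j + 1 < n → s i * s j = s j * s i

/-- The Jucys--Murphy elements of a family of Hecke generators. -/
def jm (s : ℕ → A) : ℕ → A
  | 0 => 1
  | k + 1 => s k * jm s k * s k

variable {q : K} {n : ℕ} {s : ℕ → A}

theorem HeckeGens.mono (H : HeckeGens q n s) {m : ℕ} (h : m ≤ n) : HeckeGens q m s :=
  ⟨fun i hi => H.quad i (by omega), fun i hi => H.braid i (by omega),
    fun i j hi hj => H.comm i j hi (by omega)⟩

theorem HeckeGens.shift {m k : ℕ} (H : HeckeGens q (m + k) s) :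
    HeckeGens q k fun i => s (m + i) :=
  ⟨fun i hi => H.quad _ (by omega), fun i hi => H.braid _ (by omega),
    fun i j hi hj => H.comm _ _ (by omega) (by omega)⟩

theorem HeckeGens.commute (H : HeckeGens q n s) {i j : ℕ} (h : i + 2 ≤ j ∨ j + 2 ≤ i)
    (hi : i + 1 < n) (hj : j + 1 < n) : Commute (s i) (s j) := by
  rcases h with h | h
  · exact H.comm i j h hj
  · exact (H.comm j i h hi).symm

theorem HeckeGens.commute_jm_of_lt (H : HeckeGens q n s) {i k : ℕ} (h : k < i) (hi : i + 1 < n) :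
    Commute (s i) (jm s k) := by
  induction k with
  | zero => exact Commute.one_right _
  | succ k ih =>
    have h1 := H.commute (i := i) (j := k) (Or.inr (by omega)) hi (by omega)
    exact (h1.mul_right (ih (by omega))).mul_right h1

theorem HeckeGens.commute_jm_of_ge (H : HeckeGens q n s) {i k : ℕ} (h : i + 2 ≤ k) (hk : k < n) :
    Commute (s i) (jm s k) := by
  induction k, h using Nat.le_induction with
  | base =>
    have hb := H.braid i hk
    have hc : Commute (s (i + 1)) (jm s i) := H.commute_jm_of_lt (by omega) (by omega)
    show s i * (s (i + 1) * (s i * jm s i * s i) * s (i + 1)) =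
      s (i + 1) * (s i * jm s i * s i) * s (i + 1) * s i
    calc s i * (s (i + 1) * (s i * jm s i * s i) * s (i + 1))
        = (s i * s (i + 1) * s i) * jm s i * s i * s (i + 1) := by noncomm_ring
      _ = s (i + 1) * s i * (s (i + 1) * jm s i) * s i * s (i + 1) := by rw [hb]; noncomm_ring
      _ = s (i + 1) * s i * jm s i * (s (i + 1) * s i * s (i + 1)) := by rw [hc.eq]; noncomm_ring
      _ = _ := by rw [← hb]; noncomm_ring
  | succ k hk' ih =>
    have h1 := H.commute (i := i) (j := k) (Or.inl hk') (by omega) hk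
    exact (h1.mul_right (ih (by omega))).mul_right h1

theorem HeckeGens.commute_jm_of_lt' (H : HeckeGens q n s) {j k : ℕ} (h : j < k) (hk : k < n) :
    Commute (jm s j) (jm s k) := by
  induction j with
  | zero => exact Commute.one_left _
  | succ j ih =>
    have h1 := H.commute_jm_of_ge (i := j) (k := k) (by omega) hk
    exact (h1.mul_left (ih (by omega))).mul_left h1

theorem HeckeGens.commute_jm (H : HeckeGens q n s) {j k : ℕ} (hj : j < n) (hk : k < n) :
    Commute (jm s j) (jm s k) := by
  rcases lt_trichotomy j k with h | rfl | h
  · exact H.commute_jm_of_lt' h hk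
  · exact Commute.refl _
  · exact (H.commute_jm_of_lt' h hj).symm

/-- With its mirror image `gen_mul_jm` this is the affine Hecke relation; all spectral arguments
below rest on it. -/
theorem HeckeGens.jm_mul_gen (H : HeckeGens q n s) {k : ℕ} (hk : k + 1 < n) :
    jm s k * s k = s k * jm s (k + 1) - (q - q⁻¹) • jm s (k + 1) := by
  have h : s k * jm s (k + 1) = (s k * s k) * jm s k * s k := by
    show s k * (s k * jm s k * s k) = _
    noncomm_ring
  rw [h, H.quad k hk, add_mul, one_mul, add_mul, smul_mul_assoc, smul_mul_assoc]
  show _ = (q - q⁻¹) • jm s (k + 1) + _ - _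
  abel

theorem HeckeGens.gen_mul_jm (H : HeckeGens q n s) {k : ℕ} (hk : k + 1 < n) :
    s k * jm s k = jm s (k + 1) * s k - (q - q⁻¹) • jm s (k + 1) := by
  have h : jm s (k + 1) * s k = s k * jm s k * (s k * s k) := by
    show (s k * jm s k * s k) * s k = _
    noncomm_ring
  rw [h, H.quad k hk, mul_add, mul_one, mul_smul_comm]
  show _ = (q - q⁻¹) • jm s (k + 1) + _ - _
  abel

/-- The diagonal coefficient of a generator on a vector with Jucys--Murphy eigenvalues `a`, `b`. -/
noncomputable def diagCoeff (q a b : K) : K := (q - q⁻¹) * b / (b - a)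

theorem diagCoeff_add {a b : K} (h : a ≠ b) : diagCoeff q a b + diagCoeff q b a = q - q⁻¹ := by
  have h1 : b - a ≠ 0 := sub_ne_zero.2 h.symm
  have h2 : a - b ≠ 0 := sub_ne_zero.2 h
  rw [diagCoeff, diagCoeff, div_add_div _ _ h1 h2, div_eq_iff (mul_ne_zero h1 h2)]
  ring

/-- Exchanging the eigenvalues of two consecutive Jucys--Murphy elements. -/
theorem HeckeGens.swap_spec (H : HeckeGens q n s) {k : ℕ} (hk : k + 1 < n) {a b : K} (hab : a ≠ b)
    {x : A} (hX : jm s k * x = a • x) (hY : jm s (k + 1) * x = b • x) :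
    jm s k * (s k * x - diagCoeff q a b • x) = b • (s k * x - diagCoeff q a b • x) ∧
    jm s (k + 1) * (s k * x - diagCoeff q a b • x) = a • (s k * x - diagCoeff q a b • x) ∧
    s k * (s k * x - diagCoeff q a b • x) = diagCoeff q b a • (s k * x - diagCoeff q a b • x) +
      (1 + diagCoeff q a b * diagCoeff q b a) • x := by
  have h1 : b - a ≠ 0 := sub_ne_zero.2 hab.symm
  have hd : diagCoeff q a b * (b - a) = (q - q⁻¹) * b := div_mul_cancel₀ _ h1
  have e1 : jm s k * (s k * x) = b • (s k * x) - ((q - q⁻¹) * b) • x := by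
    rw [← mul_assoc, H.jm_mul_gen hk, sub_mul, mul_assoc, hY, smul_mul_assoc, hY, mul_smul_comm,
      smul_smul]
  have e2 : jm s (k + 1) * (s k * x) = a • (s k * x) + ((q - q⁻¹) * b) • x := by
    have := congrArg (· * x) (H.gen_mul_jm hk)
    simp only [sub_mul, mul_assoc, hX, smul_mul_assoc, hY, mul_smul_comm, smul_smul] at this
    rw [this]
    module
  have e3 : s k * (s k * x) = (q - q⁻¹) • (s k * x) + x := by
    rw [← mul_assoc, H.quad k hk, add_mul, one_mul, smul_mul_assoc]
  refine ⟨?_, ?_, ?_⟩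
  · rw [mul_sub, e1, mul_smul_comm, hX, ← hd]
    module
  · rw [mul_sub, e2, mul_smul_comm, hY, ← hd]
    module
  · rw [mul_sub, e3, mul_smul_comm, ← diagCoeff_add (q := q) hab]
    module

/-- Increasing neighbouring contents (boxes adjacent in a row) give the symmetric eigenvalue q; the
decreasing case below gives the antisymmetric eigenvalue -q⁻¹. -/
theorem diagCoeff_self_succ (hq : Generic q) (c : ℤ) :
    diagCoeff q (q ^ (2 * c)) (q ^ (2 * (c + 1))) = q := by
  have h0 := hq.ne_zero
  have h1 : q ^ (2 * (c + 1)) - q ^ (2 * c) ≠ 0 := by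
    rw [sub_ne_zero, Ne, hq.two_zpow_inj]
    omega
  rw [diagCoeff, div_eq_iff h1, mul_add, zpow_add₀ h0]
  have : q ^ (2 * 1 : ℤ) = q * q := by norm_num [zpow_ofNat, sq]
  rw [this]
  field_simp

theorem diagCoeff_succ_self (hq : Generic q) (c : ℤ) :
    diagCoeff q (q ^ (2 * (c + 1))) (q ^ (2 * c)) = -q⁻¹ := by
  have h := diagCoeff_add (q := q) (a := q ^ (2 * c)) (b := q ^ (2 * (c + 1)))
    (by rw [Ne, hq.two_zpow_inj]; omega)
  rw [diagCoeff_self_succ hq] at h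
  linear_combination h

/-- For the eigenvalues a, b the expression equals (b - q²a)(b - q⁻²a)/(b - a)², which vanishes only
for neighbouring contents. It is the scalar by which the composite of the two intertwiners acts. -/
theorem one_add_diagCoeff_ne_zero (hq : Generic q) {c d : ℤ} (h : c ≠ d) (h1 : c ≠ d + 1)
    (h2 : d ≠ c + 1) :
    1 + diagCoeff q (q ^ (2 * c)) (q ^ (2 * d)) * diagCoeff q (q ^ (2 * d)) (q ^ (2 * c)) ≠ 0 := by
  have h0 := hq.ne_zero
  obtain ⟨e, rfl⟩ : ∃ e, d = c + e := ⟨d - c, by ring⟩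
  have n0 : q ^ (2 * (c + e)) - q ^ (2 * c) ≠ 0 := by
    rw [sub_ne_zero, Ne, hq.two_zpow_inj]
    omega
  have n0' : q ^ (2 * c) - q ^ (2 * (c + e)) ≠ 0 := by
    rw [sub_ne_zero, Ne, hq.two_zpow_inj]
    omega
  have n1 : q ^ (2 * (c + e)) - q ^ (2 * (c + 1)) ≠ 0 := by
    rw [sub_ne_zero, Ne, hq.two_zpow_inj]
    omega
  have n2 : q ^ (2 * (c + e)) - q ^ (2 * (c - 1)) ≠ 0 := by
    rw [sub_ne_zero, Ne, hq.two_zpow_inj]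
    omega
  have k1 : q ^ (2 * (c + 1)) = q ^ (2 * c) * q ^ 2 := by
    rw [mul_add, zpow_add₀ h0]; norm_num [zpow_ofNat]
  have k2 : q ^ (2 * (c - 1)) = q ^ (2 * c) * (q⁻¹) ^ 2 := by
    rw [mul_sub, zpow_sub₀ h0, div_eq_mul_inv, inv_pow]
    norm_num [zpow_ofNat]
  rw [k1] at n1
  rw [k2] at n2
  have hqq : q * q⁻¹ = 1 := mul_inv_cancel₀ h0
  intro h3
  refine mul_ne_zero n1 n2 ?_
  rw [diagCoeff, diagCoeff, div_mul_div_comm, ← div_self (mul_ne_zero n0 n0'), ← add_div,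
    div_eq_zero_iff, or_iff_left (mul_ne_zero n0 n0')] at h3
  linear_combination -h3 + (2 + q * q⁻¹ - 1) * (q ^ (2 * c)) ^ 2 * hqq -
    2 * q ^ (2 * c) * q ^ (2 * (c + e)) * hqq

end Hecke

/-! ### Weights of the Jucys–Murphy elements -/

section Hecke

variable {K : Type*} [Field K] {A : Type*} [Ring A] [Algebra K A] {q : K} {n : ℕ} {s : ℕ → A}

/-- `x` is a joint eigenvector of the Jucys--Murphy elements with the given contents
(the latest one first). -/
def IsWt (q : K) (s : ℕ → A) : List ℤ → A → Prop
  | [], _ => True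
  | c :: l, x => jm s l.length * x = q ^ (2 * c) • x ∧ IsWt q s l x

theorem IsWt.zero (l : List ℤ) : IsWt q s l (0 : A) := by
  induction l with
  | nil => trivial
  | cons c l ih => exact ⟨by simp, ih⟩

theorem IsWt.add {l : List ℤ} {x y : A} (hx : IsWt q s l x) (hy : IsWt q s l y) :
    IsWt q s l (x + y) := by
  induction l with
  | nil => trivial
  | cons c l ih => exact ⟨by rw [mul_add, hx.1, hy.1, smul_add], ih hx.2 hy.2⟩

theorem IsWt.smul {l : List ℤ} {x : A} (a : K) (hx : IsWt q s l x) : IsWt q s l (a • x) := by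
  induction l with
  | nil => trivial
  | cons c l ih => exact ⟨by rw [mul_smul_comm, hx.1, smul_comm], ih hx.2⟩

theorem IsWt.sub {l : List ℤ} {x y : A} (hx : IsWt q s l x) (hy : IsWt q s l y) :
    IsWt q s l (x - y) := by
  have := hx.add (hy.smul (-1))
  rwa [neg_one_smul, ← sub_eq_add_neg] at this

theorem IsWt.mul_right {l : List ℤ} {x : A} (hx : IsWt q s l x) (y : A) : IsWt q s l (x * y) := by
  induction l with
  | nil => trivial
  | cons c l ih => exact ⟨by rw [← mul_assoc, hx.1, smul_mul_assoc], ih hx.2⟩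

theorem IsWt.mul_left {l : List ℤ} {x g : A} (hx : IsWt q s l x)
    (hg : ∀ j < l.length, Commute g (jm s j)) : IsWt q s l (g * x) := by
  induction l with
  | nil => trivial
  | cons c l ih =>
    refine ⟨?_, ih hx.2 fun j hj => hg j (by simp; omega)⟩
    rw [← mul_assoc, ← (hg l.length (by simp)).eq, mul_assoc, hx.1, mul_smul_comm]

theorem IsWt.of_append {l l' : List ℤ} {x : A} (hx : IsWt q s (l' ++ l) x) : IsWt q s l x := by
  induction l' with
  | nil => exact hx
  | cons c l' ih => exact ih hx.2

theorem aeval_mul_of_eigen {X x : A} {a : K} (h : X * x = a • x) (P : Polynomial K) :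
    Polynomial.aeval X P * x = P.eval a • x := by
  induction P using Polynomial.induction_on with
  | C b => simp [Algebra.algebraMap_eq_smul_one]
  | add P Q hP hQ => rw [map_add, add_mul, hP, hQ, Polynomial.eval_add, add_smul]
  | monomial n b ih =>
    rw [pow_succ, ← mul_assoc, map_mul, Polynomial.aeval_X, mul_assoc, h, mul_smul_comm, ih,
      Polynomial.eval_mul (q := Polynomial.X), Polynomial.eval_X, smul_smul, mul_comm]

theorem aeval_eigen_factor {X : A} (a : K) (P : Polynomial K) (x : A)
    (h : Polynomial.aeval X ((Polynomial.X - Polynomial.C a) * P) * x = 0) :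
    X * (Polynomial.aeval X P * x) = a • (Polynomial.aeval X P * x) := by
  rw [map_mul, map_sub, Polynomial.aeval_X, Polynomial.aeval_C, sub_mul, sub_mul,
    Algebra.algebraMap_eq_smul_one, smul_mul_assoc, one_mul, sub_eq_zero] at h
  rw [← mul_assoc, h, smul_mul_assoc]

theorem commute_aeval {X g : A} (h : Commute g X) (P : Polynomial K) :
    Commute g (Polynomial.aeval X P) := by
  induction P using Polynomial.induction_on with
  | C b => rw [Polynomial.aeval_C]; exact (Algebra.commutes b g).symm
  | add P Q hP hQ => rw [map_add]; exact hP.add_right hQ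
  | monomial n b ih =>
    rw [pow_succ, ← mul_assoc, map_mul, Polynomial.aeval_X]
    exact ih.mul_right h

/-! ### Exchange of paths with the same end -/

/-- The weight spaces of the two lists of contents are identified by mutually inverse elements
that commute with the later Jucys--Murphy elements. -/
def Linked (q : K) (n : ℕ) (s : ℕ → A) (l l' : List ℤ) : Prop :=
  l.length = l'.length ∧ ∃ g h : A,
    (∀ x, IsWt q s l x → IsWt q s l' (g * x) ∧ h * (g * x) = x) ∧
    (∀ x, IsWt q s l' x → IsWt q s l (h * x) ∧ g * (h * x) = x) ∧
    (∀ j, l.length ≤ j → j < n → Commute g (jm s j) ∧ Commute h (jm s j))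

theorem Linked.refl (l : List ℤ) : Linked q n s l l :=
  ⟨rfl, 1, 1, fun x hx => by simpa using hx, fun x hx => by simpa using hx,
    fun j _ _ => ⟨Commute.one_left _, Commute.one_left _⟩⟩

theorem Linked.symm {l l' : List ℤ} (h : Linked q n s l l') : Linked q n s l' l := by
  obtain ⟨e, g, g', h1, h2, h3⟩ := h
  exact ⟨e.symm, g', g, h2, h1, fun j hj hn => (h3 j (by omega) hn).symm⟩

theorem Linked.trans {l l' l'' : List ℤ} (h : Linked q n s l l') (h' : Linked q n s l' l'') :
    Linked q n s l l'' := by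
  obtain ⟨e, g, k, h1, h2, h3⟩ := h
  obtain ⟨e', g', k', h1', h2', h3'⟩ := h'
  refine ⟨e.trans e', g' * g, k * k', fun x hx => ?_, fun x hx => ?_, fun j hj hn => ?_⟩
  · obtain ⟨a, b⟩ := h1 x hx
    obtain ⟨a', b'⟩ := h1' _ a
    rw [mul_assoc, mul_assoc]
    exact ⟨a', by rw [b', b]⟩
  · obtain ⟨a, b⟩ := h2' x hx
    obtain ⟨a', b'⟩ := h2 _ a
    rw [mul_assoc, mul_assoc]
    exact ⟨a', by rw [b', b]⟩
  · obtain ⟨a, b⟩ := h3 j hj hn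
    obtain ⟨a', b'⟩ := h3' j (by omega) hn
    exact ⟨a'.mul_left a, b.mul_left b'⟩

/-- The linking elements commute with the later Jucys–Murphy elements, so they preserve the next
eigenvalue as well. -/
theorem Linked.cons {l l' : List ℤ} (h : Linked q n s l l') (hl : l.length < n) (c : ℤ) :
    Linked q n s (c :: l) (c :: l') := by
  obtain ⟨e, g, k, h1, h2, h3⟩ := h
  obtain ⟨hg, hk⟩ := h3 l.length le_rfl hl
  refine ⟨by simp [e], g, k, fun x hx => ⟨⟨?_, (h1 x hx.2).1⟩, (h1 x hx.2).2⟩,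
    fun x hx => ⟨⟨?_, (h2 x hx.2).1⟩, (h2 x hx.2).2⟩, fun j hj => h3 j (by simp at hj; omega)⟩
  · rw [← e, ← mul_assoc, ← hg.eq, mul_assoc, hx.1, mul_smul_comm]
  · rw [← mul_assoc, ← hk.eq, mul_assoc, e, hx.1, mul_smul_comm]

theorem HeckeGens.commute_gen_jm (H : HeckeGens q n s) {k j : ℕ} (hk : k + 1 < n) (hj : j < n)
    (h : j < k ∨ k + 2 ≤ j) : Commute (s k) (jm s j) := by
  rcases h with h | h
  · exact H.commute_jm_of_lt h hk
  · exact H.commute_jm_of_ge h hj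

/-- The intertwiners s - α and s - β exchange the two eigenvalues, and on weight vectors their
product is the scalar 1 + αβ, invertible for contents that are not neighbours. -/
theorem HeckeGens.linked_swap (hq : Generic q) (H : HeckeGens q n s) {c d : ℤ} {l : List ℤ}
    (hn : l.length + 1 < n) (h : c ≠ d) (h1 : c ≠ d + 1) (h2 : d ≠ c + 1) :
    Linked q n s (c :: d :: l) (d :: c :: l) := by
  have hcd : q ^ (2 * d) ≠ q ^ (2 * c) := by rwa [Ne, hq.two_zpow_inj, eq_comm]
  have key : ∀ (c d : ℤ), q ^ (2 * d) ≠ q ^ (2 * c) → ∀ x, IsWt q s (c :: d :: l) x →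
      IsWt q s (d :: c :: l) (s l.length * x - diagCoeff q (q ^ (2 * d)) (q ^ (2 * c)) • x) := by
    intro c d hcd x hx
    obtain ⟨e1, e2, -⟩ := H.swap_spec hn hcd hx.2.1 hx.1
    refine ⟨e2, e1, (hx.2.2.mul_left fun j hj => ?_).sub (hx.2.2.smul _)⟩
    exact H.commute_gen_jm hn (by omega) (Or.inl hj)
  set α := diagCoeff q (q ^ (2 * d)) (q ^ (2 * c)) with hα
  set β := diagCoeff q (q ^ (2 * c)) (q ^ (2 * d)) with hβ
  have hne : 1 + α * β ≠ 0 := one_add_diagCoeff_ne_zero hq (Ne.symm h) h2 h1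
  have ex : ∀ (γ : K) (x : A), (s l.length - algebraMap K A γ) * x = s l.length * x - γ • x := by
    intro γ x
    rw [sub_mul, Algebra.algebraMap_eq_smul_one, smul_mul_assoc, one_mul]
  have hc : ∀ j, l.length + 2 ≤ j → j < n → Commute (s l.length) (jm s j) := fun j hj hjn =>
    H.commute_gen_jm hn hjn (Or.inr hj)
  refine ⟨rfl, s l.length - algebraMap K A α, (1 + α * β)⁻¹ • (s l.length - algebraMap K A β),
    fun x hx => ?_, fun x hx => ?_, fun j hj hjn => ⟨?_, ?_⟩⟩
  · rw [ex, smul_mul_assoc, ex]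
    refine ⟨key c d hcd x hx, ?_⟩
    rw [(H.swap_spec hn hcd hx.2.1 hx.1).2.2, add_sub_cancel_left, smul_smul,
      inv_mul_cancel₀ hne, one_smul]
  · rw [smul_mul_assoc, mul_smul_comm, ex, ex]
    refine ⟨(key d c hcd.symm x hx).smul _, ?_⟩
    rw [(H.swap_spec hn hcd.symm hx.2.1 hx.1).2.2, add_sub_cancel_left, smul_smul,
      ← hα, ← hβ, mul_comm β, inv_mul_cancel₀ hne, one_smul]
  · exact (hc j hj hjn).sub_left (Algebra.commutes _ _)
  · exact ((hc j hj hjn).sub_left (Algebra.commutes _ _)).smul_left _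

/-- Tableaux of the same shape are connected by admissible transpositions of consecutive entries. -/
theorem HeckeGens.linked_of_state_eq (hq : Generic q) (H : HeckeGens q n s) {l l' : List ℤ}
    (hl : IsPath l) (hl' : IsPath l') (hlen : l.length = l'.length) (hn : l.length ≤ n)
    (h : state l = state l') : Linked q n s l l' := by
  induction hk : l.length using Nat.strong_induction_on generalizing l l' with
  | _ k ih =>
    match l, l' with
    | [], [] => exact Linked.refl _
    | [], _ :: _ => simp at hlen
    | _ :: _, [] => simp at hlen
    | c :: l₁, d :: l₂ =>
      simp only [List.length_cons] at hk hlen hn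
      have e := fun x => Set.ext_iff.1 h x
      by_cases hcd : c = d
      · subst hcd
        refine (ih l₁.length (by omega) hl.1 hl'.1 (by omega) (by omega) ?_ rfl).cons (by omega) c
        ext x
        have := e x
        have a1 := hl.2
        have a2 := hl'.2
        simp only [mem_state_cons] at this
        grind
      · have b1 := e (c + 1)
        have b2 := e (d + 1)
        have b3 := e c
        have b4 := e d
        have a1 := hl.2
        have a2 := hl'.2
        simp only [mem_state_cons] at b1 b2 b3 b4
        -- Both c and d are removable from the common state, hence not neighbours. A path l₃ to the
        -- state with both removed gives the chain c :: l₁, c :: d :: l₃, d :: c :: l₃, d :: l₂.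
        obtain ⟨l₃, p1, p2, p3⟩ := exists_path_of_removable hl.1 (c := d) (by grind) (by grind)
        have p4 : IsPath (c :: d :: l₃) := hl.cons_congr p1 p2.symm
        have n1 : c ≠ d + 1 := by grind
        have n2 : d ≠ c + 1 := by grind
        have p5 := p4.swap n1 n2
        have L1 := ih l₁.length (by omega) hl.1 p1 (by simp; omega) (by omega) p2.symm rfl
        have L2 := ih l₂.length (by omega) hl'.1 p5.1 (by simp; omega) (by omega) (by
          ext x
          have b := e x
          have b' := Set.ext_iff.1 p2 x
          have a5 := p5.2
          simp only [mem_state_cons] at b b' a5 ⊢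
          have b3' := Set.ext_iff.1 p2 c
          have b4' := Set.ext_iff.1 p2 d
          simp only [mem_state_cons] at b3' b4'
          grind) rfl
        exact ((L1.cons (by omega) c).trans (H.linked_swap hq (by omega) hcd n1 n2)).trans
          (L2.symm.cons (by simp; omega) d)

/-! ### The spectrum of the Jucys--Murphy elements -/

/-- The polynomial whose roots are the eigenvalues that extend the list of contents. -/
noncomputable def annPoly (q : K) (l : List ℤ) : Polynomial K :=
  ∏ c ∈ addable l, (Polynomial.X - Polynomial.C (q ^ (2 * c)))

theorem eval_annPoly_ne_zero (hq : Generic q) {l : List ℤ} {c : ℤ} (hc : c ∉ addable l) :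
    (annPoly q l).eval (q ^ (2 * c)) ≠ 0 := by
  rw [annPoly, Polynomial.eval_prod, Finset.prod_ne_zero_iff]
  intro d hd
  rw [Polynomial.eval_sub, Polynomial.eval_X, Polynomial.eval_C, sub_ne_zero, Ne, hq.two_zpow_inj]
  rintro rfl
  exact hc hd

/-- The list of contents extends to the next Jucys--Murphy element only by addable boxes. -/
def SpecAt (q : K) (s : ℕ → A) (l : List ℤ) : Prop :=
  ∀ x, IsWt q s l x → Polynomial.aeval (jm s l.length) (annPoly q l) * x = 0

theorem SpecAt.eq_zero (hq : Generic q) {l : List ℤ} (h : SpecAt q s l) {c : ℤ}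
    (hc : c ∉ addable l) {x : A} (hx : IsWt q s (c :: l) x) : x = 0 := by
  have := h x hx.2
  rw [aeval_mul_of_eigen hx.1] at this
  exact (smul_eq_zero.1 this).resolve_left (eval_annPoly_ne_zero hq hc)

/-- The intertwined vector would have content c immediately after l, which the spectrum forbids; so
it vanishes and the generator acts by its diagonal coefficient. -/
theorem HeckeGens.gen_mul_of_adjacent (hq : Generic q) (H : HeckeGens q n s) {l : List ℤ}
    {c d : ℤ} (hn : l.length + 1 < n) (hs : SpecAt q s l) (hcd : c ≠ d) (hc : c ∉ addable l) {x : A}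
    (hx : IsWt q s (c :: d :: l) x) :
    s l.length * x = diagCoeff q (q ^ (2 * d)) (q ^ (2 * c)) • x := by
  have hcd' : q ^ (2 * d) ≠ q ^ (2 * c) := by rwa [Ne, hq.two_zpow_inj, eq_comm]
  obtain ⟨e1, -, -⟩ := H.swap_spec hn hcd' hx.2.1 hx.1
  refine sub_eq_zero.1 (hs.eq_zero hq hc ⟨e1, (hx.2.2.mul_left fun j hj => ?_).sub (hx.2.2.smul _)⟩)
  exact H.commute_gen_jm hn (by omega) (Or.inl hj)

/-- On a common eigenvector the braid relation reads aba = bab, forcing a = b. -/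
theorem HeckeGens.braid_contradiction (H : HeckeGens q n s) {k : ℕ}
    (hk : k + 2 < n) {x : A} {a b : K} (h1 : s k * x = a • x) (h2 : s (k + 1) * x = b • x)
    (ha : a ≠ 0) (hb : b ≠ 0) (hab : a ≠ b) : x = 0 := by
  have e := congrArg (· * x) (H.braid k hk)
  simp only [mul_assoc, h1, h2, mul_smul_comm, smul_smul] at e
  rw [← sub_eq_zero, ← sub_smul, smul_eq_zero] at e
  refine e.resolve_left ?_
  have : a * (b * a) - b * (a * b) = a * b * (a - b) := by ring
  rw [this]
  exact mul_ne_zero (mul_ne_zero ha hb) (sub_ne_zero.2 hab)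

/-- A box next to the latest one, but not addable, does not occur in the spectrum. -/
theorem HeckeGens.exclude (hq : Generic q) (H : HeckeGens q n s) {l : List ℤ} {c d : ℤ}
    (hl : IsPath (c :: l)) (hn : l.length + 1 < n) (hd : d = c + 1 ∨ c = d + 1)
    (hda : d ∉ addable (c :: l))
    (hs : ∀ l', IsPath l' → l'.length ≤ l.length → SpecAt q s l') {x : A}
    (hx : IsWt q s (d :: c :: l) x) : x = 0 := by
  rw [mem_addable hl] at hda
  have a1 := hl.2
  simp only [mem_state_cons] at hda
  -- Since d neighbours c and is not addable after c, a box of content d is removable from l. Making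
  -- it the last box of l produces consecutive contents d, c, d, where neither exchange is allowed:
  -- two adjacent generators then act by the different scalars q and -q⁻¹.
  obtain ⟨l₁, p1, p2, p3⟩ := exists_path_of_removable hl.1 (c := d) (by grind) (by grind)
  have p4 : IsPath (c :: d :: l₁) := hl.cons_congr p1 p2.symm
  have L : Linked q n s (c :: l) (c :: d :: l₁) := H.linked_of_state_eq hq hl p4 (by simp; omega)
    (by simp; omega) (state_cons_congr p2.symm)
  obtain ⟨-, g, h, h1, -, h3⟩ := L.cons (by simp; omega) d
  obtain ⟨w, e⟩ := h1 x hx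
  set y := g * x
  suffices y = 0 by rw [← e, this, mul_zero]
  have hcd : c ≠ d := by omega
  have t1 := H.gen_mul_of_adjacent hq (by omega) (hs l₁ p1.1 (by omega)) hcd (by
    rw [mem_addable p1.1]
    have p1' := p1.2
    have p4' := p4.2
    simp only [mem_state_cons] at p4'
    grind) w.2
  have t2 := H.gen_mul_of_adjacent hq (by simp; omega) (hs (d :: l₁) p1 (by simp; omega)) hcd.symm
    (by rw [mem_addable p1, mem_state_cons]; omega) w
  simp only [List.length_cons] at t2
  have hm : q ≠ -q⁻¹ := fun h => hq.add_inv_ne_zero (by linear_combination h)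
  have h0 := hq.ne_zero
  rcases hd with rfl | rfl
  · rw [diagCoeff_succ_self hq] at t1
    rw [diagCoeff_self_succ hq] at t2
    exact H.braid_contradiction (by omega) t1 t2 (by simpa) h0 hm.symm
  · rw [diagCoeff_self_succ hq] at t1
    rw [diagCoeff_succ_self hq] at t2
    exact H.braid_contradiction (by omega) t1 t2 h0 (by simpa) hm

/-- If `X` takes the value `a` on a `Y`-stable space `W` and `(X - a) Q(X)` annihilates `σ W`, then
`(Y - q² a) (Y - q⁻² a) Q(Y)` annihilates `W`. -/
theorem affine_annihilator (hq0 : q ≠ 0) {σ X Y : A} (hσ : σ * σ = (q - q⁻¹) • σ + 1)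
    (hrel : X * σ = σ * Y - (q - q⁻¹) • Y) (a : K) (Q : Polynomial K) (W : Submodule K A)
    (hY : ∀ z ∈ W, Y * z ∈ W) (hX : ∀ z ∈ W, X * z = a • z)
    (hann : ∀ z ∈ W, Polynomial.aeval X (Q * (Polynomial.X - Polynomial.C a)) * (σ * z) = 0)
    {x : A} (hx : x ∈ W) :
    Polynomial.aeval Y ((Polynomial.X - Polynomial.C (a * q ^ 2)) *
      ((Polynomial.X - Polynomial.C (a * q⁻¹ ^ 2)) * Q)) * x = 0 := by
  have ev : ∀ (z : A) (b : K) (T : A), Polynomial.aeval T (Polynomial.X - Polynomial.C b) * z =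
      T * z - b • z := by
    intro z b T
    rw [map_sub, Polynomial.aeval_X, Polynomial.aeval_C, sub_mul,
      Algebra.algebraMap_eq_smul_one, smul_mul_assoc, one_mul]
  have hXσ : ∀ z, X * (σ * z) = σ * (Y * z) - (q - q⁻¹) • (Y * z) := by
    intro z
    rw [← mul_assoc, hrel, sub_mul, mul_assoc, smul_mul_assoc]
  have hσσ : ∀ z, σ * (σ * z) = (q - q⁻¹) • (σ * z) + z := by
    intro z
    rw [← mul_assoc, hσ, add_mul, one_mul, smul_mul_assoc]
  have hYW : ∀ P : Polynomial K, ∀ z ∈ W, Polynomial.aeval Y P * z ∈ W := by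
    intro P
    induction P using Polynomial.induction_on with
    | C b =>
      intro z hz
      rw [Polynomial.aeval_C, Algebra.algebraMap_eq_smul_one, smul_mul_assoc, one_mul]
      exact W.smul_mem b hz
    | add P R hP hR =>
      intro z hz
      rw [map_add, add_mul]
      exact W.add_mem (hP z hz) (hR z hz)
    | monomial m b ih =>
      intro z hz
      rw [pow_succ, ← mul_assoc, map_mul, Polynomial.aeval_X, mul_assoc]
      exact ih _ (hY z hz)
  -- On W the map z ↦ (X - a)σz intertwines Y with X; `int2` extends this to all polynomials.
  have int1 : ∀ z ∈ W, X * (X * (σ * z) - a • (σ * z)) =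
      X * (σ * (Y * z)) - a • (σ * (Y * z)) := by
    intro z hz
    rw [mul_sub, mul_smul_comm, hXσ z, mul_sub, mul_smul_comm, hX _ (hY z hz)]
    module
  have int2 : ∀ (P : Polynomial K), ∀ z ∈ W,
      Polynomial.aeval X P * (X * (σ * z) - a • (σ * z)) =
      X * (σ * (Polynomial.aeval Y P * z)) - a • (σ * (Polynomial.aeval Y P * z)) := by
    intro P
    induction P using Polynomial.induction_on with
    | C b =>
      intro z _
      simp only [Polynomial.aeval_C, Algebra.algebraMap_eq_smul_one, smul_mul_assoc, one_mul,
        mul_smul_comm, smul_sub, smul_comm b a]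
    | add P R hP hR =>
      intro z hz
      rw [map_add, map_add, add_mul, hP z hz, hR z hz]
      simp only [add_mul, mul_add, smul_add]
      abel
    | monomial m b ih =>
      intro z hz
      rw [pow_succ, ← mul_assoc, map_mul (Polynomial.aeval X) _ Polynomial.X,
        map_mul (Polynomial.aeval Y) _ Polynomial.X, Polynomial.aeval_X, Polynomial.aeval_X,
        mul_assoc, int1 z hz, hXσ, ← hXσ, ih _ (hY z hz), mul_assoc]
  -- By `int2` the hypothesis `hann` becomes (X - a)σ Q(Y)z = 0; the affine relation rewrites Xσ.
  have hu : ∀ z ∈ W, σ * (Y * (Polynomial.aeval Y Q * z)) =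
      (q - q⁻¹) • (Y * (Polynomial.aeval Y Q * z)) + a • (σ * (Polynomial.aeval Y Q * z)) := by
    intro z hz
    have h1 := hann z hz
    rw [map_mul, mul_assoc, ev, int2 Q z hz, hXσ] at h1
    rw [← sub_eq_zero, ← h1]
    abel
  -- Multiplying `hu` by σ and using the quadratic relation expresses Yu through u and σu. Using
  -- this for x and for Yx and eliminating σu leaves a quadratic equation for Y on u with roots q²a
  -- and q⁻²a.
  have hu2 : ∀ z ∈ W, Y * (Polynomial.aeval Y Q * z) = a • (Polynomial.aeval Y Q * z) +
      ((q - q⁻¹) * a) • (σ * (Polynomial.aeval Y Q * z)) := by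
    intro z hz
    have h1 := congrArg (σ * ·) (hu z hz)
    simp only [mul_add, mul_smul_comm, hσσ] at h1
    rw [add_comm, hu z hz, smul_add, smul_smul] at h1
    rw [← sub_eq_zero] at h1 ⊢
    rw [← h1]
    module
  set u := Polynomial.aeval Y Q * x with hu_def
  have hcm : Y * u = Polynomial.aeval Y Q * (Y * x) := by
    rw [hu_def, ← mul_assoc, ← mul_assoc, (commute_aeval (Commute.refl Y) Q).eq]
  have e := hu2 _ (hY x hx)
  rw [← hcm, hu x hx] at e
  have e' := hu2 x hx
  rw [map_mul (Polynomial.aeval Y), map_mul (Polynomial.aeval Y), mul_assoc, mul_assoc, ev, ev,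
    mul_sub, mul_smul_comm, ← hu_def, e]
  have hqq : q * q⁻¹ = 1 := mul_inv_cancel₀ hq0
  have f1 : ((q - q⁻¹) * a) • (a • (σ * u)) = a • (Y * u - a • u) := by
    rw [← hu_def] at e'
    rw [e', add_sub_cancel_left, smul_comm]
  rw [smul_add ((q - q⁻¹) * a), f1, ← hu_def, ← sub_eq_zero]
  match_scalars
  · linear_combination (-2 * a) * hqq
  · linear_combination (a * a * (q * q⁻¹ + 1)) * hqq

/-- Adding a box of content c keeps the other addable boxes and creates candidates only at c + 1 and
c - 1. These are exactly the roots supplied by `affine_annihilator`, and `exclude` discards a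
candidate that is not addable. -/
theorem HeckeGens.specAt_cons (hq : Generic q) (H : HeckeGens q n s) {l : List ℤ} {c : ℤ}
    (hl : IsPath (c :: l)) (hn : l.length + 1 < n)
    (hs : ∀ l', IsPath l' → l'.length ≤ l.length → SpecAt q s l') : SpecAt q s (c :: l) := by
  have hc : c ∈ addable l := (mem_addable' hl.1).2 hl
  have hQ : annPoly q l = (∏ d ∈ (addable l).erase c, (Polynomial.X - Polynomial.C (q ^ (2 * d)))) *
      (Polynomial.X - Polynomial.C (q ^ (2 * c))) := by
    rw [annPoly, ← Finset.mul_prod_erase _ _ hc, mul_comm]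
  have h0 := hq.ne_zero
  have k1 : q ^ (2 * c) * q ^ 2 = q ^ (2 * (c + 1)) := by
    rw [mul_add, zpow_add₀ h0]; norm_num [zpow_ofNat]
  have k2 : q ^ (2 * c) * q⁻¹ ^ 2 = q ^ (2 * (c - 1)) := by
    rw [mul_sub, zpow_sub₀ h0, div_eq_mul_inv, inv_pow]; norm_num [zpow_ofNat]
  have hYw : ∀ (P : Polynomial K) (z : A), IsWt q s (c :: l) z →
      IsWt q s (c :: l) (Polynomial.aeval (jm s (l.length + 1)) P * z) := by
    intro P z hz
    refine hz.mul_left fun j hj => (commute_aeval ?_ P).symm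
    exact H.commute_jm (by simp at hj; omega) hn
  have hall : ∀ x, IsWt q s (c :: l) x → Polynomial.aeval (jm s (l.length + 1))
      ((Polynomial.X - Polynomial.C (q ^ (2 * (c + 1)))) *
        ((Polynomial.X - Polynomial.C (q ^ (2 * (c - 1)))) *
          ∏ d ∈ (addable l).erase c, (Polynomial.X - Polynomial.C (q ^ (2 * d))))) * x = 0 := by
    intro x hx
    rw [← k1, ← k2]
    refine affine_annihilator h0 (H.quad _ hn) (H.jm_mul_gen hn) (q ^ (2 * c)) _
      { carrier := {z | IsWt q s (c :: l) z}
        add_mem' := fun h h' => h.add h'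
        zero_mem' := IsWt.zero _
        smul_mem' := fun a _ h => h.smul a } (fun z hz => ?_) (fun z hz => hz.1) (fun z hz => ?_) hx
    · simpa using hYw Polynomial.X z hz
    · rw [← hQ]
      exact hs l hl.1 le_rfl _ (hz.2.mul_left fun j hj => H.commute_gen_jm hn (by omega) (Or.inl hj))
  -- If (Y - q^{2d})G(Y) kills x, then G(Y)x has weight d :: c :: l and vanishes by `exclude`, so
  -- the factor can be omitted.
  have hdrop : ∀ d, (d = c + 1 ∨ c = d + 1) → d ∉ addable (c :: l) → ∀ G : Polynomial K,
      (∀ x, IsWt q s (c :: l) x → Polynomial.aeval (jm s (l.length + 1))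
        ((Polynomial.X - Polynomial.C (q ^ (2 * d))) * G) * x = 0) →
      ∀ x, IsWt q s (c :: l) x → Polynomial.aeval (jm s (l.length + 1)) G * x = 0 :=
    fun d hd hda G hG x hx => H.exclude hq hl hn hd hda hs
      ⟨aeval_eigen_factor _ G x (hG x hx), hYw G x hx⟩
  have ha1 := hl.2
  have hsub : ∀ d ∈ (addable l).erase c, d ∈ addable (c :: l) := by
    intro d hd
    rw [Finset.mem_erase, mem_addable hl.1] at hd
    rw [mem_addable hl]
    simp only [mem_state_cons]
    grind
  have n1 : c + 1 ∉ (addable l).erase c := by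
    rw [Finset.mem_erase, mem_addable hl.1]; grind
  have n2 : c - 1 ∉ (addable l).erase c := by
    rw [Finset.mem_erase, mem_addable hl.1]
    have : c - 1 + 1 = c := by ring
    grind
  have n3 : c + 1 ∉ insert (c - 1) ((addable l).erase c) := by
    rw [Finset.mem_insert]
    exact fun h => h.elim (by omega) n1
  have hfin : ∀ S : Finset ℤ, S ⊆ addable (c :: l) → (∀ x, IsWt q s (c :: l) x →
      Polynomial.aeval (jm s (l.length + 1))
        (∏ d ∈ S, (Polynomial.X - Polynomial.C (q ^ (2 * d)))) * x = 0) → SpecAt q s (c :: l) := by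
    intro S hS h x hx
    obtain ⟨W, hW⟩ := Finset.prod_dvd_prod_of_subset S (addable (c :: l))
      (fun d => (Polynomial.X - Polynomial.C (q ^ (2 * d)) : Polynomial K)) hS
    rw [annPoly, hW, mul_comm, map_mul, mul_assoc]
    simp only [List.length_cons]
    rw [h x hx, mul_zero]
  by_cases c1 : c + 1 ∈ addable (c :: l)
  · by_cases c2 : c - 1 ∈ addable (c :: l)
    · refine hfin (insert (c + 1) (insert (c - 1) ((addable l).erase c))) ?_ ?_
      · intro d hd
        simp only [Finset.mem_insert] at hd
        rcases hd with rfl | rfl | hd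
        exacts [c1, c2, hsub d hd]
      · rwa [Finset.prod_insert n3, Finset.prod_insert n2]
    · refine hfin (insert (c + 1) ((addable l).erase c)) ?_ ?_
      · intro d hd
        rcases Finset.mem_insert.1 hd with rfl | hd
        exacts [c1, hsub d hd]
      · rw [Finset.prod_insert n1]
        refine hdrop (c - 1) (by omega) c2 _ ?_
        simpa only [mul_left_comm] using hall
  · by_cases c2 : c - 1 ∈ addable (c :: l)
    · refine hfin (insert (c - 1) ((addable l).erase c)) ?_ ?_
      · intro d hd
        rcases Finset.mem_insert.1 hd with rfl | hd
        exacts [c2, hsub d hd]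
      · rw [Finset.prod_insert n2]
        exact hdrop (c + 1) (by omega) c1 _ hall
    · exact hfin _ hsub (hdrop (c - 1) (by omega) c2 _ (hdrop (c + 1) (by omega) c1 _ hall))

theorem HeckeGens.specAt (hq : Generic q) (H : HeckeGens q n s) {l : List ℤ}
    (hl : IsPath l) (hn : l.length < n) : SpecAt q s l := by
  induction hk : l.length using Nat.strong_induction_on generalizing l with
  | _ k ih =>
    match l with
    | [] =>
      intro x _
      -- The first Jucys–Murphy element is 1 = q⁰, and the empty diagram has one addable box, of
      -- content 0.
      have : addable [] = {0} := by
        ext d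
        rw [mem_addable (l := []) trivial, mem_state_nil, mem_state_nil, Finset.mem_singleton]
        omega
      simp [annPoly, this, jm]
    | c :: l =>
      simp only [List.length_cons] at hk hn
      exact H.specAt_cons hq hl hn fun l' h1 h2 => ih l'.length (by omega) h1 (by omega) rfl

/-! ### Projectors onto weight spaces -/

/-- The Lagrange projector of `X` for the eigenvalue `q^{2c}`, with the contents in `(-N, N)`. -/
noncomputable def proj (q : K) (N : ℕ) (X : A) (c : ℤ) : A :=
  Polynomial.aeval X (Lagrange.basis (Finset.Ioo (-(N : ℤ)) N) (fun c : ℤ => q ^ (2 * c)) c)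

/-- The projector onto the weight space of a list of contents. -/
noncomputable def wtProj (q : K) (s : ℕ → A) (N : ℕ) : List ℤ → A
  | [] => 1
  | c :: l => wtProj q s N l * proj q N (jm s l.length) c

theorem proj_mul_of_eigen (hq : Generic q) {N : ℕ} {X x : A} {c d : ℤ}
    (hc : c ∈ Finset.Ioo (-(N : ℤ)) N) (hd : d ∈ Finset.Ioo (-(N : ℤ)) N)
    (h : X * x = q ^ (2 * d) • x) : proj q N X c * x = if c = d then x else 0 := by
  rw [proj, aeval_mul_of_eigen h]
  split_ifs with hcd
  · subst hcd
    rw [Lagrange.eval_basis_self (v := fun c : ℤ => q ^ (2 * c))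
      (fun a _ b _ hab => hq.two_zpow_inj.1 hab) hc, one_smul]
  · rw [Lagrange.eval_basis_of_ne (v := fun c : ℤ => q ^ (2 * c)) hcd hd, zero_smul]

theorem sum_proj {N : ℕ} (hq : Generic q) (hN : 0 < N) (X : A) :
    ∑ c ∈ Finset.Ioo (-(N : ℤ)) N, proj q N X c = 1 := by
  simp only [proj]
  rw [← map_sum, Lagrange.sum_basis (fun a _ b _ hab => hq.two_zpow_inj.1 hab)
    ⟨0, by simpa using hN⟩, map_one]

theorem IsPath.mem_Ioo {c : ℤ} {l : List ℤ} (hl : IsPath (c :: l)) {N : ℕ} (hN : l.length < N) :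
    c ∈ Finset.Ioo (-(N : ℤ)) N := by
  have := hl.content_bounds
  rw [Finset.mem_Ioo]
  omega

/-- The Lagrange basis polynomial times X - q^{2c} is a multiple of the nodal polynomial, which
`annPoly q l` divides because all addable contents lie among the nodes. -/
theorem HeckeGens.eigen_proj (hq : Generic q) (H : HeckeGens q n s) {l : List ℤ} (hl : IsPath l)
    {N : ℕ} (hn : l.length < n) (hN : l.length < N) {c : ℤ} (hc : c ∈ Finset.Ioo (-(N : ℤ)) N)
    {x : A} (hx : IsWt q s l x) : IsWt q s (c :: l) (proj q N (jm s l.length) c * x) := by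
  refine ⟨?_, hx.mul_left fun j hj => (commute_aeval (H.commute_jm (by omega) hn) _).symm⟩
  have hsub : addable l ⊆ Finset.Ioo (-(N : ℤ)) N := fun d hd =>
    ((mem_addable' hl).1 hd).mem_Ioo hN
  have h1 : (annPoly q l) ∣ ∏ d ∈ Finset.Ioo (-(N : ℤ)) N,
      (Polynomial.X - Polynomial.C (q ^ (2 * d))) := Finset.prod_dvd_prod_of_subset _ _ _ hsub
  rw [← Finset.mul_prod_erase _ _ hc] at h1
  obtain ⟨W, hW⟩ := h1
  refine aeval_eigen_factor _ _ x ?_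
  have : (Polynomial.X - Polynomial.C (q ^ (2 * c))) * Lagrange.basis (Finset.Ioo (-(N : ℤ)) N)
      (fun c : ℤ => q ^ (2 * c)) c = Polynomial.C (∏ d ∈ (Finset.Ioo (-(N : ℤ)) N).erase c,
        (q ^ (2 * c) - q ^ (2 * d))⁻¹) * W * annPoly q l := by
    rw [mul_assoc, mul_comm W, ← hW, Lagrange.basis]
    simp only [Lagrange.basisDivisor, Finset.prod_mul_distrib, ← map_prod]
    ring
  rw [this, map_mul, mul_assoc, H.specAt hq hl hn x hx, mul_zero]

theorem HeckeGens.isWt_cons_eq_zero (hq : Generic q) (H : HeckeGens q n s) {l : List ℤ}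
    (hl : IsPath l) {c : ℤ} (hn : l.length < n) (hc : ¬ IsPath (c :: l)) {x : A}
    (hx : IsWt q s (c :: l) x) : x = 0 :=
  (H.specAt hq hl hn).eq_zero hq (by rwa [mem_addable' hl]) hx

/-- Decomposition of a weight vector under the next Jucys--Murphy element. -/
theorem HeckeGens.sum_proj_mul (hq : Generic q) {N : ℕ} (hN : 0 < N) (k : ℕ) (x : A) :
    ∑ c ∈ Finset.Ioo (-(N : ℤ)) N, proj q N (jm s k) c * x = x := by
  rw [← Finset.sum_mul, sum_proj hq hN, one_mul]

theorem HeckeGens.commute_wtProj (N : ℕ) {g : A} {l : List ℤ}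
    (hg : ∀ j < l.length, Commute g (jm s j)) : Commute g (wtProj q s N l) := by
  induction l with
  | nil => exact Commute.one_right g
  | cons c l ih =>
    exact (ih fun j hj => hg j (by simp; omega)).mul_right (commute_aeval (hg _ (by simp)) _)

theorem IsWt.wtProj_mul (hq : Generic q) {N : ℕ} {l : List ℤ} {x : A}
    (hl : ∀ c ∈ l, c ∈ Finset.Ioo (-(N : ℤ)) N) (hx : IsWt q s l x) : wtProj q s N l * x = x := by
  induction l with
  | nil => exact one_mul x
  | cons c l ih =>
    have h1 := hl c (by simp)
    rw [wtProj, mul_assoc, proj_mul_of_eigen hq h1 h1 hx.1, if_pos rfl,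
      ih (fun d hd => hl d (by simp [hd])) hx.2]

theorem IsPath.mem_Ioo' {l : List ℤ} (hl : IsPath l) {N : ℕ} (hN : l.length ≤ N) :
    ∀ c ∈ l, c ∈ Finset.Ioo (-(N : ℤ)) N := by
  induction l with
  | nil => simp
  | cons c l ih =>
    simp only [List.length_cons] at hN
    intro d hd
    rcases List.mem_cons.1 hd with rfl | hd
    · exact hl.mem_Ioo (by omega)
    · exact ih hl.1 (by omega) d hd

theorem HeckeGens.isWt_wtProj (hq : Generic q) (H : HeckeGens q n s) {l : List ℤ} (hl : IsPath l)
    {N : ℕ} (hn : l.length ≤ n) (hN : l.length ≤ N) (x : A) :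
    IsWt q s l (wtProj q s N l * x) := by
  induction l generalizing x with
  | nil => trivial
  | cons c l ih =>
    simp only [List.length_cons] at hn hN
    have hcm : Commute (proj q N (jm s l.length) c) (wtProj q s N l) :=
      HeckeGens.commute_wtProj N fun j hj =>
        (commute_aeval (H.commute_jm (by omega) (by omega)) _).symm
    rw [wtProj, ← hcm.eq, mul_assoc]
    exact H.eigen_proj hq hl.1 (by omega) (by omega) (hl.mem_Ioo (by omega))
      (ih hl.1 (by omega) (by omega) x)

end Hecke

section Hecke

/-! ### The antisymmetrizers -/

/-- The number `1 + q⁻² + ⋯ + q^{-2(k-1)}`. -/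
noncomputable def invQNum {K : Type*} [Field K] (q : K) : ℕ → K
  | 0 => 0
  | k + 1 => 1 + q⁻¹ * q⁻¹ * invQNum q k

theorem invQNum_ne_zero {K : Type*} [Field K] {q : K} (hq : Generic q) (k : ℕ) :
    invQNum q (k + 1) ≠ 0 := by
  have h : ∀ k, (1 - q⁻¹ * q⁻¹) * invQNum q k = 1 - (q⁻¹) ^ (2 * k) := by
    intro k
    induction k with
    | zero => simp [invQNum]
    | succ k ih =>
      rw [invQNum, mul_add, mul_left_comm, ih]
      ring
  intro h0
  have := h (k + 1)
  rw [h0, mul_zero, eq_comm, sub_eq_zero, eq_comm, inv_pow, inv_eq_one] at this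
  exact hq.pow_ne_one _ (by omega) this

variable {K : Type*} [Field K] {A : Type w} [Ring A] [Algebra K A] {q : K} {n : ℕ} {s : ℕ → A}

/-- The antisymmetrizers of a family of Hecke generators. -/
noncomputable def asym (q : K) (s : ℕ → A) : ℕ → A
  | 0 => 1
  -- For `k = 0` the truncated index `k - 1` is harmless, since its coefficient contains `invQNum q
  -- 0 = 0`.
  | k + 1 => (invQNum q (k + 1))⁻¹ •
      (asym q s k - (q⁻¹ * invQNum q k) • (asym q s k * s (k - 1) * asym q s k))

/-- The signed sum over the insertions of the last strand. -/
noncomputable def insSum (q : K) (s : ℕ → A) : ℕ → A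
  | 0 => 0
  | k + 1 => 1 - q⁻¹ • (insSum q s k * s (k - 1))

theorem commute_asym {g : A} {k : ℕ} (h : ∀ i, i + 1 < k → Commute g (s i)) :
    Commute g (asym q s k) := by
  induction k with
  | zero => exact Commute.one_right g
  | succ k ih =>
    have h1 := ih fun i hi => h i (by omega)
    rcases k with _ | k
    · simp only [asym, invQNum, mul_zero, zero_smul, sub_zero]
      exact (Commute.one_right g).smul_right _
    · exact (h1.sub_right (((h1.mul_right (h _ (by simp))).mul_right h1).smul_right _)).smul_right _

theorem commute_insSum {g : A} {k : ℕ} (h : ∀ i, i + 1 < k → Commute g (s i)) :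
    Commute g (insSum q s k) := by
  induction k with
  | zero => exact Commute.zero_right g
  | succ k ih =>
    have h1 := ih fun i hi => h i (by omega)
    rcases k with _ | k
    · simp only [insSum, zero_mul, smul_zero, sub_zero]
      exact Commute.one_right g
    · exact (Commute.one_right g).sub_right ((h1.mul_right (h _ (by simp))).smul_right _)

/-- This fixes the normalization of the recursion: substituting -q⁻¹ for the generator gives 1 + q⁻²
`invQNum q k`, which is `invQNum q (k + 1)`. -/
theorem asym_mul_of_neg (hq : Generic q) {k : ℕ} {x : A}
    (h : ∀ i, i + 1 < k → s i * x = (-q⁻¹) • x) : asym q s k * x = x := by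
  induction k with
  | zero => exact one_mul x
  | succ k ih =>
    have h1 := ih fun i hi => h i (by omega)
    have h2 : (q⁻¹ * invQNum q k) • (asym q s k * s (k - 1) * asym q s k * x) =
        (-(q⁻¹ * q⁻¹ * invQNum q k)) • x := by
      rcases k with _ | k
      · simp [invQNum]
      · rw [mul_assoc, h1, mul_assoc, h _ (by simp), mul_smul_comm, h1, smul_smul]
        congr 1
        ring
    rw [asym, smul_mul_assoc, sub_mul, smul_mul_assoc, h2, h1, neg_smul, sub_neg_eq_add]
    nth_rewrite 1 [← one_smul K x]
    rw [← add_smul, smul_smul]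
    have : 1 + q⁻¹ * q⁻¹ * invQNum q k = invQNum q (k + 1) := rfl
    rw [this, inv_mul_cancel₀ (invQNum_ne_zero hq k), one_smul]

/-- The relations are symmetric under reversal of products, so every left-handed statement yields
its right-handed version in the opposite algebra. -/
theorem HeckeGens.op (H : HeckeGens q n s) : HeckeGens q n fun i => MulOpposite.op (s i) where
  quad i hi := by
    rw [← MulOpposite.op_mul, H.quad i hi]
    rfl
  braid i hi := by
    simp only [← MulOpposite.op_mul, ← mul_assoc]
    rw [H.braid i hi]
  comm i j h hj := by
    simp only [← MulOpposite.op_mul]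
    rw [H.comm i j h hj]

theorem asym_op (k : ℕ) :
    asym q (fun i => MulOpposite.op (s i)) k = MulOpposite.op (asym q s k) := by
  induction k with
  | zero => rfl
  | succ k ih =>
    rw [asym, ih, asym]
    simp only [← MulOpposite.op_mul, ← MulOpposite.op_smul, ← MulOpposite.op_sub, mul_assoc]

theorem mul_insSum {a : A} {k : ℕ} (h : ∀ i, i + 1 < k → a * s i = (-q⁻¹) • a) :
    a * insSum q s k = invQNum q k • a := by
  induction k with
  | zero => simp [insSum, invQNum]
  | succ k ih =>
    have h1 := ih fun i hi => h i (by omega)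
    rw [insSum, mul_sub, mul_one, mul_smul_comm, ← mul_assoc, h1, smul_mul_assoc, invQNum]
    rcases k with _ | k
    · simp [invQNum]
    · rw [h _ (by simp)]
      module

/-- The algebra is quantified inside the induction so that the hypothesis also applies to its
opposite. The sum over insertions of the last strand produces an antisymmetric element c from the
previous antisymmetrizer a; then ac = c, and expanding ac gives back the recursive definition. -/
theorem asym_aux (hq : Generic q) (k : ℕ) : ∀ {A : Type w} [Ring A] [Algebra K A] {s : ℕ → A},
    HeckeGens q (k + 1) s → (∀ i < k, s i * asym q s (k + 1) = (-q⁻¹) • asym q s (k + 1)) ∧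
      insSum q s (k + 1) * asym q s k = invQNum q (k + 1) • asym q s (k + 1) := by
  induction k with
  | zero =>
    intro A _ _ s _
    simp [asym, insSum, invQNum]
  | succ k ih =>
    intro A _ _ s H
    obtain ⟨hl, hB⟩ := ih (H.mono (Nat.le_succ _))
    have hr : ∀ i < k, asym q s (k + 1) * s i = (-q⁻¹) • asym q s (k + 1) := by
      intro i hi
      have := (ih (H.op.mono (Nat.le_succ _))).1 i hi
      rw [asym_op, ← MulOpposite.op_mul, ← MulOpposite.op_smul] at this
      exact MulOpposite.op_injective this
    set a := asym q s (k + 1) with ha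
    set b := insSum q s (k + 1) with hb
    set σ := s k with hσ
    have hσσ : σ * σ = (q - q⁻¹) • σ + 1 := H.quad k (by omega)
    have hqq : q⁻¹ * q = 1 := inv_mul_cancel₀ hq.ne_zero
    set c := insSum q s (k + 2) * a with hc
    have hc' : c = a - q⁻¹ • (b * (σ * a)) := by
      rw [hc, insSum, sub_mul, one_mul, smul_mul_assoc, mul_assoc]
      rfl
    -- The antisymmetrizer on k strands can be split off the left of a and moved across σ; together
    -- with b it becomes a multiple of a, which absorbs the generators from the left.
    have hbs : ∀ i < k, s i * (b * (σ * a)) = (-q⁻¹) • (b * (σ * a)) := by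
      intro i hi
      have h1 : a = asym q s k * a := (asym_mul_of_neg hq fun i hi => hl i (by omega)).symm
      have h2 : Commute σ (asym q s k) :=
        commute_asym fun i hi => H.commute (Or.inr (by omega)) (by omega) (by omega)
      have h3 : b * (σ * a) = b * asym q s k * (σ * a) := by
        rw [mul_assoc, ← mul_assoc (asym q s k), ← h2.eq, mul_assoc, ← h1]
      rw [h3, hB, smul_mul_assoc, mul_smul_comm, ← mul_assoc, hl i hi, smul_mul_assoc, smul_comm]
    have hcl : ∀ i < k + 1, s i * c = (-q⁻¹) • c := by
      intro i hi
      rcases Nat.lt_succ_iff_lt_or_eq.1 hi with hi | rfl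
      · rw [hc', mul_sub, hl i hi, mul_smul_comm, hbs i hi]
        module
      · rw [hc', mul_sub, mul_smul_comm]
        have h3 : σ * (σ * a) = (q - q⁻¹) • (σ * a) + a := by
          rw [← mul_assoc, hσσ, add_mul, one_mul, smul_mul_assoc]
        have h4 : σ * (b * (σ * a)) = σ * (σ * a) + q⁻¹ • (σ * a) - q⁻¹ • (b * (σ * a)) := by
          rcases i with _ | k
          · have : b = 1 := by simp [hb, insSum]
            rw [this, one_mul]
            abel
          · have e1 : b = 1 - q⁻¹ • (insSum q s (k + 1) * s k) := rfl
            have e2 : Commute σ (insSum q s (k + 1)) :=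
              commute_insSum fun i hi => H.commute (Or.inr (by omega)) (by omega) (by omega)
            have e3 : σ * (s k * (σ * a)) = (-q⁻¹) • (s k * (σ * a)) := by
              have := H.braid k (by omega)
              calc σ * (s k * (σ * a)) = (s (k + 1) * s k * s (k + 1)) * a := by
                    rw [hσ]; noncomm_ring
                _ = s k * (s (k + 1) * (s k * a)) := by rw [← this]; noncomm_ring
                _ = _ := by rw [hl k (by omega), mul_smul_comm, mul_smul_comm]
            have e4 : σ * (insSum q s (k + 1) * s k * (σ * a)) =
                (-q⁻¹) • (insSum q s (k + 1) * s k * (σ * a)) := by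
              rw [mul_assoc, ← mul_assoc, e2.eq, mul_assoc, e3, mul_smul_comm]
            rw [e1, sub_mul, one_mul, smul_mul_assoc, mul_sub, mul_smul_comm, e4]
            match_scalars <;> ring
        rw [h4, h3]
        match_scalars
        · linear_combination (-1 : K) * hqq
        · ring
        · ring
    -- Computing ac a second time with `mul_insSum` identifies c with a multiple of the recursively
    -- defined antisymmetrizer.
    have hca : a * c = c := asym_mul_of_neg hq fun i hi => hcl i (by omega)
    have hcc : c = invQNum q (k + 2) • asym q s (k + 2) := by
      rw [asym, smul_smul, mul_inv_cancel₀ (invQNum_ne_zero hq (k + 1)), one_smul, ← hca, hc',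
        mul_sub, mul_smul_comm, ← mul_assoc,
        mul_insSum (a := a) (k := k + 1) fun i hi => hr i (by omega), smul_mul_assoc, smul_smul,
        asym_mul_of_neg hq fun i hi => hl i (by omega), ← mul_assoc]
      rfl
    refine ⟨fun i hi => ?_, hcc⟩
    have h5 : asym q s (k + 2) = (invQNum q (k + 2))⁻¹ • c := by
      rw [hcc, smul_smul, inv_mul_cancel₀ (invQNum_ne_zero hq (k + 1)), one_smul]
    show s i * asym q s (k + 2) = (-q⁻¹) • asym q s (k + 2)
    rw [h5, mul_smul_comm, hcl i hi, smul_comm]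

theorem HeckeGens.gen_mul_asym (hq : Generic q) {k : ℕ} (H : HeckeGens q k s) {i : ℕ}
    (hi : i + 1 < k) : s i * asym q s k = (-q⁻¹) • asym q s k := by
  obtain ⟨k, rfl⟩ : ∃ j, k = j + 1 := ⟨k - 1, by omega⟩
  exact (asym_aux hq k H).1 i (by omega)

theorem HeckeGens.asym_mul_gen (hq : Generic q) {k : ℕ} (H : HeckeGens q k s) {i : ℕ}
    (hi : i + 1 < k) : asym q s k * s i = (-q⁻¹) • asym q s k := by
  have := H.op.gen_mul_asym hq hi
  rw [asym_op, ← MulOpposite.op_mul, ← MulOpposite.op_smul] at this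
  exact MulOpposite.op_injective this

theorem HeckeGens.gen_mul_of_asym (hq : Generic q) {k : ℕ} (H : HeckeGens q k s) {i : ℕ}
    (hi : i + 1 < k) {x : A} (hx : asym q s k * x = x) : s i * x = (-q⁻¹) • x := by
  rw [← hx, ← mul_assoc, H.gen_mul_asym hq hi, smul_mul_assoc]

theorem HeckeGens.asym_mul_asym (hq : Generic q) {k : ℕ} (H : HeckeGens q k s) {j : ℕ}
    (hj : j ≤ k) : asym q s j * asym q s k = asym q s k :=
  asym_mul_of_neg hq fun _ hi => H.gen_mul_asym hq (by omega)

theorem HeckeGens.asym_mul_asym' (hq : Generic q) {k : ℕ} (H : HeckeGens q k s) {j : ℕ}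
    (hj : j ≤ k) : asym q s k * asym q s j = asym q s k := by
  have := H.op.asym_mul_asym hq hj
  rw [asym_op, asym_op, ← MulOpposite.op_mul] at this
  exact MulOpposite.op_injective this

/-! ### The column tableau -/

/-- The contents of the one-column tableau. -/
def colPath : ℕ → List ℤ
  | 0 => []
  | k + 1 => -(k : ℤ) :: colPath k

theorem length_colPath (k : ℕ) : (colPath k).length = k := by
  induction k with
  | zero => rfl
  | succ k ih => rw [colPath, List.length_cons, ih]

theorem mem_state_colPath {k : ℕ} {c : ℤ} : c ∈ state (colPath k) ↔ c ≤ 1 ∧ c ≠ 1 - k := by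
  induction k with
  | zero => rw [colPath, mem_state_nil]; push_cast; omega
  | succ k ih => rw [colPath, mem_state_cons, ih]; push_cast; omega

theorem isPath_colPath (k : ℕ) : IsPath (colPath k) := by
  induction k with
  | zero => trivial
  | succ k ih =>
    refine ⟨ih, ?_⟩
    rw [mem_state_colPath, mem_state_colPath]
    omega

theorem colPath_suffix {j k : ℕ} (h : j ≤ k) : colPath j <:+ colPath k := by
  induction k, h using Nat.le_induction with
  | base => exact List.suffix_refl _
  | succ k _ ih => exact ih.trans (List.suffix_cons _ _)

theorem HeckeGens.jm_mul_asym (hq : Generic q) {k : ℕ} (H : HeckeGens q k s) {j : ℕ}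
    (hj : j < k) : jm s j * asym q s k = q ^ (2 * (-(j : ℤ))) • asym q s k := by
  induction j with
  | zero => simp [jm]
  | succ j ih =>
    have h0 := hq.ne_zero
    rw [jm, mul_assoc, H.gen_mul_asym hq (by omega), mul_smul_comm, mul_assoc, ih (by omega),
      mul_smul_comm, H.gen_mul_asym hq (by omega), smul_smul, smul_smul]
    congr 1
    have : (2 * -((j + 1 : ℕ) : ℤ)) = 2 * (-(j : ℤ)) + (-1) + (-1) := by push_cast; ring
    rw [this, zpow_add₀ h0, zpow_add₀ h0, zpow_neg_one]
    ring

theorem HeckeGens.isWt_asym (hq : Generic q) {k : ℕ} (H : HeckeGens q k s) {j : ℕ} (hj : j ≤ k) :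
    IsWt q s (colPath j) (asym q s k) := by
  induction j with
  | zero => trivial
  | succ j ih =>
    exact ⟨by rw [length_colPath]; exact H.jm_mul_asym hq (by omega), ih (by omega)⟩

/-- The two commute and each fixes the other. The antisymmetrizer has the weight of a column;
conversely, on that weight two consecutive boxes cannot be exchanged, so every generator acts by
-q⁻¹. -/
theorem HeckeGens.wtProj_colPath (hq : Generic q) {k : ℕ} (H : HeckeGens q k s) {N : ℕ}
    (hN : k ≤ N) : wtProj q s N (colPath k) = asym q s k := by
  have hlen := length_colPath k
  have hw := (H.isWt_asym hq le_rfl).wtProj_mul hq ((isPath_colPath k).mem_Ioo' (hlen.trans_le hN))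
  have hcm : Commute (asym q s k) (wtProj q s N (colPath k)) := by
    refine HeckeGens.commute_wtProj N fun j hj => ?_
    rw [hlen] at hj
    have h1 := H.jm_mul_asym hq hj
    have h2 := H.op.jm_mul_asym hq hj
    have hop : ∀ j, jm (fun i => MulOpposite.op (s i)) j = MulOpposite.op (jm s j) := by
      intro j
      induction j with
      | zero => rfl
      | succ j ih => rw [jm, ih, jm]; simp only [← MulOpposite.op_mul, mul_assoc]
    rw [asym_op, hop, ← MulOpposite.op_mul, ← MulOpposite.op_smul] at h2
    exact (MulOpposite.op_injective h2).trans h1.symm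
  have hE : asym q s k * wtProj q s N (colPath k) = wtProj q s N (colPath k) := by
    refine asym_mul_of_neg hq fun i hi => ?_
    have hwt : IsWt q s (colPath k) (wtProj q s N (colPath k)) := by
      simpa using H.isWt_wtProj hq (isPath_colPath k) hlen.le (hlen.trans_le hN) 1
    obtain ⟨t, ht⟩ := colPath_suffix (j := i + 2) (k := k) (by omega)
    rw [← ht] at hwt
    have h2 := hwt.of_append
    rw [ht] at h2
    have h3 := H.gen_mul_of_adjacent hq (l := colPath i) (by rw [length_colPath]; omega)
      (H.specAt hq (isPath_colPath i) (by rw [length_colPath]; omega)) (by push_cast; omega) (by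
        rw [mem_addable (isPath_colPath i), mem_state_colPath, mem_state_colPath]
        push_cast
        omega) h2
    rw [length_colPath] at h3
    have e : (-(i : ℤ)) = -((i + 1 : ℕ) : ℤ) + 1 := by push_cast; ring
    rw [e, diagCoeff_succ_self hq] at h3
    exact h3
  rw [← hE, hcm.eq, hw]

end Hecke

section Hecke

/-! ### The Pieri rule -/

variable {K : Type*} [Field K] {A : Type*} [Ring A] [Algebra K A] {q : K} {n : ℕ} {s : ℕ → A}

/-- An additive property of the components of a weight vector passes to the vector. -/
theorem HeckeGens.wt_induction (hq : Generic q) (H : HeckeGens q n s) {N : ℕ} (hN : n ≤ N)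
    {l : List ℤ} (hl : IsPath l) {x : A} (hx : IsWt q s l x) {j : ℕ} (hj : l.length + j ≤ n)
    {P : A → Prop} (h0 : P 0) (hadd : ∀ y z, P y → P z → P (y + z))
    (h : ∀ w : List ℤ, w.length = j → IsPath (w ++ l) → P (wtProj q s N (w ++ l) * x)) : P x := by
  induction j with
  | zero =>
    have := h [] rfl hl
    rwa [List.nil_append, hx.wtProj_mul hq (hl.mem_Ioo' (by omega))] at this
  | succ j ih =>
    refine ih (by omega) fun w hw hwl => ?_
    have hlen : (w ++ l).length = l.length + j := by simp [hw]; omega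
    have hsum : ∀ (S : Finset ℤ) (F : ℤ → A), (∀ c ∈ S, P (F c)) → P (∑ c ∈ S, F c) := by
      intro S F hF
      exact Finset.sum_induction F P hadd h0 hF
    rw [← HeckeGens.sum_proj_mul (s := s) hq (by omega : 0 < N) (w ++ l).length
      (wtProj q s N (w ++ l) * x)]
    refine hsum _ _ fun c hc => ?_
    have hy : IsWt q s (w ++ l) (wtProj q s N (w ++ l) * x) :=
      H.isWt_wtProj hq hwl (by omega) (by omega) x
    by_cases hcp : IsPath (c :: (w ++ l))
    · have := h (c :: w) (by simp [hw]) hcp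
      rw [List.cons_append, wtProj, mul_assoc] at this
      have hcm : Commute (proj q N (jm s (w ++ l).length) c) (wtProj q s N (w ++ l)) :=
        HeckeGens.commute_wtProj N fun i hi =>
          (commute_aeval (H.commute_jm (by omega) (by omega)) _).symm
      rwa [← mul_assoc, hcm.eq, mul_assoc]
    · rw [H.isWt_cons_eq_zero hq hwl (by omega) hcp
        (H.eigen_proj hq hwl (by omega) (by omega) hc hy)]
      exact h0

/-- Two vectors with the same components are equal: additive maps may be compared on components. -/
theorem HeckeGens.wt_ext (hq : Generic q) (H : HeckeGens q n s) {j : ℕ} (hj : j ≤ n)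
    {f g : A →+ A} (h : ∀ w : List ℤ, w.length = j → IsPath w → ∀ y, IsWt q s w y → f y = g y)
    (x : A) : f x = g x := by
  refine H.wt_induction hq (N := n) le_rfl (l := []) trivial (x := x) trivial (j := j) (by simpa)
    (P := fun x => f x = g x) (by simp) (fun y z hy hz => by rw [map_add, map_add, hy, hz]) ?_
  intro w hw hwp
  rw [List.append_nil] at hwp ⊢
  exact h w hw hwp _ (H.isWt_wtProj hq hwp (by omega) (by omega) x)

/-- Unlike in `eigen_proj`, x need not be a weight vector: both sides are additive and may be
compared on weight vectors, where the projector is 0 or 1. -/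
theorem HeckeGens.jm_mul_proj (hq : Generic q) (H : HeckeGens q n s) {k : ℕ} (hk : k < n) {N : ℕ}
    (hN : n ≤ N) {c : ℤ} (hc : c ∈ Finset.Ioo (-(N : ℤ)) N) (x : A) :
    jm s k * (proj q N (jm s k) c * x) = q ^ (2 * c) • (proj q N (jm s k) c * x) := by
  refine H.wt_ext hq (j := k + 1) hk
    (f := (AddMonoidHom.mulLeft (jm s k)).comp (AddMonoidHom.mulLeft (proj q N (jm s k) c)))
    (g := (DistribSMul.toAddMonoidHom A (q ^ (2 * c))).comp
      (AddMonoidHom.mulLeft (proj q N (jm s k) c))) (fun w hw hwp y hy => ?_) x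
  match w with
  | d :: w =>
    obtain rfl : k = w.length := by simpa using hw.symm
    have hd := hwp.mem_Ioo (N := N) (by omega)
    simp only [AddMonoidHom.comp_apply, AddMonoidHom.coe_mulLeft,
      DistribSMul.toAddMonoidHom_apply]
    rw [proj_mul_of_eigen hq hc hd hy.1]
    split_ifs with hcd
    · rw [hy.1, hcd]
    · simp

/-- A step of content c empties the place c, so the same content cannot follow at once. -/
theorem HeckeGens.eq_zero_of_eigen_eq (hq : Generic q) (H : HeckeGens q n s) {k : ℕ}
    (hk : k + 1 < n) {c : ℤ} {x : A} (h1 : jm s k * x = q ^ (2 * c) • x)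
    (h2 : jm s (k + 1) * x = q ^ (2 * c) • x) : x = 0 := by
  refine H.wt_induction hq (N := n) le_rfl (l := []) trivial (x := x) trivial (j := k) (by simp; omega)
    (P := fun x => x = 0) rfl (fun y z hy hz => by simp [hy, hz]) fun w hw hwp => ?_
  rw [List.append_nil] at hwp ⊢
  have hcm : ∀ i, i < n → Commute (jm s i) (wtProj q s n w) := fun i hi =>
    HeckeGens.commute_wtProj n fun j hj => H.commute_jm hi (by omega)
  have hy := H.isWt_wtProj hq hwp (N := n) (by omega) (by omega) x
  set y := wtProj q s n w * x
  have e1 : jm s w.length * y = q ^ (2 * c) • y := by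
    rw [hw, ← mul_assoc, (hcm k (by omega)).eq, mul_assoc, h1, mul_smul_comm]
  have e2 : jm s (w.length + 1) * y = q ^ (2 * c) • y := by
    rw [hw, ← mul_assoc, (hcm _ hk).eq, mul_assoc, h2, mul_smul_comm]
  by_cases hc : IsPath (c :: w)
  · refine H.isWt_cons_eq_zero hq hc (by simp; omega) (c := c) ?_ ⟨e2, e1, hy⟩
    rw [isPath_cons, mem_state_cons]
    omega
  · exact H.isWt_cons_eq_zero hq hwp (by omega) hc ⟨e1, hy⟩

/-- The matrix coefficients of a generator between two weight components. -/
theorem HeckeGens.proj_proj_gen (hq : Generic q) (H : HeckeGens q n s) {k : ℕ} (hk : k + 1 < n)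
    {N : ℕ} (hN : n ≤ N) {b c : ℤ} (hb : b ∈ Finset.Ioo (-(N : ℤ)) N)
    (hc : c ∈ Finset.Ioo (-(N : ℤ)) N) (hbc : b ≠ c) (x : A) :
    proj q N (jm s (k + 1)) b * (s k * (proj q N (jm s (k + 1)) c * x)) =
      s k * (proj q N (jm s k) b * (proj q N (jm s (k + 1)) c * x)) -
        diagCoeff q (q ^ (2 * b)) (q ^ (2 * c)) •
          (proj q N (jm s k) b * (proj q N (jm s (k + 1)) c * x)) := by
  refine H.wt_ext hq (j := k + 2) hk
    (f := (AddMonoidHom.mulLeft (proj q N (jm s (k + 1)) b)).comp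
      ((AddMonoidHom.mulLeft (s k)).comp (AddMonoidHom.mulLeft (proj q N (jm s (k + 1)) c))))
    (g := (AddMonoidHom.mulLeft (s k)).comp ((AddMonoidHom.mulLeft (proj q N (jm s k) b)).comp
        (AddMonoidHom.mulLeft (proj q N (jm s (k + 1)) c))) -
      (DistribSMul.toAddMonoidHom A (diagCoeff q (q ^ (2 * b)) (q ^ (2 * c)))).comp
      ((AddMonoidHom.mulLeft (proj q N (jm s k) b)).comp
        (AddMonoidHom.mulLeft (proj q N (jm s (k + 1)) c)))) (fun w hw hwp y hy => ?_) x
  match w with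
  | d :: e :: w =>
    obtain rfl : k = w.length := by simpa using hw.symm
    have hd := hwp.mem_Ioo (N := N) (by simp; omega)
    have he := hwp.1.mem_Ioo (N := N) (by omega)
    simp only [AddMonoidHom.comp_apply, AddMonoidHom.coe_mulLeft, AddMonoidHom.sub_apply,
      DistribSMul.toAddMonoidHom_apply]
    have hy1 : jm s (w.length + 1) * y = q ^ (2 * d) • y := hy.1
    rw [proj_mul_of_eigen hq hc hd hy1]
    split_ifs with hcd
    · subst hcd
      have hec : e ≠ c := by
        rintro rfl
        have := hwp.2
        rw [mem_state_cons] at this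
        omega
      have hec' : q ^ (2 * e) ≠ q ^ (2 * c) := by rwa [Ne, hq.two_zpow_inj]
      rw [proj_mul_of_eigen hq hb he hy.2.1]
      obtain ⟨-, e2, -⟩ := H.swap_spec hk hec' hy.2.1 hy1
      have e3 : s w.length * y = diagCoeff q (q ^ (2 * e)) (q ^ (2 * c)) • y +
          (s w.length * y - diagCoeff q (q ^ (2 * e)) (q ^ (2 * c)) • y) := by abel
      rw [e3, mul_add, mul_smul_comm, proj_mul_of_eigen hq hb hd hy1, if_neg hbc, smul_zero,
        zero_add, proj_mul_of_eigen hq hb he e2]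
      split_ifs with hbe
      · rw [hbe]
      · simp
    · simp

/-- The product of the `J_{m+i} - t`, `i < j`. -/
def cprod (s : ℕ → A) (m : ℕ) (t : K) : ℕ → A
  | 0 => 1
  | j + 1 => cprod s m t j * (jm s (m + j) - algebraMap K A t)

theorem commute_cprod {g : A} {m j : ℕ} {t : K} (h : ∀ i < j, Commute g (jm s (m + i))) :
    Commute g (cprod s m t j) := by
  induction j with
  | zero => exact Commute.one_right g
  | succ j ih =>
    exact (ih fun i hi => h i (by omega)).mul_right
      ((h j (by omega)).sub_right (Algebra.commutes t g).symm)

/-- The product is symmetric in its Jucys–Murphy elements: a generator commutes with the sum and the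
product of the two it exchanges and with each of the others. -/
theorem HeckeGens.gen_commute_cprod (H : HeckeGens q n s) {m j : ℕ} {t : K} {i : ℕ} (hi : i + 1 < j)
    (hj : m + j ≤ n) : Commute (s (m + i)) (cprod s m t j) := by
  induction j with
  | zero => omega
  | succ j ih =>
    rcases Nat.lt_succ_iff_lt_or_eq.1 hi with h | rfl
    · refine (ih h (by omega)).mul_right (Commute.sub_right ?_ (Algebra.commutes t _).symm)
      exact H.commute_gen_jm (by omega) (by omega) (Or.inr (by omega))
    · have h1 : Commute (s (m + i)) (cprod s m t i) := commute_cprod fun r hr =>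
        H.commute_gen_jm (by omega) (by omega) (Or.inl (by omega))
      have e1 := H.jm_mul_gen (k := m + i) (by omega)
      have e2 := H.gen_mul_jm (k := m + i) (by omega)
      have hXY : Commute (jm s (m + i)) (jm s (m + i + 1)) := H.commute_jm (by omega) (by omega)
      have e4 : s (m + i) * jm s (m + i + 1) =
          jm s (m + i) * s (m + i) + (q - q⁻¹) • jm s (m + i + 1) := by rw [e1]; abel
      have hadd : Commute (s (m + i)) (jm s (m + i) + jm s (m + i + 1)) := by
        show _ * _ = _ * _
        rw [mul_add, add_mul, e2, e4]
        abel
      have hmul : Commute (s (m + i)) (jm s (m + i) * jm s (m + i + 1)) := by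
        show _ * _ = _ * _
        have e5 : jm s (m + i + 1) * s (m + i) =
            s (m + i) * jm s (m + i) + (q - q⁻¹) • jm s (m + i + 1) := by rw [e2]; abel
        rw [mul_assoc, e5, hXY.eq, ← mul_assoc, e4, add_mul, mul_add, mul_assoc, smul_mul_assoc,
          mul_smul_comm, hXY.eq]
      have h2 : (jm s (m + i) - algebraMap K A t) * (jm s (m + i + 1) - algebraMap K A t) =
          jm s (m + i) * jm s (m + i + 1) - algebraMap K A t * (jm s (m + i) + jm s (m + i + 1)) +
            algebraMap K A (t * t) := by
        rw [sub_mul, mul_sub, mul_sub, ← Algebra.commutes t (jm s (m + i)), map_mul, mul_add]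
        abel
      show Commute _ (cprod s m t i * _ * _)
      rw [mul_assoc]
      refine h1.mul_right ?_
      show Commute _ ((jm s (m + i) - algebraMap K A t) * (jm s (m + i + 1) - algebraMap K A t))
      rw [h2]
      exact (hmul.sub_right (Commute.mul_right (Algebra.commutes t _).symm hadd)).add_right
        (Algebra.commutes _ _).symm

theorem IsWt.cprod_mul {w l : List ℤ} {x : A} (hx : IsWt q s (w ++ l) x) (t : K) :
    cprod s l.length t w.length * x = ((w : Multiset ℤ).map fun b => q ^ (2 * b) - t).prod • x := by
  induction w with
  | nil => simp [cprod]
  | cons c w ih =>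
    have h1 := hx.1
    rw [List.append_eq, List.length_append, add_comm] at h1
    rw [List.length_cons, cprod, mul_assoc, sub_mul, h1, Algebra.algebraMap_eq_smul_one,
      smul_mul_assoc, one_mul, ← sub_smul, mul_smul_comm, ih hx.2, smul_smul, ← Multiset.cons_coe,
      Multiset.map_cons, Multiset.prod_cons]

/-- The contents of the boxes `m + 1, …, m + j` of `x` are those in `B`. The values
`q^{2i+1}` of the parameter avoid all eigenvalues. -/
def HasContents (q : K) (s : ℕ → A) (m j : ℕ) (B : Multiset ℤ) (x : A) : Prop :=
  ∀ i : ℤ, cprod s m (q ^ (2 * i + 1)) j * x =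
    (B.map fun b => q ^ (2 * b) - q ^ (2 * i + 1)).prod • x

theorem IsWt.hasContents {w l : List ℤ} {x : A} (hx : IsWt q s (w ++ l) x) :
    HasContents q s l.length w.length w x := fun _ => hx.cprod_mul _

theorem HasContents.mul_left {m j : ℕ} {B : Multiset ℤ} {x g : A} (hx : HasContents q s m j B x)
    (hg : ∀ t : K, Commute g (cprod s m t j)) : HasContents q s m j B (g * x) := fun i => by
  rw [← mul_assoc, ← (hg _).eq, mul_assoc, hx i, mul_smul_comm]

theorem HasContents.sub {m j : ℕ} {B : Multiset ℤ} {x y : A} (hx : HasContents q s m j B x)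
    (hy : HasContents q s m j B y) : HasContents q s m j B (x - y) := fun i => by
  rw [mul_sub, hx i, hy i, smul_sub]

theorem HasContents.smul {m j : ℕ} {B : Multiset ℤ} {x : A} (a : K)
    (hx : HasContents q s m j B x) : HasContents q s m j B (a • x) := fun i => by
  rw [mul_smul_comm, hx i, smul_comm]

/-- Two polynomials that agree at the infinitely many points q^{2i+1} are equal, so their multisets
of roots agree. -/
theorem contents_prod_injective (hq : Generic q) {B B' : Multiset ℤ}
    (h : ∀ i : ℤ, (B.map fun b => q ^ (2 * b) - q ^ (2 * i + 1)).prod =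
      (B'.map fun b => q ^ (2 * b) - q ^ (2 * i + 1)).prod) : B = B' := by
  have hev : ∀ (B : Multiset ℤ) (t : K),
      ((B.map fun b => Polynomial.C (q ^ (2 * b)) - Polynomial.X).prod).eval t =
        (B.map fun b => q ^ (2 * b) - t).prod := by
    intro B t
    rw [Polynomial.eval_multiset_prod, Multiset.map_map]
    simp
  have hinj : Function.Injective fun i : ℤ => q ^ (2 * i + 1) := fun a b hab => by
    have := hq.zpow_inj.1 hab
    omega
  have key : (B.map fun b => Polynomial.C (q ^ (2 * b)) - Polynomial.X).prod =
      (B'.map fun b => Polynomial.C (q ^ (2 * b)) - Polynomial.X).prod := by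
    refine Polynomial.eq_of_infinite_eval_eq _ _ ((Set.infinite_range_of_injective hinj).mono ?_)
    rintro _ ⟨i, rfl⟩
    rw [Set.mem_ofPred_eq, hev, hev, h i]
  have hroots : ∀ B : Multiset ℤ,
      (B.map fun b => Polynomial.C (q ^ (2 * b)) - Polynomial.X).prod.roots =
        B.map fun b => q ^ (2 * b) := by
    intro B
    have e : (B.map fun b => Polynomial.C (q ^ (2 * b)) - Polynomial.X).prod =
        Polynomial.C ((-1) ^ Multiset.card B) *
          ((B.map fun b => q ^ (2 * b)).map fun a => Polynomial.X - Polynomial.C a).prod := by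
      induction B using Multiset.induction_on with
      | empty => simp
      | cons b B ih =>
        simp only [Multiset.map_cons, Multiset.prod_cons, Multiset.card_cons, ih, pow_succ, map_mul]
        rw [map_neg, map_one]
        ring
    rw [e, Polynomial.roots_C_mul _ (pow_ne_zero _ (by simp)),
      Polynomial.roots_multiset_prod_X_sub_C]
  have := congrArg Polynomial.roots key
  rw [hroots, hroots] at this
  exact Multiset.map_injective (fun a b hab => hq.two_zpow_inj.1 hab) this

theorem HasContents.unique (hq : Generic q) {m j : ℕ} {B B' : Multiset ℤ} {x : A}
    (h : HasContents q s m j B x) (h' : HasContents q s m j B' x) (hx : x ≠ 0) : B = B' := by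
  refine contents_prod_injective hq fun i => ?_
  have := (h i).symm.trans (h' i)
  rw [← sub_eq_zero, ← sub_smul, smul_eq_zero] at this
  exact sub_eq_zero.1 (this.resolve_right hx)

/-- The factor of the last box can be cancelled: an even and an odd power of q are never equal. -/
theorem HasContents.of_succ (hq : Generic q) {m j : ℕ} {B : Multiset ℤ} {b : ℤ} {x : A}
    (h : HasContents q s m (j + 1) (b ::ₘ B) x) (hx : jm s (m + j) * x = q ^ (2 * b) • x) :
    HasContents q s m j B x := fun i => by
  have h1 := h i
  rw [cprod, mul_assoc, sub_mul, hx, Algebra.algebraMap_eq_smul_one, smul_mul_assoc, one_mul,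
    ← sub_smul, mul_smul_comm, Multiset.map_cons, Multiset.prod_cons, ← smul_smul] at h1
  refine smul_right_injective A (sub_ne_zero.2 ?_) h1
  rw [Ne, hq.zpow_inj]
  omega

theorem state_of_not_mem {w l : List ℤ} {b : ℤ} (hb : b ∈ state l) (hw : b ∉ w) :
    b ∈ state (w ++ l) := by
  induction w with
  | nil => exact hb
  | cons c w ih =>
    rw [List.cons_append, mem_state_cons]
    simp only [List.mem_cons, not_or] at hw
    exact Or.inr ⟨ih hw.2, hw.1⟩

theorem HeckeGens.exists_component (hq : Generic q) (H : HeckeGens q n s) {l : List ℤ}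
    (hl : IsPath l) {x : A} (hx : IsWt q s l x) (hx0 : x ≠ 0) {j : ℕ} (hj : l.length + j ≤ n) :
    ∃ w : List ℤ, w.length = j ∧ IsPath (w ++ l) ∧ wtProj q s n (w ++ l) * x ≠ 0 := by
  by_contra! h
  exact hx0 (H.wt_induction hq le_rfl hl hx hj (P := fun x => x = 0) rfl
    (fun y z hy hz => by rw [hy, hz, add_zero]) h)

theorem HeckeGens.jm_commute_wtProj (H : HeckeGens q n s) (N : ℕ) {k : ℕ} (hk : k < n) {l : List ℤ}
    (hl : l.length ≤ n) : Commute (jm s k) (wtProj q s N l) :=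
  HeckeGens.commute_wtProj N fun j hj => H.commute_jm hk (by omega)

theorem HeckeGens.jm_commute_cprod (H : HeckeGens q n s) {k : ℕ} (hk : k < n) {m j : ℕ} {t : K}
    (hj : m + j ≤ n) : Commute (jm s k) (cprod s m t j) :=
  commute_cprod fun i hi => H.commute_jm hk (by omega)

theorem HeckeGens.wtProj_commute_cprod (H : HeckeGens q n s) (N : ℕ) {l : List ℤ}
    (hl : l.length ≤ n) {m j : ℕ} {t : K} (hj : m + j ≤ n) :
    Commute (wtProj q s N l) (cprod s m t j) :=
  (HeckeGens.commute_wtProj N fun i hi => (H.jm_commute_cprod (by omega) hj).symm).symm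

theorem eigen_mul_left {X g x : A} {a : K} (h : X * x = a • x) (hg : Commute X g) :
    X * (g * x) = a • (g * x) := by
  rw [← mul_assoc, hg.eq, mul_assoc, h, mul_smul_comm]

/-- Some nonzero component of x has a full content word ending in b, and the multiset of contents of
a nonzero vector is unique. -/
theorem HeckeGens.mem_of_hasContents (hq : Generic q) (H : HeckeGens q n s) {l : List ℤ}
    (hl : IsPath l) {x : A} (hx : IsWt q s l x) (hx0 : x ≠ 0) {j : ℕ} (hj : l.length + (j + 1) ≤ n)
    {B : Multiset ℤ} (hB : HasContents q s l.length (j + 1) B x) {b : ℤ}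
    (hb : jm s (l.length + j) * x = q ^ (2 * b) • x) : b ∈ B := by
  obtain ⟨w, rfl, hp, hy⟩ := H.exists_component hq hl hx hx0 (j := j) (by omega)
  have hw := H.isWt_wtProj hq hp (N := n) (by simp; omega) (by simp; omega) x
  have e1 := eigen_mul_left hb (H.jm_commute_wtProj n (l := w ++ l) (by omega) (by simp; omega))
  have hB' := hB.mul_left (g := wtProj q s n (w ++ l)) fun t =>
    H.wtProj_commute_cprod n (by simp; omega) hj
  have hw' : IsWt q s ((b :: w) ++ l) (wtProj q s n (w ++ l) * x) :=
    ⟨by rw [List.append_eq, List.length_append, add_comm w.length]; exact e1, hw⟩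
  rw [hB'.unique hq hw'.hasContents hy]
  simp

/-- A vertical strip has no two boxes in a row. Here b + 1 belongs to B, so its place is occupied in
`state l`, and by distinctness of contents it is still occupied when b should move there. -/
theorem HeckeGens.eq_zero_of_row (hq : Generic q) (H : HeckeGens q n s) {l : List ℤ}
    (hl : IsPath l) {x : A} (hx : IsWt q s l x) {j : ℕ} (hj : l.length + (j + 2) ≤ n)
    {B : Multiset ℤ} (hB : HasContents q s l.length (j + 2) B x) (hBn : B.Nodup)
    (hBl : ∀ b ∈ B, b ∈ state l) {b : ℤ}
    (h1 : jm s (l.length + j) * x = q ^ (2 * b) • x)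
    (h2 : jm s (l.length + j + 1) * x = q ^ (2 * (b + 1)) • x) : x = 0 := by
  by_contra hx0
  obtain ⟨w, rfl, hp, hy⟩ := H.exists_component hq hl hx hx0 (j := j) (by omega)
  have hw := H.isWt_wtProj hq hp (N := n) (by simp; omega) (by simp; omega) x
  have e1 := eigen_mul_left h1 (H.jm_commute_wtProj n (l := w ++ l) (by omega) (by simp; omega))
  have e2 := eigen_mul_left h2 (H.jm_commute_wtProj n (l := w ++ l) (by omega) (by simp; omega))
  have hB' := hB.mul_left (g := wtProj q s n (w ++ l)) fun t =>
    H.wtProj_commute_cprod n (by simp; omega) hj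
  have hw1 : IsWt q s (b :: (w ++ l)) (wtProj q s n (w ++ l) * x) :=
    ⟨by rw [List.length_append, add_comm w.length]; exact e1, hw⟩
  have hw2 : IsWt q s (((b + 1) :: b :: w) ++ l) (wtProj q s n (w ++ l) * x) := by
    refine ⟨?_, hw1⟩
    rw [List.append_eq, List.length_append, List.length_cons, add_comm]
    exact e2
  have hBw := hB'.unique hq hw2.hasContents hy
  subst hBw
  have hpath : IsPath (b :: (w ++ l)) := by
    by_contra hnp
    exact hy (H.isWt_cons_eq_zero hq hp (by simp; omega) hnp hw1)
  refine hpath.2.2 (state_of_not_mem (hBl _ (by simp)) ?_)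
  have := Multiset.coe_nodup.1 hBn
  simp only [List.nodup_cons, List.mem_cons, not_or] at this
  exact this.1.2

theorem HeckeGens.commute_shift_asym (H : HeckeGens q n s) {m k j : ℕ} (hk : k < n)
    (hj : m + j ≤ n) (h : k < m ∨ m + j ≤ k) : Commute (jm s k) (asym q (fun i => s (m + i)) j) :=
  commute_asym fun i hi => (H.commute_gen_jm (by omega) hk (by omega)).symm

theorem diagCoeff_eq_neg (hq : Generic q) {b c : ℤ} (hbc : b ≠ c)
    (h : diagCoeff q (q ^ (2 * b)) (q ^ (2 * c)) = -q⁻¹) : b = c + 1 := by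
  by_contra h1
  have h0 := hq.ne_zero
  have n1 : q ^ (2 * c) - q ^ (2 * b) ≠ 0 := by
    rw [sub_ne_zero, Ne, hq.two_zpow_inj]
    omega
  rw [diagCoeff, div_eq_iff n1] at h
  have k1 : q ^ (2 * (c + 1)) = q ^ (2 * c) * q ^ 2 := by
    rw [mul_add, zpow_add₀ h0]; norm_num [zpow_ofNat]
  refine h1 (hq.two_zpow_inj.1 ?_)
  rw [k1]
  field_simp at h
  linear_combination -h

/-- The antisymmetrizer does not vanish on vertical strips. -/
theorem HeckeGens.eq_zero_of_asym (hq : Generic q) (H : HeckeGens q n s) {l : List ℤ}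
    (hl : IsPath l) {j : ℕ} (hj : l.length + (j + 1) ≤ n) {B : Multiset ℤ} (hBn : B.Nodup)
    (hBl : ∀ b ∈ B, b ∈ state l) {b : ℤ} {x : A} (hx : IsWt q s l x)
    (hB : HasContents q s l.length (j + 1) B x) (hb : jm s (l.length + j) * x = q ^ (2 * b) • x)
    (h1 : asym q (fun i => s (l.length + i)) j * x = x)
    (h2 : asym q (fun i => s (l.length + i)) (j + 1) * x = 0) : x = 0 := by
  induction j generalizing B b x with
  | zero => simpa [asym, invQNum] using h2
  | succ j ih =>
    by_contra hx0
    set m := l.length with hm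
    set s' : ℕ → A := fun i => s (m + i) with hs'
    set σ := s (m + j) with hσ
    have H' : HeckeGens q (j + 2) s' := (H.mono hj).shift
    have hq0 := hq.ne_zero
    have hbB := H.mem_of_hasContents hq hl hx hx0 hj hB hb
    -- With Ax = x for the smaller antisymmetrizer A, the recursion turns the vanishing in `h2` into
    -- proportionality of Aσx to x.
    obtain ⟨γ, hγ⟩ : ∃ γ : K, asym q s' (j + 1) * (σ * x) = γ • x := by
      rw [asym, smul_mul_assoc, smul_eq_zero] at h2
      have h3 := h2.resolve_left (inv_ne_zero (invQNum_ne_zero hq _))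
      rw [sub_mul, h1, smul_mul_assoc, mul_assoc, mul_assoc, h1, sub_eq_zero] at h3
      have h4 : q⁻¹ * invQNum q (j + 1) ≠ 0 :=
        mul_ne_zero (inv_ne_zero hq0) (invQNum_ne_zero hq _)
      exact ⟨(q⁻¹ * invQNum q (j + 1))⁻¹, (eq_inv_smul_iff₀ h4).2 h3.symm⟩
    change jm s (m + j + 1) * x = _ at hb
    have hbN : b ∈ Finset.Ioo (-(n : ℤ)) n := by
      obtain ⟨w, hw, hp, hy⟩ := H.exists_component hq hl hx hx0 (j := j + 1) (by omega)
      by_contra hbN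
      have hlen : (w ++ l).length = m + (j + 1) := by simp [hw]; omega
      refine hy (H.isWt_cons_eq_zero hq hp (by omega) (c := b)
        (fun hpb => hbN (hpb.mem_Ioo (by omega))) ⟨?_, H.isWt_wtProj hq hp (by omega) (by omega) x⟩)
      rw [hlen]
      exact eigen_mul_left hb (H.jm_commute_wtProj n (by omega) (by omega))
    have hX : ∀ c, ∀ k < n, Commute (jm s k) (proj q n (jm s (m + j)) c) := fun c k hk =>
      commute_aeval (H.commute_jm hk (by omega)) _
    have hpx : proj q n (jm s (m + j + 1)) b * x = x := by
      rw [proj_mul_of_eigen hq hbN hbN hb, if_pos rfl]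
    -- the components with respect to the last but one Jucys-Murphy element
    have hxc : ∀ c, IsWt q s l (proj q n (jm s (m + j)) c * x) := fun c =>
      hx.mul_left fun i hi => (hX c i (by omega)).symm
    have hBc : ∀ c, HasContents q s m (j + 2) B (proj q n (jm s (m + j)) c * x) := fun c =>
      hB.mul_left fun t => (commute_aeval (H.jm_commute_cprod (by omega) hj).symm _).symm
    have hbc : ∀ c, jm s (m + j + 1) * (proj q n (jm s (m + j)) c * x) =
        q ^ (2 * b) • (proj q n (jm s (m + j)) c * x) := fun c =>
      eigen_mul_left hb (hX c _ (by omega))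
    -- The intertwined vector u has the last two contents exchanged, and by `hPσ` it is the
    -- c-component of σx for the last Jucys–Murphy element. As Aσx is a multiple of x, whose last
    -- content is b ≠ c, also Au = 0. Without the last box c, the induction hypothesis applies to u
    -- and gives u = 0.
    have hu : ∀ c ∈ Finset.Ioo (-(n : ℤ)) n, c ≠ b →
        σ * (proj q n (jm s (m + j)) c * x) =
          diagCoeff q (q ^ (2 * c)) (q ^ (2 * b)) • (proj q n (jm s (m + j)) c * x) := by
      intro c hc hcb
      have hcb' : q ^ (2 * c) ≠ q ^ (2 * b) := by rwa [Ne, hq.two_zpow_inj]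
      have hcc := H.jm_mul_proj hq (k := m + j) (by omega) le_rfl hc x
      obtain ⟨e1, e2, e3⟩ := H.swap_spec (k := m + j) (by omega) hcb' hcc (hbc c)
      have hPσ := H.proj_proj_gen hq (k := m + j) (by omega) le_rfl hc hbN hcb x
      rw [hpx] at hPσ
      rw [← sub_eq_zero]
      set u := s (m + j) * (proj q n (jm s (m + j)) c * x) -
        diagCoeff q (q ^ (2 * c)) (q ^ (2 * b)) • (proj q n (jm s (m + j)) c * x) with hu
      have hcm : Commute (asym q s' (j + 1)) (proj q n (jm s (m + j + 1)) c) :=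
        commute_aeval (H.commute_shift_asym (by omega) (by omega) (by omega)).symm _
      have hAu : asym q s' (j + 1) * u = 0 := by
        rw [← hPσ, ← mul_assoc, hcm.eq, mul_assoc, hγ, mul_smul_comm,
          proj_mul_of_eigen hq hc hbN hb, if_neg hcb, smul_zero]
      have hAx : asym q s' j * x = x := by
        rw [← h1, ← mul_assoc, (H'.mono (Nat.le_succ _)).asym_mul_asym hq (Nat.le_succ _)]
      have hAu' : asym q s' j * u = u := by
        have c1 : Commute σ (asym q s' j) := commute_asym fun i hi =>
          H.commute (Or.inr (by omega)) (by omega) (by omega)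
        have c2 : Commute (asym q s' j) (proj q n (jm s (m + j)) c) :=
          commute_aeval (H.commute_shift_asym (by omega) (by omega) (by omega)).symm _
        have hAc : asym q s' j * (proj q n (jm s (m + j)) c * x) =
            proj q n (jm s (m + j)) c * x := by
          rw [← mul_assoc, c2.eq, mul_assoc, hAx]
        rw [hu, mul_sub, mul_smul_comm, hAc, ← mul_assoc, ← c1.eq, mul_assoc, hAc]
      by_contra hu0
      have huw : IsWt q s l u := ((hxc c).mul_left fun i hi =>
        H.commute_gen_jm (by omega) (by omega) (Or.inl (by omega))).sub ((hxc c).smul _)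
      have huB : HasContents q s m (j + 2) B u := ((hBc c).mul_left fun t =>
        H.gen_commute_cprod (by omega) hj).sub ((hBc c).smul _)
      have hcB := H.mem_of_hasContents hq hl huw hu0 hj huB e2
      obtain ⟨B', rfl⟩ := Multiset.exists_cons_of_mem hcB
      exact hu0 (ih (by omega) (Multiset.nodup_cons.1 hBn).2
        (fun b hb => hBl b (Multiset.mem_cons_of_mem hb)) huw (huB.of_succ hq e2) e1 hAu' hAu)
    -- Content c = b cannot repeat, c = b - 1 would put two boxes in a row, and for contents that
    -- are not neighbours the intertwiner is invertible although it sends the component to 0.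
    have hzero : ∀ c ∈ Finset.Ioo (-(n : ℤ)) n, c ≠ b + 1 → proj q n (jm s (m + j)) c * x = 0 := by
      intro c hc hcb1
      have hcc := H.jm_mul_proj hq (k := m + j) (by omega) le_rfl hc x
      by_cases hcb : c = b
      · subst hcb
        exact H.eq_zero_of_eigen_eq hq (by omega) hcc (hbc c)
      · by_cases hcb2 : b = c + 1
        · subst hcb2
          exact H.eq_zero_of_row hq hl (hxc c) hj (hBc c) hBn hBl hcc (hbc c)
        · have hcb' : q ^ (2 * c) ≠ q ^ (2 * b) := by rwa [Ne, hq.two_zpow_inj]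
          have e3 := (H.swap_spec (k := m + j) (by omega) hcb' hcc (hbc c)).2.2
          rw [sub_eq_zero.2 (hu c hc hcb), mul_zero, smul_zero, zero_add, eq_comm, smul_eq_zero] at e3
          exact e3.resolve_left (one_add_diagCoeff_ne_zero hq hcb hcb1 hcb2)
    -- Only the component of content b + 1 survives, where the diagonal coefficient is -q⁻¹. All
    -- generators then act by -q⁻¹, so the larger antisymmetrizer fixes x instead of killing it.
    have hσx : σ * x = (-q⁻¹) • x := by
      have hsum := HeckeGens.sum_proj_mul (s := s) hq (by omega : 0 < n) (m + j) x
      by_cases hb1 : b + 1 ∈ Finset.Ioo (-(n : ℤ)) n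
      · rw [Finset.sum_eq_single_of_mem _ hb1 fun c hc hcb => hzero c hc hcb] at hsum
        have := hu (b + 1) hb1 (by omega)
        rwa [hsum, diagCoeff_succ_self hq] at this
      · rw [Finset.sum_eq_zero fun c hc => hzero c hc (by rintro rfl; exact hb1 hc)] at hsum
        exact absurd hsum.symm hx0
    refine hx0 ?_
    rw [← h2, eq_comm]
    refine asym_mul_of_neg hq fun i hi => ?_
    rcases Nat.lt_succ_iff_lt_or_eq.1 (show i < j + 1 by omega) with hi | rfl
    · exact (H'.mono (Nat.le_succ _)).gen_mul_of_asym hq (by omega) h1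
    · exact hσx

end Hecke

section Hecke

variable {K : Type*} [Field K] {A : Type*} [Ring A] [Algebra K A] {q : K} {n : ℕ} {s : ℕ → A}

/-- If x has no component with last content c, the second term disappears and σ acts on the (c,
b)-component through its diagonal coefficient alone. -/
theorem HeckeGens.proj_proj_gen' (hq : Generic q) (H : HeckeGens q n s) {k : ℕ} (hk : k + 1 < n)
    {N : ℕ} (hN : n ≤ N) {b c : ℤ} (hb : b ∈ Finset.Ioo (-(N : ℤ)) N)
    (hc : c ∈ Finset.Ioo (-(N : ℤ)) N) (x : A) :
    proj q N (jm s (k + 1)) b * (proj q N (jm s k) c * (s k * x)) =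
      diagCoeff q (q ^ (2 * c)) (q ^ (2 * b)) •
          (proj q N (jm s (k + 1)) b * (proj q N (jm s k) c * x)) +
        proj q N (jm s (k + 1)) b * (proj q N (jm s k) c *
          (s k * (proj q N (jm s (k + 1)) c * x))) := by
  refine H.wt_ext hq (j := k + 2) hk
    (f := (AddMonoidHom.mulLeft (proj q N (jm s (k + 1)) b)).comp
      ((AddMonoidHom.mulLeft (proj q N (jm s k) c)).comp (AddMonoidHom.mulLeft (s k))))
    (g := (DistribSMul.toAddMonoidHom A (diagCoeff q (q ^ (2 * c)) (q ^ (2 * b)))).comp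
        ((AddMonoidHom.mulLeft (proj q N (jm s (k + 1)) b)).comp
          (AddMonoidHom.mulLeft (proj q N (jm s k) c))) +
      (AddMonoidHom.mulLeft (proj q N (jm s (k + 1)) b)).comp
        ((AddMonoidHom.mulLeft (proj q N (jm s k) c)).comp ((AddMonoidHom.mulLeft (s k)).comp
          (AddMonoidHom.mulLeft (proj q N (jm s (k + 1)) c))))) (fun w hw hwp y hy => ?_) x
  match w with
  | d :: e :: w =>
    obtain rfl : k = w.length := by simpa using hw.symm
    have hd := hwp.mem_Ioo (N := N) (by simp; omega)
    have he := hwp.1.mem_Ioo (N := N) (by omega)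
    simp only [AddMonoidHom.comp_apply, AddMonoidHom.coe_mulLeft, AddMonoidHom.add_apply,
      DistribSMul.toAddMonoidHom_apply]
    have hy1 : jm s (w.length + 1) * y = q ^ (2 * d) • y := hy.1
    have hed : e ≠ d := by
      rintro rfl
      have := hwp.2
      rw [mem_state_cons] at this
      omega
    rw [proj_mul_of_eigen hq hc hd hy1, proj_mul_of_eigen hq hc he hy.2.1]
    by_cases hcd : c = d
    · subst hcd
      rw [if_pos rfl, if_neg hed.symm, mul_zero, smul_zero, zero_add]
    · have hed' : q ^ (2 * e) ≠ q ^ (2 * d) := by rwa [Ne, hq.two_zpow_inj]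
      obtain ⟨e1, -, -⟩ := H.swap_spec hk hed' hy.2.1 hy1
      have e3 : s w.length * y = diagCoeff q (q ^ (2 * e)) (q ^ (2 * d)) • y +
          (s w.length * y - diagCoeff q (q ^ (2 * e)) (q ^ (2 * d)) • y) := by abel
      rw [if_neg hcd, mul_zero, mul_zero, mul_zero, add_zero, e3, mul_add, mul_smul_comm,
        proj_mul_of_eigen hq hc he hy.2.1, proj_mul_of_eigen hq hc hd e1, if_neg hcd, add_zero,
        mul_smul_comm]
      split_ifs with hce
      · subst hce
        rw [proj_mul_of_eigen hq hb hd hy1]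
        split_ifs with hbd
        · rw [hbd]
        · simp
      · simp

/-- A nonzero vector fixed by the antisymmetrizer has a nonzero component along a vertical
strip, with the boxes added from top to bottom. -/
theorem HeckeGens.exists_sorted_component (hq : Generic q) (H : HeckeGens q n s) {l : List ℤ}
    (hl : IsPath l) {k : ℕ} (hk : l.length + k ≤ n) {x : A} (hx : IsWt q s l x)
    (hA : asym q (fun i => s (l.length + i)) k * x = x) (hx0 : x ≠ 0) :
    ∃ w : List ℤ, w.length = k ∧ w.Pairwise (· < ·) ∧ IsPath (w ++ l) ∧
      wtProj q s n (w ++ l) * x ≠ 0 := by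
  classical
  induction k generalizing x with
  | zero =>
    refine ⟨[], rfl, List.Pairwise.nil, hl, ?_⟩
    rwa [List.nil_append, hx.wtProj_mul hq (hl.mem_Ioo' (by omega))]
  | succ k ih =>
    set m := l.length with hm
    set s' : ℕ → A := fun i => s (m + i) with hs'
    have H' : HeckeGens q (k + 1) s' := (H.mono hk).shift
    set S : Finset ℤ := (Finset.Ioo (-(n : ℤ)) n).filter
      fun c => proj q n (jm s (m + k)) c * x ≠ 0 with hS
    have hSne : S.Nonempty := by
      by_contra hS0
      rw [Finset.not_nonempty_iff_eq_empty, hS, Finset.filter_eq_empty_iff] at hS0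
      refine hx0 ?_
      rw [← HeckeGens.sum_proj_mul (s := s) hq (by omega : 0 < n) (m + k) x]
      exact Finset.sum_eq_zero fun c hc => not_not.1 (hS0 hc)
    -- The smallest last content is peeled off first: lists begin with the latest box, so this aims
    -- at an increasing list, with the lowest box added last.
    set b := S.min' hSne with hb
    have hbS : b ∈ S := S.min'_mem hSne
    rw [hS, Finset.mem_filter] at hbS
    obtain ⟨hbN, hxb0⟩ := hbS
    have hxb : IsWt q s l (proj q n (jm s (m + k)) b * x) := hx.mul_left fun i hi =>
      (commute_aeval (H.commute_jm (by omega) (by omega)) _).symm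
    have hAk : asym q s' k * x = x := by
      rw [← hA, ← mul_assoc, H'.asym_mul_asym hq (Nat.le_succ _)]
    have hAb : asym q s' k * (proj q n (jm s (m + k)) b * x) = proj q n (jm s (m + k)) b * x := by
      have c2 : Commute (asym q s' k) (proj q n (jm s (m + k)) b) :=
        commute_aeval (H.commute_shift_asym (by omega) (by omega) (by omega)).symm _
      rw [← mul_assoc, c2.eq, mul_assoc, hAk]
    obtain ⟨w, hw, hws, hwp, hw0⟩ := ih (by omega) hxb hAb hxb0
    have hlen : (w ++ l).length = m + k := by simp [hw]; omega
    have hcw : wtProj q s n (b :: (w ++ l)) * x =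
        wtProj q s n (w ++ l) * (proj q n (jm s (m + k)) b * x) := by
      rw [wtProj, hlen, mul_assoc]
    have hbp : IsPath (b :: (w ++ l)) := by
      by_contra hnp
      refine hw0 (H.isWt_cons_eq_zero hq hwp (by omega) hnp ⟨?_, H.isWt_wtProj hq hwp (by omega)
        (by omega) _⟩)
      rw [hlen]
      exact eigen_mul_left (H.jm_mul_proj hq (by omega) le_rfl hbN x)
        (H.jm_commute_wtProj n (by omega) (by omega))
    match w with
    | [] => exact ⟨[b], by simp [← hw], by simp, hbp, ne_of_eq_of_ne hcw hw0⟩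
    | c :: w =>
      rcases lt_or_ge b c with hbc | hbc
      · refine ⟨b :: c :: w, by simp [← hw], ?_, hbp, by exact ne_of_eq_of_ne hcw hw0⟩
        refine List.pairwise_cons.2 ⟨fun d hd => ?_, hws⟩
        rcases List.mem_cons.1 hd with rfl | hd
        · exact hbc
        · exact hbc.trans ((List.pairwise_cons.1 hws).1 d hd)
      · exfalso
        have hbc' : b ≠ c := by
          rintro h
          have := hbp.2
          rw [h, List.cons_append, mem_state_cons] at this
          omega
        obtain ⟨k, rfl⟩ : ∃ k', k = k' + 1 := ⟨w.length, by simpa using hw.symm⟩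
        have hlen' : (w ++ l).length = m + k := by simp at hw; simp [hw]; omega
        have hcN : c ∈ Finset.Ioo (-(n : ℤ)) n := hwp.mem_Ioo (by rw [List.append_eq]; omega)
        -- A content c < b contradicts minimality unless this component is zero. Since σx = -q⁻¹x,
        -- `key` then forces either the chosen component to vanish or c = b + 1, both impossible.
        have hxc : proj q n (jm s (m + k + 1)) c * x = 0 := by
          by_contra hxc
          have hcS : c ∈ S := by
            rw [hS, Finset.mem_filter]
            exact ⟨hcN, hxc⟩
          have := S.min'_le c hcS
          omega
        have hσ : s (m + k) * x = (-q⁻¹) • x := H'.gen_mul_of_asym hq (i := k) (by omega) hA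
        have key := H.proj_proj_gen' hq (k := m + k) (by omega) le_rfl hbN hcN x
        rw [hxc, hσ] at key
        simp only [mul_zero, add_zero, mul_smul_comm] at key
        rw [← sub_eq_zero, ← sub_smul, smul_eq_zero] at key
        rcases key with key | key
        · have := diagCoeff_eq_neg hq hbc'.symm (sub_eq_zero.1 key).symm
          omega
        · refine hw0 ?_
          have hcm : Commute (proj q n (jm s (m + k + 1)) b) (proj q n (jm s (m + k)) c) :=
            commute_aeval (commute_aeval (H.commute_jm (by omega) (by omega)) _).symm _
          rw [List.cons_append, wtProj, hlen', mul_assoc, ← mul_assoc (proj _ _ _ c)]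
          show _ * (_ * proj q n (jm s (m + k + 1)) b * x) = 0
          rw [← hcm.eq, mul_assoc, key, mul_zero]

theorem mem_state_of_append {w l : List ℤ} {c : ℤ} (h : c ∈ state (w ++ l))
    (hw : ∀ d ∈ w, c ≠ d + 1) : c ∈ state l := by
  induction w with
  | nil => exact h
  | cons d w ih =>
    rw [List.cons_append, mem_state_cons] at h
    exact ih (h.resolve_left (hw d (by simp))).1 fun e he => hw e (by simp [he])

/-- Earlier steps of the word have larger contents e and create beads only at e + 1, so the bead
moved from c was there from the start. -/
theorem mem_state_of_sorted {w l : List ℤ} (hw : w.Pairwise (· < ·)) (h : IsPath (w ++ l)) :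
    ∀ c ∈ w, c ∈ state l := by
  induction w with
  | nil => simp
  | cons d w ih =>
    rw [List.pairwise_cons] at hw
    intro c hc
    rcases List.mem_cons.1 hc with rfl | hc
    · exact mem_state_of_append h.2.1 fun e he h' => by have := hw.1 e he; omega
    · exact ih hw.2 h.1 c hc

/-- The strip is built box by box: `eq_zero_of_asym` shows that if the next antisymmetrizer kills x,
so does the previous one. -/
theorem HeckeGens.eq_zero_of_asym_mul (hq : Generic q) (H : HeckeGens q n s) {l w : List ℤ}
    (hp : IsPath (w ++ l)) (hw : w.Pairwise (· < ·)) (hn : (w ++ l).length ≤ n) {x : A}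
    (hx : IsWt q s (w ++ l) x) (h : asym q (fun i => s (l.length + i)) w.length * x = 0) :
    x = 0 := by
  induction w with
  | nil => simpa [asym] using h
  | cons b w ih =>
    have hl : IsPath l := by
      clear ih h hx hn hw
      have : ∀ w : List ℤ, IsPath (w ++ l) → IsPath l := by
        intro w
        induction w with
        | nil => exact id
        | cons c w ih => exact fun h => ih h.1
      exact this _ hp
    simp only [List.cons_append, List.length_cons, List.length_append] at hn
    set m := l.length with hm
    set s' : ℕ → A := fun i => s (m + i) with hs'
    have H' : HeckeGens q (w.length + 1) s' := (H.mono (m := m + (w.length + 1)) (by omega)).shift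
    refine ih hp.1 (List.pairwise_cons.1 hw).2 (by simp; omega) hx.2 ?_
    have hcA : ∀ k < n, k < m ∨ m + w.length ≤ k → Commute (jm s k) (asym q s' w.length) :=
      fun k hk h => H.commute_shift_asym hk (by omega) h
    have h1 : jm s (m + w.length) * x = q ^ (2 * b) • x := by
      have := hx.1
      rwa [List.append_eq, List.length_append, add_comm] at this
    have hxB : HasContents q s m (w.length + 1) ((b :: w : List ℤ) : Multiset ℤ)
      (asym q s' w.length * x) := fun i => by
        have := hx.cprod_mul (l := l) (w := b :: w) (q ^ (2 * i + 1))
        have hcm : Commute (asym q s' w.length) (cprod s m (q ^ (2 * i + 1)) (w.length + 1)) :=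
          (commute_asym fun r hr =>
            (H.gen_commute_cprod (i := r) (by omega) (by omega)).symm).symm
        rw [← mul_assoc, ← hcm.eq, mul_assoc]
        have e : cprod s m (q ^ (2 * i + 1)) (w.length + 1) * x = _ := this
        rw [e, mul_smul_comm]
    refine H.eq_zero_of_asym hq hl (by omega) (B := ((b :: w : List ℤ) : Multiset ℤ)) (b := b) ?_ ?_
      ?_ hxB (eigen_mul_left h1 (hcA _ (by omega) (by omega))) ?_ ?_
    · exact Multiset.coe_nodup.2 (hw.imp fun h => h.ne)
    · exact fun c hc => mem_state_of_sorted hw hp c (by simpa using hc)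
    · exact (hx.of_append (l' := b :: w)).mul_left fun i hi => (hcA i (by omega) (by omega)).symm
    · rw [← mul_assoc, (H'.mono (Nat.le_succ _)).asym_mul_asym hq le_rfl]
    · rw [← mul_assoc, H'.asym_mul_asym' hq (Nat.le_succ _)]
      exact h

/-- The product of a primitive idempotent with an antisymmetrizer on the next `k` strands splits
into the primitive idempotents of the vertical strips. -/
theorem HeckeGens.pieri [FiniteDimensional K A] (hq : Generic q) {l : List ℤ} {k : ℕ}
    (H : HeckeGens q (l.length + k) s) (hl : IsPath l) (W : Finset (List ℤ))
    (hW : ∀ w, w ∈ W ↔ w.length = k ∧ w.Pairwise (· < ·) ∧ IsPath (w ++ l)) {e : A}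
    (he : e = wtProj q s (l.length + k) l * asym q (fun i => s (l.length + i)) k) :
    ∃ a : List ℤ → A,
      (∀ w ∈ W, e * a w = a w ∧ a w * wtProj q s (l.length + k) (w ++ l) = a w ∧
        wtProj q s (l.length + k) (w ++ l) * a w = wtProj q s (l.length + k) (w ++ l)) ∧
      (∀ w ∈ W, ∀ w' ∈ W, w ≠ w' → wtProj q s (l.length + k) (w' ++ l) * a w = 0) ∧
      ∑ w ∈ W, a w * (wtProj q s (l.length + k) (w ++ l) * e) = e := by
  set m := l.length with hm
  set n := m + k with hn
  set s' : ℕ → A := fun i => s (m + i) with hs'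
  have H' : HeckeGens q k s' := H.shift
  set p := asym q s' k with hp
  set y : List ℤ → A := fun w => wtProj q s n (w ++ l) with hy
  have hlN := hl.mem_Ioo' (N := n) (by omega)
  have hpp : p * p = p := H'.asym_mul_asym hq le_rfl
  have hpl : ∀ {x : A}, IsWt q s l x → IsWt q s l (p * x) := fun hx => hx.mul_left fun i hi =>
    (H.commute_shift_asym (by omega) (by omega) (by omega)).symm
  have hlen : ∀ w ∈ W, (w ++ l).length = n := fun w hw => by
    have := ((hW w).1 hw).1
    simp [this]; omega
  have hyw : ∀ w ∈ W, ∀ x, IsWt q s (w ++ l) (y w * x) := fun w hw x =>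
    H.isWt_wtProj hq ((hW w).1 hw).2.2 (hlen w hw).le (hlen w hw).le x
  have hyx : ∀ w ∈ W, ∀ x, IsWt q s (w ++ l) x → y w * x = x := fun w hw x hx =>
    hx.wtProj_mul hq (((hW w).1 hw).2.2.mem_Ioo' (hlen w hw).le)
  have hyy : ∀ w ∈ W, y w * y w = y w := fun w hw =>
    hyx w hw _ (by simpa using hyw w hw 1)
  have hpc : ∀ t : K, Commute p (cprod s m t k) := fun t =>
    (commute_asym fun r hr => (H.gen_commute_cprod (i := r) (by omega) (by omega)).symm).symm
  -- different strips are separated by their contents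
  have hsep : ∀ w ∈ W, ∀ w' ∈ W, w ≠ w' → ∀ x, y w' * (p * (y w * x)) = 0 := by
    intro w hw w' hw' hww x
    by_contra h0
    have h1 := (hyw w' hw' (p * (y w * x))).hasContents
    have h2 := ((hyw w hw x).hasContents.mul_left (g := p) fun t => by
      rw [((hW w).1 hw).1]; exact hpc t).mul_left (g := y w') fun t =>
        H.wtProj_commute_cprod n (hlen w' hw').le (by rw [((hW w).1 hw).1])
    rw [((hW w).1 hw).1] at h2
    rw [((hW w').1 hw').1] at h1
    have h3 := h2.unique hq h1 h0
    refine hww (List.Perm.eq_of_pairwise (le := (· < ·)) (fun a b _ _ hab hba => ?_) ((hW w).1 hw).2.1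
      ((hW w').1 hw').2.1 (Multiset.coe_eq_coe.1 h3))
    exact absurd (hab.trans hba) (lt_irrefl _)
  -- injectivity
  have hinj : ∀ x, IsWt q s l x → p * x = x → (∀ w ∈ W, y w * x = 0) → x = 0 := by
    intro x hx hpx h
    by_contra hx0
    obtain ⟨w, h1, h2, h3, h4⟩ := H.exists_sorted_component hq hl (by omega) hx hpx hx0
    exact h4 (h w ((hW w).2 ⟨h1, h2, h3⟩))
  -- surjectivity
  have hsurj : ∀ w ∈ W, ∃ u, y w * u = u ∧ u * y w = u ∧ y w * (p * u) = y w := by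
    intro w hw
    -- R is the right ideal generated by y_w. The compression of p to R is injective, hence
    -- bijective by finite dimension, and a preimage of y_w provides u.
    let R : Submodule K A := LinearMap.ker (LinearMap.mulLeft K (y w) - LinearMap.id)
    have hR : ∀ {x}, x ∈ R ↔ y w * x = x := by
      intro x
      simp only [R, LinearMap.mem_ker, LinearMap.sub_apply, LinearMap.mulLeft_apply,
        LinearMap.id_apply, sub_eq_zero]
    let F : R →ₗ[K] R := ((LinearMap.mulLeft K (y w)).comp (LinearMap.mulLeft K p)).restrict
      fun x _ => hR.2 (by
        simp only [LinearMap.comp_apply, LinearMap.mulLeft_apply]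
        rw [← mul_assoc, hyy w hw])
    have hF : Function.Injective F := by
      rw [injective_iff_map_eq_zero]
      rintro ⟨x, hx⟩ hFx
      have hFx' : y w * (p * x) = 0 := congrArg Subtype.val hFx
      have hx' := hR.1 hx
      have hwx : IsWt q s (w ++ l) x := by
        rw [← hx']
        exact hyw w hw x
      -- The w-component of px vanishes by assumption and the components of the other strips vanish
      -- by `hsep`.
      have h0 : p * x = 0 := by
        refine hinj _ (hpl hwx.of_append) (by rw [← mul_assoc, hpp]) fun w' hw' => ?_
        by_cases hww : w = w'
        · rw [← hww]; exact hFx'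
        · rw [← hx']
          exact hsep w hw w' hw' hww x
      refine Subtype.ext (H.eq_zero_of_asym_mul hq ((hW w).1 hw).2.2 ((hW w).1 hw).2.1
        (hlen w hw).le hwx ?_)
      rw [((hW w).1 hw).1]
      exact h0
    obtain ⟨⟨u, hu⟩, hu'⟩ := LinearMap.surjective_of_injective hF ⟨y w, hR.2 (hyy w hw)⟩
    have hu1 := hR.1 hu
    have hu2 : y w * (p * u) = y w := congrArg Subtype.val hu'
    refine ⟨u * y w, by rw [← mul_assoc, hu1], by rw [mul_assoc, hyy w hw], ?_⟩
    rw [← mul_assoc p, ← mul_assoc, hu2, hyy w hw]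
  have heE : ∀ x, IsWt q s l x → p * x = x → e * x = x := fun x hx hpx => by
    rw [he, mul_assoc, hpx, hx.wtProj_mul hq hlN]
  have hcm : Commute p (wtProj q s n l) := HeckeGens.commute_wtProj n fun i hi =>
    (H.commute_shift_asym (by omega) (by omega) (by omega)).symm
  have hel : IsWt q s l e := by
    rw [he]
    exact H.isWt_wtProj hq hl (by omega) (by omega) _
  have hpe : p * e = e := by rw [he, ← mul_assoc, hcm.eq, mul_assoc, hpp]
  choose! u hu1 hu2 hu3 using hsurj
  have hul : ∀ w ∈ W, IsWt q s l (u w) := fun w hw => by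
    have := hyw w hw (u w)
    rw [hu1 w hw] at this
    exact this.of_append
  refine ⟨fun w => p * u w, fun w hw => ⟨?_, ?_, hu3 w hw⟩, fun w hw w' hw' hww => ?_, ?_⟩
  · exact heE _ (hpl (hul w hw)) (by rw [← mul_assoc, hpp])
  · show p * u w * y w = p * u w
    rw [mul_assoc, hu2 w hw]
  · show y w' * (p * u w) = 0
    rw [← hu1 w hw]
    exact hsep w hw w' hw' hww _
  · show ∑ w ∈ W, p * u w * (y w * e) = e
    -- The difference is a vector of weight l fixed by p with no component along any strip.
    rw [← sub_eq_zero]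
    have hsw : IsWt q s l (∑ w ∈ W, p * u w * (y w * e)) :=
      Finset.sum_induction _ (IsWt q s l) (fun _ _ => IsWt.add) (IsWt.zero l)
        fun w hw => (hpl (hul w hw)).mul_right _
    refine hinj _ (hsw.sub hel) ?_ fun w' hw' => ?_
    · rw [mul_sub, hpe, Finset.mul_sum]
      congr 1
      exact Finset.sum_congr rfl fun w _ => by rw [← mul_assoc, ← mul_assoc p p, hpp]
    · rw [mul_sub, Finset.mul_sum, Finset.sum_eq_single_of_mem w' hw', ← mul_assoc, hu3 w' hw',
        ← mul_assoc, hyy w' hw', sub_self]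
      intro w hw hww
      rw [← mul_assoc, ← hu1 w hw, hsep w hw w' hw' hww, zero_mul]

/-! ### Equivalence of the primitive idempotents of one shape -/

/-- The choice of interpolation nodes is immaterial: both elements have weight l, commute, and fix
each other. -/
theorem HeckeGens.wtProj_congr (hq : Generic q) (H : HeckeGens q n s) {l : List ℤ} (hl : IsPath l)
    (hn : l.length ≤ n) {N N' : ℕ} (hN : l.length ≤ N) (hN' : l.length ≤ N') :
    wtProj q s N l = wtProj q s N' l := by
  have h1 : ∀ N, l.length ≤ N → IsWt q s l (wtProj q s N l) := fun N hN => by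
    simpa using H.isWt_wtProj hq hl hn hN 1
  have hcm : Commute (wtProj q s N l) (wtProj q s N' l) :=
    HeckeGens.commute_wtProj N' fun i hi =>
      (H.jm_commute_wtProj N (by omega) hn).symm
  rw [← (h1 N hN).wtProj_mul hq (hl.mem_Ioo' hN'), ← hcm.eq,
    (h1 N' hN').wtProj_mul hq (hl.mem_Ioo' hN)]

theorem HeckeGens.exists_equiv (hq : Generic q) (H : HeckeGens q n s) {l l' : List ℤ}
    (hl : IsPath l) (hl' : IsPath l') (hlen : l.length = l'.length) (hn : l.length ≤ n) {N : ℕ}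
    (hN : l.length ≤ N) (h : state l = state l') :
    ∃ g k : A, wtProj q s N l' * g = g ∧ wtProj q s N l * k = k ∧
      g * wtProj q s N l = g ∧ k * wtProj q s N l' = k ∧
      k * g = wtProj q s N l ∧ g * k = wtProj q s N l' := by
  obtain ⟨-, g, k, h1, h2, -⟩ := H.linked_of_state_eq hq hl hl' hlen hn h
  have w1 : IsWt q s l (wtProj q s N l) := by simpa using H.isWt_wtProj hq hl hn hN 1
  have w2 : IsWt q s l' (wtProj q s N l') := by
    simpa using H.isWt_wtProj hq hl' (by omega) (hlen ▸ hN) 1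
  have i1 := hl.mem_Ioo' hN
  have i2 := hl'.mem_Ioo' (hlen ▸ hN)
  refine ⟨g * wtProj q s N l, k * wtProj q s N l', (h1 _ w1).1.wtProj_mul hq i2,
    (h2 _ w2).1.wtProj_mul hq i1, ?_, ?_, ?_, ?_⟩
  · rw [mul_assoc, w1.wtProj_mul hq i1]
  · rw [mul_assoc, w2.wtProj_mul hq i2]
  · rw [mul_assoc, (h1 _ w1).1.wtProj_mul hq i2, (h1 _ w1).2]
  · rw [mul_assoc, (h2 _ w2).1.wtProj_mul hq i1, (h2 _ w2).2]

end Hecke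

/-! ### Young diagrams and row lengths -/

section Diagrams

theorem rowLen_injective : Function.Injective YoungDiagram.rowLen := by
  intro μ ν h
  refine YoungDiagram.ext (Finset.ext fun c => ?_)
  obtain ⟨i, j⟩ := c
  rw [YoungDiagram.mem_cells, YoungDiagram.mem_cells, YoungDiagram.mem_iff_lt_rowLen,
    YoungDiagram.mem_iff_lt_rowLen, h]

theorem rowLen_eq_of_mem_iff {μ : YoungDiagram} {a : ℕ → ℕ} (h : ∀ i j, (i, j) ∈ μ ↔ j < a i) :
    μ.rowLen = a :=
  funext fun i => eq_of_forall_lt_iff fun j => by rw [← YoungDiagram.mem_iff_lt_rowLen, h]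

theorem exists_rowLen_eq {a : ℕ → ℕ} (ha : Antitone a) {N : ℕ} (hN : a N = 0) :
    ∃ μ : YoungDiagram, μ.rowLen = a := by
  refine ⟨⟨(Finset.range N ×ˢ Finset.range (a 0)).filter fun c => c.2 < a c.1, ?_⟩,
    rowLen_eq_of_mem_iff fun i j => ?_⟩
  · rintro ⟨i, j⟩ ⟨i', j'⟩ ⟨h1, h2⟩ h
    simp only [Finset.coe_filter, Finset.mem_product, Finset.mem_range, Set.mem_ofPred_eq] at h ⊢
    simp only at h1 h2
    have := ha h1
    omega
  · refine (YoungDiagram.mem_mk _ _ _).trans ?_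
    simp only [Finset.mem_filter, Finset.mem_product, Finset.mem_range, and_iff_right_iff_imp]
    intro h
    refine ⟨?_, h.trans_le (ha (Nat.zero_le i))⟩
    by_contra hi
    have := ha (not_lt.1 hi)
    omega

theorem rowLen_pos_iff {μ : YoungDiagram} {i : ℕ} : 0 < μ.rowLen i ↔ i < μ.colLen 0 := by
  rw [← YoungDiagram.mem_iff_lt_rowLen, YoungDiagram.mem_iff_lt_colLen]

theorem rowLen_eq_zero_iff {μ : YoungDiagram} {i : ℕ} : μ.rowLen i = 0 ↔ μ.colLen 0 ≤ i := by
  have := rowLen_pos_iff (μ := μ) (i := i)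
  omega

theorem card_eq_sum_rowLen {μ : YoungDiagram} {N : ℕ} (hN : μ.colLen 0 ≤ N) :
    μ.card = ∑ i ∈ Finset.range N, μ.rowLen i := by
  rw [YoungDiagram.card, Finset.card_eq_sum_card_fiberwise (f := Prod.fst) (t := Finset.range N)]
  · exact Finset.sum_congr rfl fun i _ => by rw [YoungDiagram.rowLen_eq_card]; rfl
  · rintro ⟨i, j⟩ h
    have : (i, j) ∈ μ := h
    rw [YoungDiagram.mem_iff_lt_rowLen] at this
    have := rowLen_pos_iff.1 (Nat.zero_lt_of_lt this)
    simp only [Finset.coe_range, Set.mem_Iio]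
    omega

theorem colLen_le_card (μ : YoungDiagram) : μ.colLen 0 ≤ μ.card := by
  rw [YoungDiagram.colLen_eq_card]
  exact Finset.card_le_card (Finset.filter_subset _ _)

/-- Lengthen the rows in `S` by one box. -/
def rowAdd (a : ℕ → ℕ) (S : Finset ℕ) (i : ℕ) : ℕ := a i + if i ∈ S then 1 else 0

theorem antitone_rowAdd {μ : YoungDiagram} {S : Finset ℕ} :
    Antitone (rowAdd μ.rowLen S) ↔ ∀ i, i + 1 ∈ S → μ.rowLen i = μ.rowLen (i + 1) → i ∈ S := by
  constructor
  · intro h i hi he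
    by_contra hn
    have := h (show i ≤ i + 1 by omega)
    simp only [rowAdd, hi, hn, he, if_true, if_false] at this
    omega
  · intro h
    refine antitone_nat_of_succ_le fun i => ?_
    have h1 := μ.rowLen_anti i (i + 1) (Nat.le_succ i)
    have h2 := h i
    simp only [rowAdd]
    split_ifs with h3 h4 h4 <;> first | omega | skip
    have : μ.rowLen i ≠ μ.rowLen (i + 1) := fun e => h4 (h2 h3 e)
    omega

/-- Empty rows must be filled from the top, so reaching row s uses a box in every row from `μ.colLen
0` to s. -/
theorem subset_range_of_antitone {μ : YoungDiagram} {S : Finset ℕ}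
    (h : Antitone (rowAdd μ.rowLen S)) : S ⊆ Finset.range (μ.colLen 0 + S.card) := by
  intro s hs
  rw [Finset.mem_range]
  by_contra hn
  have hsub : Finset.Ico (μ.colLen 0) (s + 1) ⊆ S := by
    intro i hi
    rw [Finset.mem_Ico] at hi
    have h1 := h (show i ≤ s by omega)
    by_contra hi'
    have h2 := rowLen_eq_zero_iff.2 hi.1
    simp only [rowAdd, hs, hi', if_true, if_false, h2] at h1
    omega
  have := Finset.card_le_card hsub
  rw [Nat.card_Ico] at this
  omega

theorem antitone_rowLen (μ : YoungDiagram) : Antitone μ.rowLen := fun i j h => μ.rowLen_anti i j h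

theorem exists_rowLen_eq_rowAdd {μ : YoungDiagram} {S : Finset ℕ} :
    (∃ ν : YoungDiagram, ν.rowLen = rowAdd μ.rowLen S) ↔ Antitone (rowAdd μ.rowLen S) := by
  refine ⟨fun ⟨ν, h⟩ => h ▸ antitone_rowLen ν, fun h => exists_rowLen_eq h
    (N := μ.colLen 0 + S.card) ?_⟩
  have h1 : μ.rowLen (μ.colLen 0 + S.card) = 0 := rowLen_eq_zero_iff.2 (Nat.le_add_right _ _)
  have h2 : μ.colLen 0 + S.card ∉ S := fun h' => by
    simpa using subset_range_of_antitone h h'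
  simp [rowAdd, h1, h2]

theorem card_of_rowLen_eq_rowAdd {μ ν : YoungDiagram} {S : Finset ℕ}
    (h : ν.rowLen = rowAdd μ.rowLen S) : ν.card = μ.card + S.card := by
  have hS := subset_range_of_antitone (h ▸ antitone_rowLen ν)
  set N := max (ν.colLen 0) (μ.colLen 0 + S.card)
  rw [card_eq_sum_rowLen (le_max_left _ _ : _ ≤ N),
    card_eq_sum_rowLen ((Nat.le_add_right _ _).trans (le_max_right _ _) : μ.colLen 0 ≤ N), h]
  simp only [rowAdd, Finset.sum_add_distrib, Finset.sum_boole, Nat.cast_id]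
  congr 2
  ext i
  rw [Finset.mem_filter, and_iff_right_iff_imp]
  exact fun hi => Finset.range_subset_range.2 (le_max_right _ _) (hS hi)

/-! ### Diagrams and bead configurations -/

/-- The position of the bead of a row. -/
def bead (μ : YoungDiagram) (i : ℕ) : ℤ := (μ.rowLen i : ℤ) - i

theorem bead_strictAnti (μ : YoungDiagram) : StrictAnti (bead μ) := fun i j h => by
  have := μ.rowLen_anti i j h.le
  simp only [bead]
  omega

/-- The set of beads of a diagram. -/
def maya (μ : YoungDiagram) : Set ℤ := Set.range (bead μ)

/-- Beads on neighbouring places belong to consecutive rows of equal length, where the lower row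
cannot grow unless the upper one does. -/
theorem bead_add_one_eq {μ : YoungDiagram} {i j : ℕ} :
    bead μ i + 1 = bead μ j ↔ i = j + 1 ∧ μ.rowLen j = μ.rowLen i := by
  constructor
  · intro h
    have h1 : j < i := (bead_strictAnti μ).lt_iff_gt.1 (by omega)
    have h2 : ¬ j + 1 < i := fun h2 => by
      have := bead_strictAnti μ h2
      have := bead_strictAnti μ (Nat.lt_succ_self j)
      simp only [Nat.succ_eq_add_one] at this
      omega
    have h3 : i = j + 1 := by omega
    refine ⟨h3, ?_⟩
    simp only [bead] at h
    omega
  · rintro ⟨rfl, h⟩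
    simp only [bead]
    omega

theorem maya_bot : maya ⊥ = state [] := by
  have h : (⊥ : YoungDiagram).rowLen = fun _ => 0 :=
    rowLen_eq_of_mem_iff fun i j => by simp [YoungDiagram.notMem_bot]
  ext c
  simp only [maya, Set.mem_range, bead, h, mem_state_nil]
  exact ⟨fun ⟨i, hi⟩ => by omega, fun hc => ⟨(-c).toNat, by omega⟩⟩

/-- In an increasing list every bead moves at most once: the places at the contents of w are vacated
and those one further are filled. -/
theorem mem_state_sorted {w l : List ℤ} (hw : w.Pairwise (· < ·)) {c : ℤ} :
    c ∈ state (w ++ l) ↔ (c ∈ state l ∧ c ∉ w) ∨ c - 1 ∈ w := by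
  induction w with
  | nil => simp
  | cons d w ih =>
    rw [List.pairwise_cons] at hw
    rw [List.cons_append, mem_state_cons, ih hw.2, List.mem_cons, List.mem_cons]
    have : c = d → c - 1 ∉ w := fun h h' => by
      have := hw.1 _ h'
      omega
    rw [sub_eq_iff_eq_add]
    tauto

/-- Larger contents move earlier, so a bead blocking the move from c only has to be among the moved
ones. -/
theorem isPath_sorted {w l : List ℤ} (hl : IsPath l) (hw : w.Pairwise (· < ·)) :
    IsPath (w ++ l) ↔ ∀ c ∈ w, c ∈ state l ∧ (c + 1 ∈ state l → c + 1 ∈ w) := by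
  induction w with
  | nil => simpa using hl
  | cons d w ih =>
    rw [List.pairwise_cons] at hw
    rw [List.cons_append, isPath_cons, ih hw.2, mem_state_sorted hw.2, mem_state_sorted hw.2]
    have h1 : d ∉ w := fun h => lt_irrefl _ (hw.1 _ h)
    have h2 : d - 1 ∉ w := fun h => by have := hw.1 _ h; omega
    have h3 : ∀ c ∈ w, c + 1 ≠ d := fun c hc h => by have := hw.1 _ hc; omega
    simp only [List.mem_cons, forall_eq_or_imp, add_sub_cancel_right]
    have h4 : d + 1 ≠ d := by omega
    have h5 : (∀ c ∈ w, c ∈ state l ∧ (c + 1 ∈ state l → c + 1 = d ∨ c + 1 ∈ w)) ↔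
        ∀ c ∈ w, c ∈ state l ∧ (c + 1 ∈ state l → c + 1 ∈ w) :=
      forall₂_congr fun c hc => by simp [h3 c hc]
    rw [h5]
    tauto

/-- The contents of the boxes added to the rows in `S`, in increasing order. -/
noncomputable def stripWord (μ : YoungDiagram) (S : Finset ℕ) : List ℤ :=
  (S.image (bead μ)).sort (· ≤ ·)

theorem mem_stripWord {μ : YoungDiagram} {S : Finset ℕ} {c : ℤ} :
    c ∈ stripWord μ S ↔ ∃ i ∈ S, bead μ i = c := by
  simp [stripWord]

theorem bead_mem_stripWord {μ : YoungDiagram} {S : Finset ℕ} {i : ℕ} :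
    bead μ i ∈ stripWord μ S ↔ i ∈ S := by
  rw [mem_stripWord]
  exact ⟨fun ⟨j, hj, h⟩ => (bead_strictAnti μ).injective h ▸ hj, fun h => ⟨i, h, rfl⟩⟩

theorem pairwise_stripWord (μ : YoungDiagram) (S : Finset ℕ) :
    (stripWord μ S).Pairwise (· < ·) := (Finset.sortedLT_sort _).pairwise

theorem length_stripWord (μ : YoungDiagram) (S : Finset ℕ) :
    (stripWord μ S).length = S.card := by
  rw [stripWord, Finset.length_sort, Finset.card_image_of_injective _ (bead_strictAnti μ).injective]

theorem stripWord_injective (μ : YoungDiagram) : Function.Injective (stripWord μ) := by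
  intro S S' h
  ext i
  rw [← bead_mem_stripWord (μ := μ), h, bead_mem_stripWord]

theorem isPath_stripWord {μ : YoungDiagram} {l : List ℤ} (hl : IsPath l) (h : state l = maya μ)
    {S : Finset ℕ} : IsPath (stripWord μ S ++ l) ↔ Antitone (rowAdd μ.rowLen S) := by
  rw [isPath_sorted hl (pairwise_stripWord μ S), antitone_rowAdd, h]
  constructor
  · intro H i hi he
    have := (H _ (bead_mem_stripWord.2 hi)).2
    rw [bead_add_one_eq.2 ⟨rfl, he⟩] at this
    exact bead_mem_stripWord.1 (this ⟨i, rfl⟩)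
  · rintro H c hc
    obtain ⟨i, hi, rfl⟩ := mem_stripWord.1 hc
    refine ⟨⟨i, rfl⟩, ?_⟩
    rintro ⟨j, hj⟩
    obtain ⟨rfl, he⟩ := bead_add_one_eq.1 hj.symm
    rw [← hj, bead_mem_stripWord]
    exact H j hi he

theorem state_stripWord {μ ν : YoungDiagram} {l : List ℤ} (h : state l = maya μ)
    {S : Finset ℕ} (hν : ν.rowLen = rowAdd μ.rowLen S) : state (stripWord μ S ++ l) = maya ν := by
  have hb : ∀ i, bead ν i = if i ∈ S then bead μ i + 1 else bead μ i := fun i => by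
    simp only [bead, hν, rowAdd]
    split_ifs <;> push_cast <;> ring
  ext c
  rw [mem_state_sorted (pairwise_stripWord μ S), h]
  constructor
  · rintro (⟨⟨i, rfl⟩, hi⟩ | hc)
    · rw [bead_mem_stripWord] at hi
      exact ⟨i, by rw [hb, if_neg hi]⟩
    · obtain ⟨i, hi, he⟩ := mem_stripWord.1 hc
      exact ⟨i, by rw [hb, if_pos hi, he]; ring⟩
  · rintro ⟨i, rfl⟩
    rw [hb]
    split_ifs with hi
    · exact Or.inr (by rwa [add_sub_cancel_right, bead_mem_stripWord])
    · exact Or.inl ⟨⟨i, rfl⟩, by rwa [bead_mem_stripWord]⟩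

theorem exists_stripWord_eq {μ : YoungDiagram} {l w : List ℤ} (h : state l = maya μ)
    (hw : w.Pairwise (· < ·)) (hp : IsPath (w ++ l)) : ∃ S, stripWord μ S = w := by
  refine ⟨w.toFinset.preimage (bead μ) (bead_strictAnti μ).injective.injOn, ?_⟩
  refine (Finset.sortedLT_sort _).pairwise.eq_of_mem_iff hw fun c => ?_
  have hc : c ∈ w → c ∈ maya μ := fun hc => h ▸ mem_state_of_sorted hw hp c hc
  rw [Finset.mem_sort, Finset.mem_image]
  simp only [Finset.mem_preimage, List.mem_toFinset]
  exact ⟨by rintro ⟨i, hi, rfl⟩; exact hi, fun hcw => by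
    obtain ⟨i, rfl⟩ := hc hcw
    exact ⟨i, hcw, rfl⟩⟩

/-! ### The path of a standard tableau -/

/-- The contents of the boxes of a tableau, the box of the largest entry first. -/
def StdTableau.path {lam : YoungDiagram} (T : StdTableau lam) : List ℤ :=
  (List.ofFn T.content).reverse

theorem StdTableau.length_path {lam : YoungDiagram} (T : StdTableau lam) :
    T.path.length = lam.card := by simp [StdTableau.path]

/-- The boxes with the first m entries form a diagram because entries increase along rows and
columns. -/
theorem StdTableau.exists_initial {lam : YoungDiagram} (T : StdTableau lam) (m : ℕ) :
    ∃ μ : YoungDiagram, ∀ c, c ∈ μ ↔ ∃ k : Fin lam.card, (k : ℕ) < m ∧ (T.pos k).1 = c := by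
  classical
  refine ⟨⟨(Finset.univ.filter fun k : Fin lam.card => (k : ℕ) < m).image fun k => (T.pos k).1,
    ?_⟩, fun c => by rw [YoungDiagram.mem_mk]; simp⟩
  intro c d hdc hc
  simp only [Finset.coe_image, Finset.coe_filter, Finset.mem_univ, true_and, Set.mem_image,
    Set.mem_ofPred_eq] at hc ⊢
  obtain ⟨k, hk, rfl⟩ := hc
  obtain ⟨j, hj⟩ := T.pos.surjective ⟨d, lam.isLowerSet hdc (T.pos k).2⟩
  have := T.mono j k (by rw [hj]; exact hdc)
  exact ⟨j, lt_of_le_of_lt this hk, by rw [hj]⟩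

/-- Each new box lengthens one row, a vertical strip of size one whose word is the single content of
the box. -/
theorem StdTableau.path_initial {lam : YoungDiagram} (T : StdTableau lam) (m : ℕ)
    (hm : m ≤ lam.card) (μ : YoungDiagram)
    (hμ : ∀ c, c ∈ μ ↔ ∃ k : Fin lam.card, (k : ℕ) < m ∧ (T.pos k).1 = c) :
    IsPath (List.ofFn fun k : Fin m => T.content (k.castLE hm)).reverse ∧
      state (List.ofFn fun k : Fin m => T.content (k.castLE hm)).reverse = maya μ := by
  induction m generalizing μ with
  | zero =>
    have : μ = ⊥ := by
      refine YoungDiagram.ext (Finset.ext fun c => ?_)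
      rw [YoungDiagram.mem_cells, hμ]
      simp
    rw [this, maya_bot]
    simp [IsPath]
  | succ m ih =>
    obtain ⟨ν, hν⟩ := T.exists_initial m
    obtain ⟨h1, h2⟩ := ih (by omega) ν hν
    set l := (List.ofFn fun k : Fin m => T.content (k.castLE (by omega))).reverse
    set k₀ : Fin lam.card := ⟨m, hm⟩
    have hl : (List.ofFn fun k : Fin (m + 1) => T.content (k.castLE hm)).reverse =
        T.content k₀ :: l := by
      rw [List.ofFn_succ', List.concat_eq_append, List.reverse_append]
      rfl
    have hins : ∀ c, c ∈ μ ↔ c ∈ ν ∨ c = (T.pos k₀).1 := fun c => by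
      rw [hμ, hν]
      constructor
      · rintro ⟨k, hk, rfl⟩
        rcases Nat.lt_succ_iff_lt_or_eq.1 hk with h | h
        · exact Or.inl ⟨k, h, rfl⟩
        · exact Or.inr (by rw [show k = k₀ from Fin.ext h])
      · rintro (⟨k, hk, rfl⟩ | rfl)
        · exact ⟨k, by omega, rfl⟩
        · exact ⟨k₀, Nat.lt_succ_self m, rfl⟩
    have hnot : (T.pos k₀).1 ∉ ν := fun h => by
      obtain ⟨k, hk, he⟩ := (hν _).1 h
      have := T.pos.injective (Subtype.ext he)
      rw [this] at hk
      exact lt_irrefl _ hk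
    obtain ⟨i, j, hij⟩ : ∃ i j, (T.pos k₀).1 = (i, j) := ⟨_, _, rfl⟩
    rw [hij] at hins hnot
    have hj : ν.rowLen i = j := by
      refine eq_of_forall_lt_iff fun j' => ?_
      rw [← YoungDiagram.mem_iff_lt_rowLen]
      constructor
      · intro h
        by_contra hlt
        exact hnot (ν.up_left_mem le_rfl (not_lt.1 hlt) h)
      · intro h
        have := (hins (i, j')).1 (μ.up_left_mem le_rfl h.le ((hins _).2 (Or.inr rfl)))
        refine this.resolve_right fun e => ?_
        rw [Prod.mk.injEq] at e
        omega
    have hrow : μ.rowLen = rowAdd ν.rowLen {i} := by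
      refine rowLen_eq_of_mem_iff fun i' j' => ?_
      simp only [hins, YoungDiagram.mem_iff_lt_rowLen, Prod.mk.injEq, rowAdd, Finset.mem_singleton]
      split_ifs with hi
      · subst hi; omega
      · simp [hi]
    have hw : stripWord ν {i} = [T.content k₀] := by
      simp [stripWord, bead, hj, StdTableau.content, hij]
    rw [hl, ← List.singleton_append, ← hw]
    exact ⟨(isPath_stripWord h1 h2).2 (hrow ▸ antitone_rowLen μ), state_stripWord h2 hrow⟩

theorem StdTableau.isPath_path {lam : YoungDiagram} (T : StdTableau lam) : IsPath T.path :=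
  have h : ∀ c, c ∈ lam ↔ ∃ k : Fin lam.card, (k : ℕ) < lam.card ∧ (T.pos k).1 = c := fun c =>
    ⟨fun hc => ⟨T.pos.symm ⟨c, hc⟩, Fin.is_lt _, by simp⟩, fun ⟨k, _, hk⟩ => hk ▸ (T.pos k).2⟩
  (T.path_initial lam.card le_rfl lam h).1

theorem StdTableau.state_path {lam : YoungDiagram} (T : StdTableau lam) :
    state T.path = maya lam :=
  have h : ∀ c, c ∈ lam ↔ ∃ k : Fin lam.card, (k : ℕ) < lam.card ∧ (T.pos k).1 = c := fun c =>
    ⟨fun hc => ⟨T.pos.symm ⟨c, hc⟩, Fin.is_lt _, by simp⟩, fun ⟨k, _, hk⟩ => hk ▸ (T.pos k).2⟩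
  (T.path_initial lam.card le_rfl lam h).2

/-! ### Columns -/

theorem rowLen_column (k : ℕ) : (column k).rowLen = fun i => if i < k then 1 else 0 := by
  refine rowLen_eq_of_mem_iff fun i j => ?_
  rw [column, YoungDiagram.mem_ofRowLens]
  simp only [List.length_replicate, List.getElem_replicate, exists_prop]
  split_ifs with h <;> omega

theorem colLen_column (k : ℕ) : (column k).colLen 0 = k :=
  eq_of_forall_lt_iff fun i => by
    simp only [← rowLen_pos_iff, rowLen_column]
    split_ifs with h <;> simp [h]

theorem card_column (k : ℕ) : (column k).card = k := by
  rw [card_eq_sum_rowLen (colLen_column k).le, rowLen_column,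
    Finset.sum_congr rfl fun i hi => if_pos (Finset.mem_range.1 hi)]
  simp

theorem column_zero : column 0 = ⊥ :=
  rowLen_injective <| by
    rw [rowLen_column, rowLen_eq_of_mem_iff (μ := ⊥) (a := fun _ => 0)] <;>
      simp [YoungDiagram.notMem_bot]

theorem maya_column (k : ℕ) : maya (column k) = state (colPath k) := by
  ext c
  rw [mem_state_colPath]
  simp only [maya, Set.mem_range, bead, rowLen_column]
  constructor
  · rintro ⟨i, rfl⟩
    split_ifs with h <;> push_cast <;> omega
  · rintro ⟨h1, h2⟩
    by_cases h : c ≤ -k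
    · refine ⟨(-c).toNat, ?_⟩
      rw [if_neg (by omega)]
      omega
    · refine ⟨(1 - c).toNat, ?_⟩
      rw [if_pos (by omega)]
      push_cast
      omega

/-- A column has only one standard tableau: its only removable box has content 1 - k. -/
theorem eq_colPath {l : List ℤ} (hl : IsPath l) {k : ℕ} (h : state l = state (colPath k)) :
    l = colPath k := by
  induction l generalizing k with
  | nil =>
    rcases k with _ | k
    · rfl
    · have : (1 : ℤ) ∈ state [] := by
        rw [h, mem_state_colPath]
        omega
      rw [mem_state_nil] at this
      omega
  | cons c l ih =>
    obtain ⟨h1, h2, h3⟩ := hl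
    have e : ∀ x, x ∈ state (c :: l) ↔ x ≤ 1 ∧ x ≠ 1 - k := fun x => by
      rw [h, mem_state_colPath]
    simp only [mem_state_cons] at e
    have ec := e c
    have ec1 := e (c + 1)
    have hc : c = 1 - k := by
      by_contra hne
      have h4 : ¬ (c ≤ 1 ∧ c ≠ 1 - k) := fun h => by
        rcases ec.2 h with h | h <;> omega
      have := ec1.1 (Or.inl rfl)
      omega
    have hk : c + 1 ≤ 1 := (ec1.1 (Or.inl rfl)).1
    rcases k with _ | k
    · omega
    · have hck : c = -k := by omega
      rw [colPath, ih h1 (k := k), hck]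
      ext x
      rw [mem_state_colPath]
      have ex := e x
      by_cases hx : x = c
      · subst hx
        simp only [h2, true_iff]
        omega
      · by_cases hx1 : x = c + 1
        · subst hx1
          simp only [h3, false_iff]
          omega
        · simp only [hx, hx1, false_or, ne_eq, not_false_eq_true, and_true] at ex
          rw [ex]
          omega

theorem StdTableau.path_column {k : ℕ} (T : StdTableau (column k)) : T.path = colPath k :=
  eq_colPath T.isPath_path (T.state_path.trans (maya_column k))

end Diagrams

/-! ### Functoriality of weight projectors and their product form -/

section Functoriality

variable {K : Type*} [Field K] {A B : Type*} [Ring A] [Algebra K A] [Ring B] [Algebra K B]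
  {q : K} {s : ℕ → A}

theorem map_jm (φ : A →ₐ[K] B) (k : ℕ) : φ (jm s k) = jm (fun i => φ (s i)) k := by
  induction k with
  | zero => simp [jm]
  | succ k ih => simp [jm, ih]

theorem jm_congr {s' : ℕ → A} {k : ℕ} (h : ∀ i < k, s i = s' i) : jm s k = jm s' k := by
  induction k with
  | zero => rfl
  | succ k ih =>
    rw [jm, jm, ih fun i hi => h i (by omega), h k (by omega)]

theorem map_wtProj (φ : A →ₐ[K] B) (N : ℕ) (l : List ℤ) :
    φ (wtProj q s N l) = wtProj q (fun i => φ (s i)) N l := by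
  induction l with
  | nil => simp [wtProj]
  | cons c l ih => rw [wtProj, wtProj, map_mul, ih, proj, proj, ← Polynomial.aeval_algHom_apply, map_jm]

theorem wtProj_congr_gens {s' : ℕ → A} {N : ℕ} {l : List ℤ}
    (h : ∀ i, i + 1 < l.length → s i = s' i) : wtProj q s N l = wtProj q s' N l := by
  induction l with
  | nil => rfl
  | cons c l ih =>
    rw [wtProj, wtProj, ih fun i hi => h i (by simp; omega),
      jm_congr fun i hi => h i (by simpa using hi)]

theorem wtProj_reverse_ofFn {N n : ℕ} (c : Fin n → ℤ) :
    wtProj q s N (List.ofFn c).reverse = (List.ofFn fun k => proj q N (jm s k) (c k)).prod := by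
  induction n with
  | zero => simp [wtProj]
  | succ n ih =>
    rw [List.ofFn_succ', List.concat_eq_append, List.reverse_append, List.ofFn_succ',
      List.concat_eq_append, List.prod_append, List.prod_singleton]
    simp only [List.reverse_singleton, List.singleton_append, wtProj, ih, List.length_reverse,
      List.length_ofFn, Fin.val_castSucc, Fin.val_last]

end Functoriality

/-! ### Primitive idempotents acting on tensor powers -/

section Tensor

variable {K : Type u} {V : Type v} [Field K] [AddCommGroup V] [Module K V]

theorem tens_mulEquiv {a a' b b' : ℕ} (f : ⨂[K]^a V →ₗ[K] ⨂[K]^b V)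
    (g : ⨂[K]^a' V →ₗ[K] ⨂[K]^b' V) (x : ⨂[K]^a V) (y : ⨂[K]^a' V) :
    tens f g (TensorPower.mulEquiv (x ⊗ₜ y)) = TensorPower.mulEquiv (f x ⊗ₜ g y) := by
  simp [tens]

theorem tens_comp_tens {a a' b b' c c' : ℕ} (f : ⨂[K]^a V →ₗ[K] ⨂[K]^b V)
    (g : ⨂[K]^a' V →ₗ[K] ⨂[K]^b' V) (f' : ⨂[K]^b V →ₗ[K] ⨂[K]^c V)
    (g' : ⨂[K]^b' V →ₗ[K] ⨂[K]^c' V) : tens f' g' ∘ₗ tens f g = tens (f' ∘ₗ f) (g' ∘ₗ g) := by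
  ext x
  simp [tens, TensorProduct.map_comp]

theorem tens_id_id {a b : ℕ} :
    tens (LinearMap.id : ⨂[K]^a V →ₗ[K] ⨂[K]^a V) (LinearMap.id : ⨂[K]^b V →ₗ[K] ⨂[K]^b V) =
      LinearMap.id := by
  ext x
  simp [tens]

/-- Extension of operators by the identity on the last `b` tensor factors. -/
noncomputable def tensL (K : Type u) (V : Type v) [Field K] [AddCommGroup V] [Module K V] (a b : ℕ) :
    Module.End K (⨂[K]^a V) →ₐ[K] Module.End K (⨂[K]^(a + b) V) :=
  AlgHom.ofLinearMap
    { toFun := fun f => tens f LinearMap.id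
      map_add' := fun f g => by
        ext x
        simp [tens, TensorProduct.map_add_left]
      map_smul' := fun c f => by
        ext x
        simp [tens, TensorProduct.map_smul_left] }
    tens_id_id (fun f g => (tens_comp_tens g LinearMap.id f LinearMap.id).symm)

/-- Extension of operators by the identity on the first `a` tensor factors. -/
noncomputable def tensR (K : Type u) (V : Type v) [Field K] [AddCommGroup V] [Module K V] (a b : ℕ) :
    Module.End K (⨂[K]^b V) →ₐ[K] Module.End K (⨂[K]^(a + b) V) :=
  AlgHom.ofLinearMap
    { toFun := fun f => tens LinearMap.id f
      map_add' := fun f g => by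
        ext x
        simp [tens, TensorProduct.map_add_right]
      map_smul' := fun c f => by
        ext x
        simp [tens, TensorProduct.map_smul_right] }
    tens_id_id (fun f g => (tens_comp_tens LinearMap.id g LinearMap.id f).symm)

theorem tensL_apply {a b : ℕ} (f : Module.End K (⨂[K]^a V)) :
    tensL K V a b f = tens f LinearMap.id := rfl

theorem tensR_apply {a b : ℕ} (f : Module.End K (⨂[K]^b V)) :
    tensR K V a b f = tens LinearMap.id f := rfl

theorem tens_eq_mul {a b : ℕ} (f : Module.End K (⨂[K]^a V)) (g : Module.End K (⨂[K]^b V)) :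
    tens f g = tensL K V a b f * tensR K V a b g :=
  (tens_comp_tens LinearMap.id g f LinearMap.id).symm

theorem tensorPower_hom_ext {a b : ℕ} {M : Type*} [AddCommGroup M] [Module K M]
    {f g : ⨂[K]^(a + b) V →ₗ[K] M}
    (h : ∀ (x : Fin a → V) (y : Fin b → V),
      f (TensorPower.mulEquiv (PiTensorProduct.tprod K x ⊗ₜ PiTensorProduct.tprod K y)) =
        g (TensorPower.mulEquiv (PiTensorProduct.tprod K x ⊗ₜ PiTensorProduct.tprod K y))) :
    f = g := by
  apply PiTensorProduct.ext
  ext v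
  have e := TensorPower.tprod_mul_tprod K (fun l => v (Fin.castAdd b l))
    (fun l => v (Fin.natAdd a l))
  rw [TensorPower.gMul_def, Fin.append_castAdd_natAdd] at e
  simp only [LinearMap.compMultilinearMap_apply]
  rw [← e, h]

/-- The operator `R_{i+1,i+2}` on `V^{⊗n}` for every index `i`, the identity out of range. -/
noncomputable def locOp (R : V ⊗[K] V →ₗ[K] V ⊗[K] V) (n i : ℕ) : Module.End K (⨂[K]^n V) :=
  if h : i < n - 1 then localOp R n ⟨i, h⟩ else 1

theorem tensL_locOp (R : V ⊗[K] V →ₗ[K] V ⊗[K] V) {a b i : ℕ} (hi : i + 1 < a) :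
    tensL K V a b (locOp R a i) = locOp R (a + b) i := by
  rw [locOp, dif_pos (by omega), locOp, dif_pos (by omega)]
  refine tensorPower_hom_ext fun x y => ?_
  rw [tensL_apply, tens_mulEquiv, eq_ins x i 2 (by omega), localOp_ins (i := ⟨i, _⟩),
    mul_ins_left, LinearMap.id_apply, mul_ins_left, localOp_ins (i := ⟨i, _⟩)]

theorem tensR_locOp (R : V ⊗[K] V →ₗ[K] V ⊗[K] V) {a b i : ℕ} (hi : i + 1 < b) :
    tensR K V a b (locOp R b i) = locOp R (a + b) (a + i) := by
  rw [locOp, dif_pos (by omega), locOp, dif_pos (by omega)]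
  refine tensorPower_hom_ext fun x y => ?_
  rw [tensR_apply, tens_mulEquiv, eq_ins y i 2 (by omega), localOp_ins (i := ⟨i, _⟩),
    mul_ins_right, LinearMap.id_apply, mul_ins_right, localOp_ins (i := ⟨a + i, _⟩)]

variable {q : K} {R : V ⊗[K] V →ₗ[K] V ⊗[K] V}

theorem IsHeckeSymmetry.generic (hR : IsHeckeSymmetry q R) : Generic q := ⟨hR.1, hR.2⟩

theorem heckeGens_locOp (hR : IsHeckeSymmetry q R) (n : ℕ) : HeckeGens q n (locOp R n) where
  quad i hi := by
    rw [locOp, dif_pos (by omega)]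
    have h := localOp_mul_add R q q⁻¹ hR.hecke n ⟨i, by omega⟩
    have hq := hR.q_ne_zero
    rw [Algebra.algebraMap_eq_smul_one, Algebra.algebraMap_eq_smul_one, sub_mul, mul_add, mul_add,
      smul_mul_assoc, smul_mul_assoc, mul_smul_comm, one_mul, mul_one, one_mul, smul_smul,
      mul_inv_cancel₀ hq, one_smul] at h
    rw [← sub_eq_zero, ← h]
    module
  braid i hi := by
    rw [locOp, dif_pos (by omega), locOp, dif_pos (by omega)]
    exact localOp_braid R hR.yang_baxter n i (by omega)
  comm i j hi hj := by
    rw [locOp, dif_pos (by omega), locOp, dif_pos (by omega)]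
    exact localOp_comm R n ⟨i, _⟩ ⟨j, _⟩ hi

theorem rho_gen (hR : IsHeckeSymmetry q R) (n : ℕ) (i : Fin (n - 1)) :
    rho hR n (gen q n i) = localOp R n i := by
  simp [rho, gen]

theorem rho_jucysMurphy (hR : IsHeckeSymmetry q R) {n k : ℕ} (hk : k < n) :
    rho hR n (jucysMurphy q n k) = jm (locOp R n) k := by
  induction k with
  | zero => simp [jucysMurphy, jm]
  | succ k ih =>
    rw [jucysMurphy, dif_pos (by omega), map_mul, map_mul, ih (by omega), rho_gen, jm, locOp,
      dif_pos (by omega)]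

theorem rho_youngIdem (hR : IsHeckeSymmetry q R) {lam : YoungDiagram} (T : StdTableau lam) :
    rho hR lam.card (youngIdem q T) = wtProj q (locOp R lam.card) lam.card T.path := by
  rw [StdTableau.path, wtProj_reverse_ofFn, youngIdem, map_list_prod, List.map_ofFn]
  congr 2
  ext1 k
  simp only [Function.comp_apply]
  rw [← Polynomial.aeval_algHom_apply, rho_jucysMurphy hR k.isLt, proj]

theorem locOp_mem_range (hR : IsHeckeSymmetry q R) (n i : ℕ) : locOp R n i ∈ (rho hR n).range := by
  rw [locOp]
  split_ifs with h
  · exact ⟨gen q n ⟨i, h⟩, rho_gen hR n _⟩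
  · exact one_mem _

/-- The projector of a word with one letter. -/
theorem projector_singleton (hR : IsHeckeSymmetry q R) {lam : YoungDiagram} (T : StdTableau lam) :
    projector hR [⟨lam, T⟩] =
      wtProj q (locOp R (lam.card + 0)) lam.card T.path := by
  show tens (rho hR lam.card (youngIdem q T)) LinearMap.id = _
  rw [rho_youngIdem, ← tensL_apply, map_wtProj]
  exact wtProj_congr_gens fun i hi => tensL_locOp R (by rwa [T.length_path] at hi)

/-- The projector of a word with two letters. -/
theorem projector_pair (hR : IsHeckeSymmetry q R) {lam mu : YoungDiagram} (T : StdTableau lam)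
    (S : StdTableau mu) :
    projector hR [⟨lam, T⟩, ⟨mu, S⟩] =
      wtProj q (locOp R (lam.card + (mu.card + 0))) lam.card T.path *
        wtProj q (fun i => locOp R (lam.card + (mu.card + 0)) (lam.card + i)) mu.card S.path := by
  show tens (rho hR lam.card (youngIdem q T)) (projector hR [⟨mu, S⟩]) = _
  rw [rho_youngIdem, projector_singleton]
  refine (tens_eq_mul (b := mu.card + 0) _ _).trans ?_
  rw [map_wtProj, map_wtProj]
  congr 1
  · exact wtProj_congr_gens fun i hi => tensL_locOp R (by rwa [T.length_path] at hi)
  · exact wtProj_congr_gens fun i hi => tensR_locOp R (by rw [S.length_path] at hi; omega)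

theorem cast_conj_wtProj {m n N : ℕ} (h : m = n) (l : List ℤ) :
    (TensorPower.cast K V h).conj (wtProj q (locOp R m) N l) = wtProj q (locOp R n) N l := by
  subst h
  ext x
  simp [LinearEquiv.conj_apply]

theorem mor_cast (hR : IsHeckeSymmetry q R) (p : ℕ) {m n : ℕ} (h : m = n) :
    Mor hR p m n (TensorPower.cast K V h).toLinearMap := by
  subst h
  have : (TensorPower.cast K V (rfl : m = m)).toLinearMap = rho hR m 1 := by
    ext x
    simp
  rw [this]
  exact .first m 1

theorem mor_of_mem_range (hR : IsHeckeSymmetry q R) (p : ℕ) {n : ℕ} {f : Module.End K (⨂[K]^n V)}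
    (h : f ∈ (rho hR n).range) : Mor hR p n n f := by
  obtain ⟨τ, rfl⟩ := h
  exact .first n τ

end Tensor

/-! ### From decompositions of idempotents to isomorphisms and additivity -/

section Splitting

variable {K : Type u} {V : Type v} [Field K] [AddCommGroup V] [Module K V]
  {q : K} {R : V ⊗[K] V →ₗ[K] V ⊗[K] V} {hR : IsHeckeSymmetry q R} {p : ℕ}

namespace SW

/-- The map between word spaces induced by a map between tensor powers of `V`. -/
noncomputable def wordMap {w w' : List Label} (g : ⨂[K]^(degree w) V →ₗ[K] ⨂[K]^(degree w') V)
    (h : projector hR w' ∘ₗ g = g) : wordSpace hR w →ₗ[K] wordSpace hR w' :=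
  LinearMap.codRestrict _ (g ∘ₗ (wordSpace hR w).subtype)
    fun x => ⟨g x, LinearMap.congr_fun h x⟩

theorem coe_wordMap {w w' : List Label} (g : ⨂[K]^(degree w) V →ₗ[K] ⨂[K]^(degree w') V)
    (h : projector hR w' ∘ₗ g = g) (x : wordSpace hR w) : (wordMap g h x : ⨂[K]^(degree w') V) = g x :=
  rfl

theorem isWordMor_wordMap {w w' : List Label} {g : ⨂[K]^(degree w) V →ₗ[K] ⨂[K]^(degree w') V}
    (h : projector hR w' ∘ₗ g = g) (hg : Mor hR p _ _ g) : IsWordMor hR p (wordMap g h) :=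
  ⟨g, hg, fun _ => rfl⟩

/-- The morphism with given components. -/
noncomputable def homOfComponents (U W : SW hR p)
    (m : ∀ i j, wordSpace hR (U.summands.get i) →ₗ[K] wordSpace hR (W.summands.get j))
    (hm : ∀ i j, IsWordMor hR p (m i j)) : U ⟶ W where
  toLin := LinearMap.pi fun j => ∑ i, m i j ∘ₗ LinearMap.proj i
  isMor i j := by
    convert hm i j using 1
    ext1 x
    simp only [LinearMap.comp_apply, LinearMap.proj_apply, LinearMap.pi_apply, LinearMap.sum_apply,
      LinearMap.coe_single]
    rw [Finset.sum_eq_single_of_mem i (Finset.mem_univ i)]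
    · rw [Pi.single_eq_same]
    · intro k _ hk
      rw [Pi.single_eq_of_ne hk, map_zero]

theorem toLin_homOfComponents {U W : SW hR p}
    (m : ∀ i j, wordSpace hR (U.summands.get i) →ₗ[K] wordSpace hR (W.summands.get j))
    (hm : ∀ i j, IsWordMor hR p (m i j)) (x : U.Space) (j : Fin W.summands.length) :
    Hom.toLin (homOfComponents U W m hm) x j = ∑ i, m i j (x i) := by
  show (LinearMap.pi fun j => ∑ i, m i j ∘ₗ LinearMap.proj i : U.Space →ₗ[K] W.Space) x j = _
  simp [LinearMap.pi_apply, LinearMap.sum_apply]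

theorem projector_coe {w : List Label} (h : projector hR w ∘ₗ projector hR w = projector hR w)
    (x : wordSpace hR w) : projector hR w x = x := by
  obtain ⟨_, x, rfl⟩ := x
  exact LinearMap.congr_fun h x

/-- Mutually inverse matrices of maps between tensor powers induce mutually inverse morphisms. -/
theorem homOfComponents_comp {U W : SW hR p}
    (g : ∀ i j, ⨂[K]^(degree (U.summands.get i)) V →ₗ[K] ⨂[K]^(degree (W.summands.get j)) V)
    (h : ∀ j i, ⨂[K]^(degree (W.summands.get j)) V →ₗ[K] ⨂[K]^(degree (U.summands.get i)) V)
    (hg : ∀ i j, Mor hR p _ _ (g i j)) (hh : ∀ j i, Mor hR p _ _ (h j i))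
    (hPg : ∀ i j, projector hR _ ∘ₗ g i j = g i j) (hPh : ∀ j i, projector hR _ ∘ₗ h j i = h j i)
    (hgh : ∀ i, ∑ j, h j i ∘ₗ g i j = projector hR (U.summands.get i))
    (hgh' : ∀ i k, i ≠ k → ∑ j, h j k ∘ₗ g i j = 0) :
    homOfComponents U W (fun i j => wordMap (g i j) (hPg i j))
        (fun i j => isWordMor_wordMap (hPg i j) (hg i j)) ≫
      homOfComponents W U (fun j i => wordMap (h j i) (hPh j i))
        (fun j i => isWordMor_wordMap (hPh j i) (hh j i)) = 𝟙 U := by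
  have hP : ∀ i (x : wordSpace hR (U.summands.get i)), projector hR (U.summands.get i) x = x := by
    refine fun i => projector_coe ?_
    refine LinearMap.ext fun x => ?_
    have e := LinearMap.congr_fun (hgh i) x
    rw [LinearMap.sum_apply] at e
    rw [LinearMap.comp_apply, ← e, _root_.map_sum]
    exact Finset.sum_congr rfl fun j _ => LinearMap.congr_fun (hPh j i) (g i j x)
  refine Hom.ext (LinearMap.ext fun x => funext fun k => Subtype.ext ?_)
  change ((Hom.toLin (homOfComponents W U (fun j i => wordMap (h j i) (hPh j i))
    fun j i => isWordMor_wordMap (hPh j i) (hh j i)) (Hom.toLin (homOfComponents U W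
      (fun i j => wordMap (g i j) (hPg i j)) fun i j => isWordMor_wordMap (hPg i j) (hg i j)) x)) k).1 =
    (x k).1
  rw [toLin_homOfComponents, Submodule.coe_sum]
  have e1 : ∀ j, (wordMap (h j k) (hPh j k) (Hom.toLin (homOfComponents U W
      (fun i j => wordMap (g i j) (hPg i j)) fun i j => isWordMor_wordMap (hPg i j) (hg i j)) x j)).1 =
      ∑ i, h j k (g i j (x i).1) := fun j => by
    rw [coe_wordMap, toLin_homOfComponents, Submodule.coe_sum, _root_.map_sum]
    rfl
  refine (Finset.sum_congr rfl fun j _ => e1 j).trans ?_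
  rw [Finset.sum_comm, Finset.sum_eq_single_of_mem k (Finset.mem_univ k)]
  · have e := LinearMap.congr_fun (hgh k) (x k).1
    rw [LinearMap.sum_apply, hP] at e
    exact e
  · intro i _ hik
    have e := LinearMap.congr_fun (hgh' i k hik) (x i).1
    rw [LinearMap.sum_apply] at e
    exact e

theorem nonempty_iso_of_matrices {U W : SW hR p}
    (g : ∀ i j, ⨂[K]^(degree (U.summands.get i)) V →ₗ[K] ⨂[K]^(degree (W.summands.get j)) V)
    (h : ∀ j i, ⨂[K]^(degree (W.summands.get j)) V →ₗ[K] ⨂[K]^(degree (U.summands.get i)) V)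
    (hg : ∀ i j, Mor hR p _ _ (g i j)) (hh : ∀ j i, Mor hR p _ _ (h j i))
    (hPg : ∀ i j, projector hR _ ∘ₗ g i j = g i j) (hPh : ∀ j i, projector hR _ ∘ₗ h j i = h j i)
    (hgh : ∀ i, ∑ j, h j i ∘ₗ g i j = projector hR (U.summands.get i))
    (hgh' : ∀ i k, i ≠ k → ∑ j, h j k ∘ₗ g i j = 0)
    (hhg : ∀ j, ∑ i, g i j ∘ₗ h j i = projector hR (W.summands.get j))
    (hhg' : ∀ j k, j ≠ k → ∑ i, g i k ∘ₗ h j i = 0) : Nonempty (U ≅ W) :=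
  ⟨⟨_, _, homOfComponents_comp g h hg hh hPg hPh hgh hgh',
    homOfComponents_comp h g hh hg hPh hPg hhg hhg'⟩⟩

/-- A complete system of orthogonal decompositions of the projector of a word splits the
corresponding object into a direct sum. -/
theorem nonempty_iso_of_split (w : List Label) (ws : List (List Label))
    (α : ∀ j : Fin ws.length, ⨂[K]^(degree (ws.get j)) V →ₗ[K] ⨂[K]^(degree w) V)
    (β : ∀ j : Fin ws.length, ⨂[K]^(degree w) V →ₗ[K] ⨂[K]^(degree (ws.get j)) V)
    (hα : ∀ j, Mor hR p _ _ (α j)) (hβ : ∀ j, Mor hR p _ _ (β j))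
    (hPα : ∀ j, projector hR w ∘ₗ α j = α j)
    (hPβ : ∀ j, projector hR (ws.get j) ∘ₗ β j = β j)
    (hβα : ∀ j, β j ∘ₗ α j = projector hR (ws.get j))
    (hβα' : ∀ i j, i ≠ j → β i ∘ₗ α j = 0)
    (hsum : ∑ j, α j ∘ₗ β j = projector hR w) :
    Nonempty ((⟨[w]⟩ : SW hR p) ≅ ⟨ws⟩) :=
  nonempty_iso_of_matrices (U := ⟨[w]⟩) (W := ⟨ws⟩)
    (fun i j => match i with | ⟨0, _⟩ => β j) (fun j i => match i with | ⟨0, _⟩ => α j)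
    (fun i j => match i with | ⟨0, _⟩ => hβ j) (fun j i => match i with | ⟨0, _⟩ => hα j)
    (fun i j => match i with | ⟨0, _⟩ => hPβ j) (fun j i => match i with | ⟨0, _⟩ => hPα j)
    (fun i => match i with | ⟨0, _⟩ => hsum)
    (fun i k hik => absurd (Subsingleton.elim (α := Fin 1) i k) hik)
    (fun j => (Fin.sum_univ_one _).trans (hβα j))
    (fun i j hij => (Fin.sum_univ_one _).trans (hβα' j i hij.symm))

variable {f : SW hR p → K}

/-- The empty direct sum is its own sum with itself. -/
theorem IsAMFunctional.map_nil (hf : IsAMFunctional f) : f ⟨[]⟩ = 0 := by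
  have := hf.add ⟨[]⟩ ⟨[]⟩
  exact left_eq_add.1 this

theorem IsAMFunctional.map_sum (hf : IsAMFunctional f) (ws : List (List Label)) :
    f ⟨ws⟩ = (ws.map fun w => f ⟨[w]⟩).sum := by
  induction ws with
  | nil => simpa using hf.map_nil
  | cons w ws ih =>
    rw [List.map_cons, List.sum_cons, ← ih]
    exact hf.add ⟨[w]⟩ ⟨ws⟩

theorem IsAMFunctional.map_cons (hf : IsAMFunctional f) (T : Label) (w : List Label) :
    f ⟨[T :: w]⟩ = f (basicAt T.2) * f ⟨[w]⟩ :=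
  hf.mul ⟨[[T]]⟩ ⟨[w]⟩

/-- Splitting of a word in one fixed algebra of operators on a tensor power of `V`. -/
theorem IsAMFunctional.map_split (hf : IsAMFunctional f) {ι : Type*} [DecidableEq ι] (S : Finset ι)
    (w : List Label) (φ : ι → List Label) (hdeg : ∀ i ∈ S, degree (φ i) = degree w)
    (y a b : ι → Module.End K (⨂[K]^(degree w) V))
    (hy : ∀ i ∈ S, ∀ h : degree (φ i) = degree w,
      (TensorPower.cast K V h).conj (projector hR (φ i)) = y i)
    (ha : ∀ i ∈ S, a i ∈ (rho hR (degree w)).range) (hb : ∀ i ∈ S, b i ∈ (rho hR (degree w)).range)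
    (hea : ∀ i ∈ S, projector hR w * a i = a i) (hyb : ∀ i ∈ S, y i * b i = b i)
    (hba : ∀ i ∈ S, b i * a i = y i) (hba' : ∀ i ∈ S, ∀ j ∈ S, i ≠ j → b i * a j = 0)
    (hsum : ∑ i ∈ S, a i * b i = projector hR w) :
    f ⟨[w]⟩ = ∑ i ∈ S, f ⟨[φ i]⟩ := by
  set ws := S.toList.map φ with hws
  have hlen : ws.length = S.toList.length := List.length_map _
  let x : Fin ws.length → ι := fun j => S.toList.get (j.cast hlen)
  have hxS : ∀ j, x j ∈ S := fun j => Finset.mem_toList.1 (List.get_mem _ _)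
  have hx : ∀ j, ws.get j = φ (x j) := fun j => by simp [x, hws]
  have hxinj : Function.Injective x := fun i j h => by
    have := (List.nodup_iff_injective_get.1 (Finset.nodup_toList S)) h
    exact Fin.ext (by simpa using congrArg Fin.val this)
  have hd : ∀ j, degree (ws.get j) = degree w := fun j => by rw [hx, hdeg _ (hxS j)]
  -- The words `ws.get j` and `φ (x j)` agree only propositionally, so their projectors live on
  -- different types; generalizing the word permits the substitution.
  have hproj : ∀ w', ∀ i ∈ S, w' = φ i → ∀ h : degree w' = degree w,
      (TensorPower.cast K V h).conj (projector hR w') = y i := by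
    rintro _ i hi rfl h
    exact hy i hi h
  have hP : ∀ j, (TensorPower.cast K V (hd j)).conj (projector hR (ws.get j)) = y (x j) :=
    fun j => hproj _ _ (hxS j) (hx j) _
  have hP' : ∀ j, projector hR (ws.get j) = (TensorPower.cast K V (hd j)).symm.toLinearMap ∘ₗ
      y (x j) ∘ₗ (TensorPower.cast K V (hd j)).toLinearMap := fun j => by
    rw [← hP]
    ext z
    simp [LinearEquiv.conj_apply]
  have hxsum : ∀ {M : Type _} [AddCommMonoid M] (g : ι → M), ∑ j, g (x j) = ∑ i ∈ S, g i := by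
    intro M _ g
    refine Finset.sum_bij (fun j _ => x j) (fun j _ => hxS j) (fun i _ j _ h => hxinj h)
      (fun i hi => ?_) (fun _ _ => rfl)
    obtain ⟨n, hn⟩ := List.mem_iff_get.1 (Finset.mem_toList.2 hi)
    exact ⟨n.cast hlen.symm, Finset.mem_univ _, by rw [← hn]; rfl⟩
  have key := nonempty_iso_of_split (hR := hR) (p := p) w ws
    (fun j => a (x j) ∘ₗ (TensorPower.cast K V (hd j)).toLinearMap)
    (fun j => (TensorPower.cast K V (hd j)).symm.toLinearMap ∘ₗ b (x j))
    (fun j => .comp (mor_cast hR p (hd j)) (mor_of_mem_range hR p (ha _ (hxS j))))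
    (fun j => .comp (mor_of_mem_range hR p (hb _ (hxS j))) (by
      rw [TensorPower.cast_symm]
      exact mor_cast hR p _))
    (fun j => by
      rw [← LinearMap.comp_assoc]
      exact congrArg (· ∘ₗ _) (hea _ (hxS j)))
    (fun j => by
      rw [hP']
      refine LinearMap.ext fun z => ?_
      simp only [LinearMap.comp_apply, LinearEquiv.coe_coe, LinearEquiv.apply_symm_apply]
      rw [← Module.End.mul_apply, hyb _ (hxS j)])
    (fun j => by
      rw [hP', ← hba _ (hxS j)]
      rfl)
    (fun i j hij => by
      refine LinearMap.ext fun z => ?_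
      simp only [LinearMap.comp_apply, LinearEquiv.coe_coe]
      rw [← Module.End.mul_apply, hba' _ (hxS i) _ (hxS j) (hxinj.ne hij)]
      simp)
    (by
      rw [← hsum, ← hxsum]
      refine Finset.sum_congr rfl fun j _ => ?_
      refine LinearMap.ext fun z => ?_
      simp only [LinearMap.comp_apply, LinearEquiv.coe_coe, LinearEquiv.apply_symm_apply,
        Module.End.mul_apply])
  rw [hf.iso _ _ key, hf.map_sum, hws, List.map_map, Finset.sum_map_toList]
  rfl

end SW

end Splitting

/-! ### The Pieri decomposition along arbitrary tableaux -/

section Hecke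

variable {K : Type*} [Field K] {A : Type*} [Ring A] [Algebra K A] {q : K} {s : ℕ → A}

/-- The splitting of the product of a primitive idempotent with an antisymmetrizer into primitive
idempotents, for arbitrary paths to the resulting diagrams. -/
theorem HeckeGens.pieri_paths [FiniteDimensional K A] (hq : Generic q) {mu : YoungDiagram}
    {l : List ℤ} {k : ℕ} (H : HeckeGens q (l.length + k) s) (hl : IsPath l)
    (hs : state l = maya mu) (S : Finset (Finset ℕ))
    (hS : ∀ X, X ∈ S ↔ X.card = k ∧ Antitone (rowAdd mu.rowLen X)) (t : Finset ℕ → List ℤ)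
    (ht : ∀ X ∈ S, IsPath (t X) ∧ (t X).length = l.length + k ∧
      state (t X) = state (stripWord mu X ++ l)) {e : A}
    (he : e = wtProj q s (l.length + k) l * wtProj q (fun i => s (l.length + i)) k (colPath k)) :
    ∃ a b : Finset ℕ → A,
      (∀ X ∈ S, e * a X = a X ∧ wtProj q s (l.length + k) (t X) * b X = b X ∧
        b X * a X = wtProj q s (l.length + k) (t X)) ∧
      (∀ X ∈ S, ∀ Y ∈ S, X ≠ Y → b X * a Y = 0) ∧ ∑ X ∈ S, a X * b X = e := by
  classical
  have hp : ∀ X ∈ S, IsPath (stripWord mu X ++ l) := fun X hX =>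
    (isPath_stripWord hl hs).2 ((hS X).1 hX).2
  have hlen : ∀ X ∈ S, (stripWord mu X ++ l).length = l.length + k := fun X hX => by
    rw [List.length_append, length_stripWord, ((hS X).1 hX).1, add_comm]
  obtain ⟨a, h1, h2, h3⟩ := H.pieri hq hl (S.image (stripWord mu)) (fun w => by
    rw [Finset.mem_image]
    constructor
    · rintro ⟨X, hX, rfl⟩
      exact ⟨by rw [length_stripWord, ((hS X).1 hX).1], pairwise_stripWord mu X, hp X hX⟩
    · rintro ⟨hw1, hw2, hw3⟩
      obtain ⟨X, rfl⟩ := exists_stripWord_eq hs hw2 hw3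
      exact ⟨X, (hS X).2 ⟨by rw [← hw1, length_stripWord], (isPath_stripWord hl hs).1 hw3⟩, rfl⟩)
    (e := e) (by rw [he, HeckeGens.wtProj_colPath hq H.shift le_rfl])
  have hlink : ∀ X ∈ S, _ := fun X hX => H.exists_equiv hq (hp X hX) (ht X hX).1
    ((hlen X hX).trans (ht X hX).2.1.symm) (hlen X hX).le (N := l.length + k) (hlen X hX).le
    (ht X hX).2.2.symm
  choose! g r hg1 hr1 hg2 hr2 hrg hgr using hlink
  have hmem : ∀ X ∈ S, stripWord mu X ∈ S.image (stripWord mu) := fun X hX =>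
    Finset.mem_image_of_mem _ hX
  -- The elements g and r carry the weight space of the sorted path to that of `t X` and back, so
  -- they cancel in the sum and replace the idempotents as required.
  refine ⟨fun X => a (stripWord mu X) * r X,
    fun X => g X * (wtProj q s (l.length + k) (stripWord mu X ++ l) * e),
    fun X hX => ⟨?_, ?_, ?_⟩, fun X hX Y hY hXY => ?_, ?_⟩
  · rw [← mul_assoc, (h1 _ (hmem X hX)).1]
  · rw [← mul_assoc, hg1 X hX]
  · obtain ⟨i1, i2, i3⟩ := h1 _ (hmem X hX)
    rw [mul_assoc, mul_assoc, ← mul_assoc e, i1, ← mul_assoc _ (a _), i3, hr1 X hX, hgr X hX]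
  · obtain ⟨i1, i2, i3⟩ := h1 _ (hmem Y hY)
    rw [mul_assoc, mul_assoc, ← mul_assoc e, i1, ← mul_assoc _ (a _),
      h2 _ (hmem Y hY) _ (hmem X hX) ((stripWord_injective mu).ne hXY.symm), zero_mul, mul_zero]
  · rw [Finset.sum_image fun X _ Y _ h => stripWord_injective mu h] at h3
    refine Eq.trans (Finset.sum_congr rfl fun X hX => ?_) h3
    obtain ⟨i1, i2, i3⟩ := h1 _ (hmem X hX)
    rw [mul_assoc, ← mul_assoc (r X), hrg X hX, ← mul_assoc, ← mul_assoc, i2, mul_assoc]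

end Hecke

/-! ### Uniqueness of solutions of the Pieri rule -/

section Extension

/-- A diagram with given row lengths, if there is one. -/
noncomputable def ofRowLen (a : ℕ → ℕ) : YoungDiagram :=
  open Classical in if h : ∃ mu : YoungDiagram, mu.rowLen = a then h.choose else ⊥

theorem rowLen_ofRowLen {a : ℕ → ℕ} (h : ∃ mu : YoungDiagram, mu.rowLen = a) :
    (ofRowLen a).rowLen = a := by
  rw [ofRowLen, dif_pos h]
  exact h.choose_spec

/-- Extension by zero of a function on diagrams to sequences of row lengths. -/
noncomputable def extRows {L : Type*} [Zero L] (D : YoungDiagram → L) (a : ℕ → ℕ) : L :=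
  open Classical in if ∃ mu : YoungDiagram, mu.rowLen = a then D (ofRowLen a) else 0

theorem extRows_rowLen {L : Type*} [Zero L] (D : YoungDiagram → L) (mu : YoungDiagram) :
    extRows D mu.rowLen = D mu := by
  have h : ∃ nu : YoungDiagram, nu.rowLen = mu.rowLen := ⟨mu, rfl⟩
  rw [extRows, if_pos h, rowLen_injective (rowLen_ofRowLen h)]

theorem extRows_of_not {L : Type*} [Zero L] (D : YoungDiagram → L) {a : ℕ → ℕ}
    (h : ¬ ∃ mu : YoungDiagram, mu.rowLen = a) : extRows D a = 0 := if_neg h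

/-- The Pieri rule for multiplication by `e k`: the sum runs over the vertical strips. -/
def IsPieri {L : Type*} [CommRing L] (p : ℕ) (e : ℕ → L) (D : YoungDiagram → L) : Prop :=
  -- Vertical strips of size k lie in the first `mu.colLen 0 + k` rows, so larger N give the same
  -- sum; the summand p keeps the first p rows in range.
  ∀ (mu : YoungDiagram) (k N : ℕ), mu.colLen 0 + k + p ≤ N →
    D mu * e k = ∑ X ∈ (Finset.range N).powersetCard k, extRows D (rowAdd mu.rowLen X)

/-- A solution of the Pieri rule is determined by its value at the empty diagram. -/
theorem IsPieri.unique {L : Type*} [CommRing L] {p : ℕ} {e : ℕ → L} {D D' : YoungDiagram → L}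
    (h : IsPieri p e D) (h' : IsPieri p e D') (h0 : D ⊥ = D' ⊥) : D = D' := by
  -- The outer induction is on the size and the inner one on a bound r for size minus number of
  -- rows, so among diagrams of one size those with longer first column come first.
  suffices ∀ m r : ℕ, ∀ mu : YoungDiagram, mu.card = m → m ≤ mu.colLen 0 + r → D mu = D' mu from
    funext fun mu => this mu.card mu.card mu rfl (Nat.le_add_left _ _)
  intro m
  induction m using Nat.strong_induction_on with
  | _ m ih =>
  intro r
  induction r using Nat.strong_induction_on with
  | _ r ihr =>
  intro mu hm hr
  set k := mu.colLen 0 with hk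
  rcases Nat.eq_zero_or_pos k with h0k | hkpos
  · have : mu = ⊥ := rowLen_injective <| by
      rw [rowLen_eq_of_mem_iff (μ := ⊥) (a := fun _ => 0)
        (fun i j => by simp [YoungDiagram.notMem_bot])]
      exact funext fun i => rowLen_eq_zero_iff.2 (by omega)
    rw [this, h0]
  · obtain ⟨nu, hnu⟩ := exists_rowLen_eq (a := fun i => mu.rowLen i - 1) (N := k)
      (fun i j hij => Nat.sub_le_sub_right (antitone_rowLen mu hij) 1)
      (by rw [rowLen_eq_zero_iff.2 hk.ge])
    have hmu : mu.rowLen = rowAdd nu.rowLen (Finset.range k) := funext fun i => by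
      have := rowLen_pos_iff (μ := mu) (i := i)
      rw [rowAdd, hnu]
      simp only [Finset.mem_range]
      split_ifs with hi <;> omega
    have hcard := card_of_rowLen_eq_rowAdd hmu
    rw [Finset.card_range] at hcard
    set N := nu.colLen 0 + k + p
    have hkS : Finset.range k ∈ (Finset.range N).powersetCard k := by
      rw [Finset.mem_powersetCard, Finset.card_range]
      exact ⟨Finset.range_subset_range.2 (by omega), rfl⟩
    have e1 := h nu k N le_rfl
    have e2 := h' nu k N le_rfl
    rw [← Finset.sum_erase_add _ _ hkS, ← hmu, extRows_rowLen] at e1 e2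
    rw [ih nu.card (by omega) nu.card nu rfl (Nat.le_add_left _ _), e2,
      Finset.sum_congr rfl (g := fun X => extRows D (rowAdd nu.rowLen X))] at e1
    · exact (add_left_cancel e1).symm
    · intro X hX
      rw [Finset.mem_erase, Finset.mem_powersetCard] at hX
      obtain ⟨hXk, hXN, hXc⟩ := hX
      by_cases hex : ∃ ka : YoungDiagram, ka.rowLen = rowAdd nu.rowLen X
      · obtain ⟨ka, hka⟩ := hex
        rw [← hka, extRows_rowLen, extRows_rowLen]
        -- Any other strip of k boxes reaches a row beyond the first k, so the resulting diagram has
        -- more rows than mu.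
        obtain ⟨i, hiX, hik⟩ : ∃ i ∈ X, k ≤ i := by
          by_contra hcon
          push Not at hcon
          exact hXk (Finset.eq_of_subset_of_card_le
            (fun i hi => Finset.mem_range.2 (hcon i hi)) (by simp [hXc]))
        have hi : i < ka.colLen 0 := rowLen_pos_iff.1 (by rw [hka]; simp [rowAdd, hiX])
        have hkac := card_of_rowLen_eq_rowAdd hka
        rcases r with _ | r
        · have := colLen_le_card ka
          omega
        · exact (ihr r (Nat.lt_succ_self r) ka (by omega) (by omega)).symm
      · rw [extRows_of_not _ hex, extRows_of_not _ hex]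

end Extension

/-! ### The Pieri rule for additive-multiplicative functionals -/

section Functional

variable {K : Type u} {V : Type v} [Field K] [AddCommGroup V] [Module K V]
  {q : K} {R : V ⊗[K] V →ₗ[K] V ⊗[K] V} {hR : IsHeckeSymmetry q R} {p : ℕ}

/-- The generators as elements of the image of the Hecke algebra. -/
noncomputable def rangeGen (hR : IsHeckeSymmetry q R) (n i : ℕ) : (rho hR n).range :=
  ⟨locOp R n i, locOp_mem_range hR n i⟩

/-- The image of the Hecke algebra is finite-dimensional when V is, as `pieri` requires, and all
elements constructed in it are morphisms of the first kind. -/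
theorem heckeGens_rangeGen (hR : IsHeckeSymmetry q R) (n : ℕ) :
    HeckeGens q n (rangeGen hR n) where
  quad i hi := Subtype.ext ((heckeGens_locOp hR n).quad i hi)
  braid i hi := Subtype.ext ((heckeGens_locOp hR n).braid i hi)
  comm i j hi hj := Subtype.ext ((heckeGens_locOp hR n).comm i j hi hj)

theorem coe_wtProj_rangeGen (hR : IsHeckeSymmetry q R) (n N : ℕ) (l : List ℤ) :
    (wtProj q (rangeGen hR n) N l).1 = wtProj q (locOp R n) N l :=
  map_wtProj (s := rangeGen hR n) (rho hR n).range.val N l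

theorem coe_wtProj_rangeGen_shift (hR : IsHeckeSymmetry q R) (m n N : ℕ) (l : List ℤ) :
    (wtProj q (fun i => rangeGen hR n (m + i)) N l).1 =
      wtProj q (fun i => locOp R n (m + i)) N l :=
  map_wtProj (s := fun i => rangeGen hR n (m + i)) (rho hR n).range.val N l

namespace SW

variable {f : SW hR p → K}

/-- The spaces `V_λ(T)` for different tableaux `T` of the same shape are isomorphic. -/
theorem IsAMFunctional.map_basicAt (hf : IsAMFunctional f) {lam : YoungDiagram}
    (T : StdTableau lam) : f (basicAt T) = f (basic lam) := by
  set T' := colTableau lam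
  obtain ⟨g, k, h1, h2, h3, h4, h5, h6⟩ := (heckeGens_rangeGen hR (lam.card + 0)).exists_equiv
    hR.generic T.isPath_path T'.isPath_path (T.length_path.trans T'.length_path.symm)
    T.length_path.le (N := lam.card) T.length_path.le (T.state_path.trans T'.state_path.symm)
  have hP : ∀ S : StdTableau lam, projector hR [⟨lam, S⟩] =
      (wtProj q (rangeGen hR (lam.card + 0)) lam.card S.path).1 :=
    fun S => by rw [coe_wtProj_rangeGen, projector_singleton]
  have := hf.map_split {()} [⟨lam, T⟩] (fun _ : Unit => [⟨lam, T'⟩]) (fun _ _ => rfl)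
    (fun _ => projector hR [⟨lam, T'⟩]) (fun _ => k.1) (fun _ => g.1)
    (fun _ _ h => by
      rw [show TensorPower.cast K V h = LinearEquiv.refl K _ from TensorPower.cast_refl K V h]
      rfl)
    (fun _ _ => k.2) (fun _ _ => g.2)
    (fun _ _ => by rw [hP]; exact congrArg Subtype.val h2)
    (fun _ _ => by rw [hP]; exact congrArg Subtype.val h1)
    (fun _ _ => by rw [hP]; exact congrArg Subtype.val h6)
    (fun _ _ _ _ h => absurd (Subsingleton.elim _ _) h)
    (by rw [hP, Finset.sum_singleton]; exact congrArg Subtype.val h5)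
  exact this.trans (Finset.sum_singleton _ _)

/-- The word with the empty diagram as its only letter is a different object from the empty word,
but both projectors are the identity of V^{⊗0}. -/
theorem IsAMFunctional.map_basic_bot (hf : IsAMFunctional f) (h1 : f unit = 1) :
    f (basic (⊥ : YoungDiagram)) = 1 := by
  set T := colTableau (⊥ : YoungDiagram)
  have hP : projector hR [⟨⊥, T⟩] = 1 := by
    rw [projector_singleton]
    have : T.path = [] := List.length_eq_zero_iff.1 (T.length_path.trans (by simp [YoungDiagram.card]))
    rw [this]
    rfl
  have := hf.map_split {()} [⟨⊥, T⟩] (fun _ : Unit => [])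
    (fun _ _ => by simp [degree, YoungDiagram.card])
    (fun _ => 1) (fun _ => 1) (fun _ => 1)
    (fun _ _ h => by
      refine LinearMap.ext fun x => ?_
      simp [LinearEquiv.conj_apply, projector])
    (fun _ _ => one_mem _) (fun _ _ => one_mem _)
    (fun _ _ => by rw [mul_one, hP]) (fun _ _ => mul_one _) (fun _ _ => mul_one _)
    (fun _ _ _ _ h => absurd (Subsingleton.elim _ _) h)
    (by rw [Finset.sum_singleton, hP, mul_one])
  rw [Finset.sum_singleton] at this
  exact this.trans h1

/-- The values of the functional on the basic objects satisfy the Pieri rule. -/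
theorem IsAMFunctional.isPieri [FiniteDimensional K V] (hf : IsAMFunctional f) (r : ℕ) :
    IsPieri r (fun k => f (basic (column k))) (fun lam => f (basic lam)) := by
  classical
  intro lam k N hN
  set T := colTableau lam
  set C := colTableau (column k)
  set n := lam.card + ((column k).card + 0) with hn
  have hnk : T.path.length + k = n := by rw [T.length_path, hn, card_column, add_zero]
  set S := ((Finset.range N).powersetCard k).filter fun X => Antitone (rowAdd lam.rowLen X) with hS
  -- The bound on N makes membership in the range automatic for vertical strips.
  have hSmem : ∀ X, X ∈ S ↔ X.card = k ∧ Antitone (rowAdd lam.rowLen X) := fun X => by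
    rw [hS, Finset.mem_filter, Finset.mem_powersetCard]
    refine ⟨fun h => ⟨h.1.2, h.2⟩, fun h => ⟨⟨?_, h.1⟩, h.2⟩⟩
    refine (subset_range_of_antitone h.2).trans (Finset.range_subset_range.2 ?_)
    rw [h.1]
    omega
  set M : Finset ℕ → YoungDiagram := fun X => ofRowLen (rowAdd lam.rowLen X) with hM
  have hMrow : ∀ X ∈ S, (M X).rowLen = rowAdd lam.rowLen X := fun X hX =>
    rowLen_ofRowLen (exists_rowLen_eq_rowAdd.2 ((hSmem X).1 hX).2)
  have hMcard : ∀ X ∈ S, (M X).card = n := fun X hX => by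
    rw [card_of_rowLen_eq_rowAdd (hMrow X hX), ((hSmem X).1 hX).1, hn, card_column, add_zero]
  have H : HeckeGens q (T.path.length + k) (rangeGen hR n) := by
    rw [hnk]
    exact heckeGens_rangeGen hR n
  obtain ⟨a, b, h1, h2, h3⟩ := H.pieri_paths hR.generic T.isPath_path T.state_path S hSmem
    (fun X => (colTableau (M X)).path)
    (fun X hX => ⟨StdTableau.isPath_path _, by rw [StdTableau.length_path, hMcard X hX, hnk], by
      rw [StdTableau.state_path, state_stripWord T.state_path (hMrow X hX)]⟩) rfl
  have hP : projector hR [⟨lam, T⟩, ⟨column k, C⟩] =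
      (wtProj q (rangeGen hR n) (T.path.length + k) T.path * wtProj q
        (fun i => rangeGen hR n (T.path.length + i)) k (colPath k)).1 := by
    have hC : wtProj q (fun i => locOp R n (lam.card + i)) (column k).card C.path =
        wtProj q (fun i => locOp R n (lam.card + i)) k (colPath k) := by
      rw [C.path_column, card_column]
    refine (projector_pair hR T C).trans ?_
    rw [Subalgebra.coe_mul, coe_wtProj_rangeGen, coe_wtProj_rangeGen_shift, T.length_path]
    exact congrArg₂ (· * ·) ((heckeGens_locOp hR n).wtProj_congr hR.generic T.isPath_path
      (by rw [T.length_path]; omega) T.length_path.le (by rw [T.length_path]; omega)) hC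
  have key := hf.map_split S [⟨lam, T⟩, ⟨column k, C⟩] (fun X => [⟨M X, colTableau (M X)⟩])
    (fun X hX => hMcard X hX)
    (fun X => (wtProj q (rangeGen hR n) (T.path.length + k) (colTableau (M X)).path).1)
    (fun X => (a X).1) (fun X => (b X).1)
    (fun X hX h => by
      rw [projector_singleton, coe_wtProj_rangeGen]
      exact (cast_conj_wtProj (m := (M X).card + 0) (n := n) h _).trans
        (congrArg (fun d => wtProj q (locOp R n) d (colTableau (M X)).path)
          ((hMcard X hX).trans hnk.symm)))
    (fun X _ => (a X).2) (fun X _ => (b X).2)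
    (fun X hX => by rw [hP]; exact congrArg Subtype.val (h1 X hX).1)
    (fun X hX => congrArg Subtype.val (h1 X hX).2.1)
    (fun X hX => congrArg Subtype.val (h1 X hX).2.2)
    (fun X hX Y hY hXY => congrArg Subtype.val (h2 X hX Y hY hXY))
    (by
      rw [hP, ← h3, AddSubmonoidClass.coe_finsetSum]
      rfl)
  have hmul : f ⟨[[⟨lam, T⟩, ⟨column k, C⟩]]⟩ = f (basic lam) * f (basic (column k)) :=
    hf.map_cons _ _
  show f (basic lam) * f (basic (column k)) = _
  rw [← hmul, key, hS, Finset.sum_filter]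
  refine Finset.sum_congr rfl fun X _ => ?_
  rw [extRows]
  simp only [exists_rowLen_eq_rowAdd]
  split_ifs <;> rfl

end SW

end Functional

/-! ### Vanishing of antisymmetrizers above the rank -/

section Skew

variable {K : Type u} {V : Type v} [Field K] [AddCommGroup V] [Module K V]
  {q : K} {R : V ⊗[K] V →ₗ[K] V ⊗[K] V} {hR : IsHeckeSymmetry q R} {p : ℕ}

open TensorPower in
theorem tensorAlgebra_hom_ext {M : Type*} [AddCommGroup M] [Module K M]
    {f g : TensorAlgebra K V →ₗ[K] M}
    (h : ∀ (n : ℕ) (x : Fin n → V), f (toTensorAlgebra (PiTensorProduct.tprod K x)) =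
      g (toTensorAlgebra (PiTensorProduct.tprod K x))) : f = g := by
  have : f ∘ₗ TensorAlgebra.ofDirectSum.toLinearMap = g ∘ₗ TensorAlgebra.ofDirectSum.toLinearMap := by
    refine DirectSum.linearMap_ext _ fun n => ?_
    apply PiTensorProduct.ext
    ext x
    have e := TensorAlgebra.ofDirectSum_of_tprod (R := K) x
    simp only [LinearMap.compMultilinearMap_apply, LinearMap.comp_apply, AlgHom.toLinearMap_apply]
    rw [show DirectSum.lof K ℕ (fun i => ⨂[K]^i V) n (PiTensorProduct.tprod K x) =
      DirectSum.of (fun i => ⨂[K]^i V) n (PiTensorProduct.tprod K x) from rfl, e]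
    simpa using h n x
  refine LinearMap.ext fun a => ?_
  have := LinearMap.congr_fun this (TensorAlgebra.toDirectSum a)
  simpa using this

theorem toTensorAlgebra_tensorSq (x : V ⊗[K] V) :
    TensorPower.toTensorAlgebra (tensorSq x) = LinearMap.mul' K (TensorAlgebra K V)
      (TensorProduct.map (TensorAlgebra.ι K) (TensorAlgebra.ι K) x) := by
  induction x using TensorProduct.induction_on with
  | zero => simp
  | add x y hx hy => simp only [map_add, hx, hy]
  | tmul x y =>
    rw [tensorSq_tmul, TensorPower.toTensorAlgebra_tprod, TensorAlgebra.tprod_apply]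
    simp

/-- The component of degree `l` of an element of the tensor algebra. -/
noncomputable def degreeComponent (K : Type u) (V : Type v) [Field K] [AddCommGroup V] [Module K V]
    (l : ℕ) : TensorAlgebra K V →ₗ[K] ⨂[K]^l V :=
  DirectSum.component K ℕ (fun i => ⨂[K]^i V) l ∘ₗ TensorAlgebra.toDirectSum.toLinearMap

theorem toDirectSum_toTensorAlgebra {n : ℕ} (x : ⨂[K]^n V) :
    TensorAlgebra.toDirectSum (TensorPower.toTensorAlgebra x) =
      DirectSum.lof K ℕ (fun i => ⨂[K]^i V) n x := by
  have : TensorAlgebra.toDirectSum.toLinearMap ∘ₗ TensorPower.toTensorAlgebra =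
      DirectSum.lof K ℕ (fun i => ⨂[K]^i V) n := by
    apply PiTensorProduct.ext
    ext1 v
    simp only [LinearMap.compMultilinearMap_apply, LinearMap.comp_apply, AlgHom.toLinearMap_apply,
      TensorPower.toTensorAlgebra_tprod]
    exact TensorAlgebra.toDirectSum_tensorPower_tprod v
  exact LinearMap.congr_fun this x

theorem degreeComponent_self {n : ℕ} (x : ⨂[K]^n V) :
    degreeComponent K V n (TensorPower.toTensorAlgebra x) = x := by
  rw [degreeComponent, LinearMap.comp_apply, AlgHom.toLinearMap_apply, toDirectSum_toTensorAlgebra,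
    DirectSum.component.lof_self]

theorem degreeComponent_of_ne {n l : ℕ} (h : n ≠ l) (x : ⨂[K]^n V) :
    degreeComponent K V l (TensorPower.toTensorAlgebra x) = 0 := by
  rw [degreeComponent, LinearMap.comp_apply, AlgHom.toLinearMap_apply, toDirectSum_toTensorAlgebra,
    DirectSum.component.of, dif_neg h]

theorem ins_zero (c : Fin 2 → V) (y : ⨂[K]^2 V) : ins c 0 2 le_rfl y = y := by
  have : ins (K := K) c 0 2 le_rfl = LinearMap.id := by
    apply PiTensorProduct.ext
    ext b
    simp only [LinearMap.compMultilinearMap_apply, ins_tprod, LinearMap.id_apply]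
    congr 1
    ext j
    simp only [overwrite, Nat.sub_zero]
    exact dif_pos ⟨Nat.zero_le _, by omega⟩
  exact LinearMap.congr_fun this y

/-- In degree l the ideal is spanned by images of q⁻¹ + R_{i,i+1}, and the antisymmetrizer times
such an operator is zero. -/
theorem asym_degreeComponent (hR : IsHeckeSymmetry q R) (l : ℕ) {z : TensorAlgebra K V}
    (hz : z ∈ skewIdeal q R) : asym q (locOp R l) l (degreeComponent K V l z) = 0 := by
  suffices h : skewIdeal q R ≤ LinearMap.ker (asym q (locOp R l) l ∘ₗ degreeComponent K V l) from
    LinearMap.mem_ker.1 (h hz)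
  refine Submodule.span_le.2 ?_
  rintro _ ⟨a, b, x, rfl⟩
  rw [SetLike.mem_coe, LinearMap.mem_ker, ← toTensorAlgebra_tensorSq]
  set Y := tensorSq (q⁻¹ • x + R x) with hY
  set Φ := asym q (locOp R l) l ∘ₗ degreeComponent K V l with hΦ
  have h1 : ∀ (m n : ℕ) (u : Fin m → V) (w : Fin n → V),
      Φ (TensorPower.toTensorAlgebra (PiTensorProduct.tprod K u) * TensorPower.toTensorAlgebra Y *
        TensorPower.toTensorAlgebra (PiTensorProduct.tprod K w)) = 0 := by
    intro m n u w
    rw [← TensorPower.toTensorAlgebra_gMul, ← TensorPower.toTensorAlgebra_gMul,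
      TensorPower.gMul_def, TensorPower.gMul_def, hΦ, LinearMap.comp_apply]
    by_cases hl : m + 2 + n = l
    · subst hl
      -- Writing Y as an insertion into a dummy pair of vectors presents the whole product as one
      -- insertion into a pure tensor, on which the local operator is computable.
      rw [degreeComponent_self, ← ins_zero (0 : Fin 2 → V) Y, mul_ins_right, mul_ins_left]
      set v := Fin.append (Fin.append u 0) w
      have e : ins v (m + 0) 2 (by omega) Y =
          (q⁻¹ • (1 : Module.End K (⨂[K]^(m + 2 + n) V)) + locOp R (m + 2 + n) m : Module.End K _)
          (ins v (m + 0) 2 (by omega) (tensorSq x)) := by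
        rw [locOp, dif_pos (by omega), LinearMap.add_apply, LinearMap.smul_apply,
          Module.End.one_apply]
        have := localOp_ins R (m := m + 2 + n) ⟨m, by omega⟩ v (tensorSq x)
        simp only [add_zero] at this ⊢
        rw [this, hY, map_add, map_add, map_smul, map_smul]
        simp [LinearEquiv.conj_apply]
      rw [e, ← Module.End.mul_apply, mul_add, mul_smul_comm, mul_one,
        (heckeGens_locOp hR (m + 2 + n)).asym_mul_gen hR.generic (i := m) (by omega)]
      simp
    · rw [degreeComponent_of_ne hl, map_zero]
  -- Pure tensors span, so the right factor and then the left factor may be replaced by arbitrary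
  -- elements of the tensor algebra.
  have h2 : ∀ (m : ℕ) (u : Fin m → V), Φ ∘ₗ LinearMap.mulLeft K
      (TensorPower.toTensorAlgebra (PiTensorProduct.tprod K u) * TensorPower.toTensorAlgebra Y) = 0 :=
    fun m u => tensorAlgebra_hom_ext fun n w => h1 m n u w
  have h3 : Φ ∘ₗ LinearMap.mulRight K b ∘ₗ LinearMap.mulRight K (TensorPower.toTensorAlgebra Y) = 0 :=
    tensorAlgebra_hom_ext fun m u => LinearMap.congr_fun (h2 m u) b
  exact LinearMap.congr_fun h3 a

theorem toTensorAlgebra_mem_pow {n : ℕ} (v : Fin n → V) :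
    TensorPower.toTensorAlgebra (PiTensorProduct.tprod K v) ∈
      LinearMap.range (TensorAlgebra.ι K (M := V)) ^ n := by
  rw [TensorPower.toTensorAlgebra_tprod, TensorAlgebra.tprod_apply]
  induction n with
  | zero => simp [Submodule.one_le.1 le_rfl]
  | succ n ih =>
    rw [List.ofFn_succ, List.prod_cons, pow_succ']
    exact Submodule.mul_mem_mul ⟨_, rfl⟩ (ih fun i => v i.succ)

/-- If the component is zero, every pure tensor of degree l lies in the ideal. -/
theorem asym_eq_zero (hR : IsHeckeSymmetry q R) {l : ℕ} (h : skewComponent q R l = ⊥) :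
    asym q (locOp R l) l = 0 := by
  apply PiTensorProduct.ext
  ext v
  simp only [LinearMap.compMultilinearMap_apply, LinearMap.zero_apply]
  rw [skewComponent, ← LinearMap.le_ker_iff_map, Submodule.ker_mkQ] at h
  have := asym_degreeComponent hR l (h (toTensorAlgebra_mem_pow v))
  rwa [degreeComponent_self] at this

/-- The projector is zero, so the object is isomorphic to the empty direct sum. -/
theorem SW.IsAMFunctional.map_column_eq_zero {f : SW hR p → K} (hf : SW.IsAMFunctional f) {l : ℕ}
    (h : skewComponent q R l = ⊥) : f (SW.basic (column l)) = 0 := by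
  classical
  set T := colTableau (column l)
  have hP : projector hR [⟨column l, T⟩] = 0 := by
    rw [projector_singleton, T.path_column]
    have : ∀ m, m = l → wtProj q (locOp R (m + 0)) m (colPath l) = 0 := by
      rintro m rfl
      exact ((heckeGens_locOp hR m).wtProj_colPath hR.generic le_rfl).trans (asym_eq_zero hR h)
    exact this _ (card_column l)
  have := hf.map_split (∅ : Finset Unit) [⟨column l, T⟩] (fun _ => []) (by simp) 0 0 0 (by simp)
    (by simp) (by simp) (by simp) (by simp) (by simp) (by simp) (by rw [hP]; simp)
  exact this.trans Finset.sum_empty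

end Skew

/-! ### The Pieri rule for Schur polynomials -/

section Schur

theorem alternant_eq_zero {p : ℕ} {k : Fin p → ℕ} {i j : Fin p} (hij : i ≠ j) (h : k i = k j) :
    alternant k = 0 :=
  Matrix.det_zero_of_column_eq hij fun l => by simp [h]

theorem alternant_eq_sum {p : ℕ} (k : Fin p → ℕ) :
    alternant k = ∑ σ : Equiv.Perm (Fin p), Equiv.Perm.sign σ •
      ∏ i, (MvPolynomial.X (σ i) : MvPolynomial (Fin p) ℤ) ^ k i := by
  rw [alternant, Matrix.det_apply]
  rfl

/-- The Pieri rule for alternants. -/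
theorem alternant_mul_esymm {p : ℕ} (k : Fin p → ℕ) (r : ℕ) :
    alternant k * MvPolynomial.esymm (Fin p) ℤ r =
      ∑ X ∈ Finset.univ.powersetCard r, alternant fun i => k i + if i ∈ X then 1 else 0 := by
  -- By symmetry e_r may be written in the permuted variables, separately in each term of the
  -- Leibniz expansion; its monomials then raise exponents of that term.
  have h : ∀ σ : Equiv.Perm (Fin p), MvPolynomial.esymm (Fin p) ℤ r =
      ∑ X ∈ Finset.univ.powersetCard r, ∏ i, (MvPolynomial.X (σ i) : MvPolynomial (Fin p) ℤ) ^
        (if i ∈ X then 1 else 0) := fun σ => by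
    have := MvPolynomial.rename_esymm (Fin p) ℤ r σ
    rw [← this, MvPolynomial.esymm, map_sum]
    refine Finset.sum_congr rfl fun X _ => ?_
    rw [map_prod, ← Finset.prod_subset (Finset.subset_univ X)]
    · exact Finset.prod_congr rfl fun i hi => by simp [hi]
    · intro i _ hi
      simp [hi]
  simp only [alternant_eq_sum]
  rw [Finset.sum_mul, Finset.sum_comm]
  refine Finset.sum_congr rfl fun σ _ => ?_
  rw [h σ, Finset.mul_sum]
  refine Finset.sum_congr rfl fun X _ => ?_
  rw [smul_mul_assoc, ← Finset.prod_mul_distrib]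
  simp only [pow_add]

/-- Up to sign this is the Vandermonde determinant in distinct variables. -/
theorem alternant_ne_zero (p : ℕ) : alternant (fun j : Fin p => p - 1 - (j : ℕ)) ≠ 0 := by
  intro h
  have e : alternant (fun j : Fin p => p - 1 - (j : ℕ)) =
      ((Matrix.vandermonde fun i : Fin p =>
        (MvPolynomial.X i : MvPolynomial (Fin p) ℤ)).submatrix id Fin.revPerm).det := by
    rw [alternant]
    congr 1
    ext1 i j
    simp only [Matrix.of_apply, Matrix.submatrix_apply, id_eq, Matrix.vandermonde_apply,
      Fin.revPerm_apply, Fin.val_rev]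
    congr 1
    omega
  rw [e, Matrix.det_permute'] at h
  have h2 : (Matrix.vandermonde fun i : Fin p =>
      (MvPolynomial.X i : MvPolynomial (Fin p) ℤ)).det ≠ 0 :=
    Matrix.det_vandermonde_ne_zero_iff.2 (MvPolynomial.X_injective)
  rcases Int.units_eq_one_or (Equiv.Perm.sign (Fin.revPerm : Equiv.Perm (Fin p))) with hs | hs <;>
    rw [hs] at h <;> simp [h2] at h

theorem schur_mul_alternant {p : ℕ} {lam : YoungDiagram} (h : lam.colLen 0 ≤ p) :
    schur p lam * alternant (fun j : Fin p => p - 1 - (j : ℕ)) =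
      alternant fun j : Fin p => lam.rowLen j + (p - 1 - (j : ℕ)) := by
  rw [schur, if_pos h, mul_comm]
  exact ((alternant_dvd fun j : Fin p => lam.rowLen j + (p - 1 - (j : ℕ))).choose_spec).symm

theorem schur_bot (p : ℕ) : schur p ⊥ = 1 := by
  have hrow : (⊥ : YoungDiagram).rowLen = fun _ => 0 :=
    rowLen_eq_of_mem_iff fun i j => by simp [YoungDiagram.notMem_bot]
  have hcol : (⊥ : YoungDiagram).colLen 0 ≤ p :=
    (rowLen_eq_zero_iff.1 (congrFun hrow 0)).trans (Nat.zero_le p)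
  refine mul_right_cancel₀ (alternant_ne_zero p) ?_
  rw [schur_mul_alternant hcol, hrow, one_mul]
  simp only [zero_add]

/-- When the new row lengths do not form a partition, row i + 1 overtakes an equal row i; two
exponents coincide and the alternant vanishes too. -/
theorem extRows_schur_mul_alternant {p : ℕ} {lam : YoungDiagram} (h : lam.colLen 0 ≤ p)
    {X : Finset ℕ} (hX : X ⊆ Finset.range p) :
    extRows (schur p) (rowAdd lam.rowLen X) * alternant (fun j : Fin p => p - 1 - (j : ℕ)) =
      alternant fun j : Fin p => rowAdd lam.rowLen X j + (p - 1 - (j : ℕ)) := by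
  by_cases hex : ∃ mu : YoungDiagram, mu.rowLen = rowAdd lam.rowLen X
  · obtain ⟨mu, hmu⟩ := hex
    rw [← hmu, extRows_rowLen, schur_mul_alternant]
    rw [← rowLen_eq_zero_iff, hmu, rowAdd, rowLen_eq_zero_iff.2 h,
      if_neg fun hp => by simpa using hX hp]
  · rw [extRows_of_not _ hex, zero_mul]
    rw [exists_rowLen_eq_rowAdd, antitone_rowAdd] at hex
    push Not at hex
    obtain ⟨i, hi1, he, hi⟩ := hex
    have hip := Finset.mem_range.1 (hX hi1)
    refine (alternant_eq_zero (i := ⟨i, by omega⟩) (j := ⟨i + 1, hip⟩)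
      (by simp [Fin.ext_iff]) ?_).symm
    simp only [rowAdd, hi, hi1, he, if_true, if_false]
    omega

theorem schur_of_lt {p : ℕ} {lam : YoungDiagram} (h : p < lam.colLen 0) : schur p lam = 0 :=
  if_neg (not_le.2 h)

theorem extRows_schur_eq_zero {p : ℕ} {a : ℕ → ℕ} {i : ℕ} (hi : p ≤ i) (ha : 0 < a i) :
    extRows (schur p) a = 0 := by
  by_cases hex : ∃ mu : YoungDiagram, mu.rowLen = a
  · obtain ⟨mu, rfl⟩ := hex
    rw [extRows_rowLen, schur_of_lt (lt_of_le_of_lt hi (rowLen_pos_iff.1 ha))]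
  · exact extRows_of_not _ hex

/-- The Pieri rule for Schur polynomials. -/
theorem isPieri_schur (p : ℕ) : IsPieri p (MvPolynomial.esymm (Fin p) ℤ) (schur p) := by
  intro lam k N hN
  rcases lt_or_ge p (lam.colLen 0) with hp | hp
  · rw [schur_of_lt hp, zero_mul]
    refine (Finset.sum_eq_zero fun X _ => extRows_schur_eq_zero le_rfl ?_).symm
    exact Nat.add_pos_left (rowLen_pos_iff.2 hp) _
  · have hsub : (Finset.range p).powersetCard k ⊆ (Finset.range N).powersetCard k :=
      Finset.powersetCard_mono (Finset.range_subset_range.2 (by omega))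
    -- Strips leaving the first p rows produce no diagram or one with more than p rows, hence
    -- contribute 0.
    rw [← Finset.sum_subset hsub]
    · refine mul_right_cancel₀ (alternant_ne_zero p) ?_
      rw [mul_right_comm, schur_mul_alternant hp, alternant_mul_esymm, Finset.sum_mul]
      refine Finset.sum_bij (fun X _ => X.map Fin.valEmbedding) (fun X hX => ?_)
        (fun X _ Y _ h => Finset.map_injective _ h) (fun Y hY => ?_) (fun X hX => ?_)
      · rw [Finset.mem_powersetCard] at hX ⊢
        refine ⟨fun i hi => ?_, by rw [Finset.card_map, hX.2]⟩
        obtain ⟨j, _, rfl⟩ := Finset.mem_map.1 hi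
        exact Finset.mem_range.2 j.isLt
      · rw [Finset.mem_powersetCard] at hY
        have hmap : (Y.attachFin fun i hi => Finset.mem_range.1 (hY.1 hi)).map Fin.valEmbedding = Y := by
          ext i
          simp only [Finset.mem_map, Finset.mem_attachFin, Fin.valEmbedding_apply]
          exact ⟨fun ⟨j, hj, h⟩ => h ▸ hj, fun hi => ⟨⟨i, Finset.mem_range.1 (hY.1 hi)⟩, hi, rfl⟩⟩
        refine ⟨Y.attachFin fun i hi => Finset.mem_range.1 (hY.1 hi), ?_, hmap⟩
        rw [Finset.mem_powersetCard, Finset.card_attachFin]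
        exact ⟨Finset.subset_univ _, hY.2⟩
      · rw [extRows_schur_mul_alternant hp]
        · congr 1
          ext1 j
          have : (j : ℕ) ∈ X.map Fin.valEmbedding ↔ j ∈ X :=
            Finset.mem_map' (f := Fin.valEmbedding)
          simp only [rowAdd, this]
          ring
        · intro i hi
          obtain ⟨j, _, rfl⟩ := Finset.mem_map.1 hi
          exact Finset.mem_range.2 j.isLt
    · intro X hXN hXp
      rw [Finset.mem_powersetCard] at hXN hXp
      obtain ⟨i, hi, hip⟩ : ∃ i ∈ X, i ∉ Finset.range p := by
        by_contra hcon
        push Not at hcon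
        exact hXp ⟨hcon, hXN.2⟩
      exact extRows_schur_eq_zero (i := i) (by simpa using hip) (by simp [rowAdd, hi])

theorem IsPieri.map {L M : Type*} [CommRing L] [CommRing M] (φ : L →+* M) {p : ℕ} {e : ℕ → L}
    {D : YoungDiagram → L} (h : IsPieri p e D) :
    IsPieri p (fun k => φ (e k)) (fun lam => φ (D lam)) := by
  intro lam k N hN
  rw [← map_mul, h lam k N hN, map_sum]
  refine Finset.sum_congr rfl fun X _ => ?_
  by_cases hex : ∃ mu : YoungDiagram, mu.rowLen = rowAdd lam.rowLen X
  · obtain ⟨mu, hmu⟩ := hex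
    rw [← hmu, extRows_rowLen, extRows_rowLen]
  · rw [extRows_of_not _ hex, extRows_of_not _ hex, map_zero]

end Schur

/-! ### Identification with Schur polynomials and uniqueness -/

section Main

variable {K : Type u} {V : Type v} [Field K] [AddCommGroup V] [Module K V]
  {q : K} {R : V ⊗[K] V →ₗ[K] V ⊗[K] V} {hR : IsHeckeSymmetry q R} {p : ℕ}

namespace SW

variable {f g : SW hR p → K}

theorem charPoly_coeff (f : SW hR p → K) {k : ℕ} (hk : 1 ≤ k) (hkp : k < p) :
    (charPoly f).coeff (p - k) = f (basic (column k)) := by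
  simp only [charPoly, Polynomial.coeff_add, Polynomial.coeff_X_pow, Polynomial.finsetSum_coeff,
    Polynomial.coeff_C_mul, Polynomial.coeff_one]
  rw [if_neg (by omega), if_neg (by omega), zero_add, add_zero,
    Finset.sum_eq_single_of_mem k (Finset.mem_Ico.2 ⟨hk, hkp⟩), if_pos rfl, mul_one]
  intro j hj hjk
  rw [Finset.mem_Ico] at hj
  rw [if_neg (by omega), mul_zero]

theorem charPoly_coeff_zero (hp : 0 < p) (f : SW hR p → K) : (charPoly f).coeff 0 = 1 := by
  simp only [charPoly, Polynomial.coeff_add, Polynomial.coeff_X_pow, Polynomial.finsetSum_coeff,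
    Polynomial.coeff_C_mul, Polynomial.coeff_one]
  rw [if_neg (by omega), if_pos trivial, zero_add, Finset.sum_eq_zero, zero_add]
  intro j hj
  rw [Finset.mem_Ico] at hj
  rw [if_neg (by omega), mul_zero]

theorem charPoly_monic (hp : 0 < p) (f : SW hR p → K) :
    (charPoly f).Monic ∧ (charPoly f).natDegree = p := by
  have hdeg : (∑ k ∈ Finset.Ico 1 p, Polynomial.C (f (basic (column k))) *
      Polynomial.X ^ (p - k) + 1 : Polynomial K).degree < p := by
    refine lt_of_le_of_lt (Polynomial.degree_add_le _ _) (max_lt ?_ ?_)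
    · refine (Polynomial.degree_sum_le _ _).trans_lt ?_
      rw [Finset.sup_lt_iff (by exact_mod_cast WithBot.bot_lt_coe p)]
      intro k hk
      rw [Finset.mem_Ico] at hk
      refine (Polynomial.degree_C_mul_X_pow_le _ _).trans_lt ?_
      exact_mod_cast (by omega : p - k < p)
    · exact lt_of_le_of_lt Polynomial.degree_one_le (by exact_mod_cast hp)
  have h : charPoly f = Polynomial.X ^ p + (∑ k ∈ Finset.Ico 1 p,
      Polynomial.C (f (basic (column k))) * Polynomial.X ^ (p - k) + 1 : Polynomial K) := by
    rw [charPoly, add_assoc]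
  refine ⟨h ▸ Polynomial.monic_X_pow_add hdeg, ?_⟩
  rw [h, Polynomial.natDegree_eq_of_degree_eq_some]
  rw [Polynomial.degree_add_eq_left_of_degree_lt] <;> rw [Polynomial.degree_X_pow]
  exact hdeg

/-- The values of the functional on columns are elementary symmetric polynomials in the roots. -/
theorem IsAMFunctional.map_column (hp : IsEvenOfRank q R p) (hf : IsAMFunctional f)
    (h1 : f unit = 1) (htop : f (basic (column p)) = 1) {L : Type*} [Field L] [Algebra K L]
    (α : Fin p → L) (hα : (charPoly f).aroots L = Finset.univ.val.map (fun i => -α i)) (k : ℕ) :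
    algebraMap K L (f (basic (column k))) =
      MvPolynomial.aeval α (MvPolynomial.esymm (Fin p) ℤ k) := by
  obtain ⟨hmon, hdeg⟩ := charPoly_monic hp.rank_pos f
  rw [MvPolynomial.aeval_esymm_eq_multiset_esymm]
  rcases lt_or_ge p k with hpk | hkp
  · rw [hf.map_column_eq_zero (hp.component_eq_bot k hpk), map_zero, Multiset.esymm,
      Multiset.powersetCard_eq_empty _ (by simpa using hpk)]
    simp
  -- The roots -α_i account for the full degree p, so φ is the product of the X + α_i, whose
  -- coefficient at X^{p-k} is e_k(α).
  · have hprod : ((charPoly f).map (algebraMap K L)) =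
        ((Finset.univ.val.map α).map fun r => Polynomial.X + Polynomial.C r).prod := by
      have := Polynomial.prod_multiset_X_sub_C_of_monic_of_roots_card_eq
        (hmon.map (algebraMap K L)) (by
          rw [← Polynomial.aroots_def, hα, hmon.natDegree_map, hdeg]
          simp)
      rw [← this, ← Polynomial.aroots_def, hα, Multiset.map_map, Multiset.map_map]
      congr 1
      exact Multiset.map_congr rfl fun i _ => by simp
    have hcoeff := Multiset.prod_X_add_C_coeff (Finset.univ.val.map α) (k := p - k) (by simp)
    rw [← hprod, Polynomial.coeff_map] at hcoeff
    have hcard : (Finset.univ.val.map α).card - (p - k) = k := by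
      simp
      omega
    rw [hcard] at hcoeff
    rw [← hcoeff]
    congr 1
    rcases Nat.eq_zero_or_pos k with rfl | hk
    · rw [column_zero, hf.map_basic_bot h1, Nat.sub_zero]
      have := hmon.coeff_natDegree
      rw [hdeg] at this
      exact this.symm
    · rcases hkp.lt_or_eq with hlt | rfl
      · exact (charPoly_coeff f hk hlt).symm
      · rw [htop, Nat.sub_self, charPoly_coeff_zero hp.rank_pos f]

/-- Both sides solve the Pieri rule with the same multipliers, by `map_column`, and equal 1 at the
empty diagram. -/
theorem IsAMFunctional.map_basic [FiniteDimensional K V] (hp : IsEvenOfRank q R p)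
    (hf : IsAMFunctional f) (h1 : f unit = 1) (htop : f (basic (column p)) = 1)
    {L : Type*} [Field L] [Algebra K L] (α : Fin p → L)
    (hα : (charPoly f).aroots L = Finset.univ.val.map (fun i => -α i)) (lam : YoungDiagram) :
    algebraMap K L (f (basic lam)) = MvPolynomial.aeval α (schur p lam) := by
  have e1 := (hf.isPieri p).map (algebraMap K L)
  have e2 := (isPieri_schur p).map (MvPolynomial.aeval α : MvPolynomial (Fin p) ℤ →ₐ[ℤ] L).toRingHom
  have e : (fun k => algebraMap K L (f (basic (column k)))) = fun k =>
      (MvPolynomial.aeval α : MvPolynomial (Fin p) ℤ →ₐ[ℤ] L).toRingHom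
        (MvPolynomial.esymm (Fin p) ℤ k) :=
    funext fun k => hf.map_column hp h1 htop α hα k
  rw [e] at e1
  exact congrFun (e1.unique e2 (by simp [hf.map_basic_bot h1, schur_bot])) lam

/-- Additivity reduces to tensor words, multiplicativity to single letters, and `map_basicAt`
removes the dependence on the tableau. -/
theorem IsAMFunctional.eq_of_basic (hf : IsAMFunctional f) (hg : IsAMFunctional g)
    (h1 : g unit = f unit) (h : ∀ lam : YoungDiagram, g (basic lam) = f (basic lam))
    (U : SW hR p) : g U = f U := by
  obtain ⟨ws⟩ := U
  rw [hf.map_sum, hg.map_sum]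
  congr 1
  refine List.map_congr_left fun w hw => ?_
  clear hw
  induction w with
  | nil => exact h1
  | cons T w ih => rw [hf.map_cons, hg.map_cons, ih, hf.map_basicAt, hg.map_basicAt, h]

theorem IsAMFunctional.unique [FiniteDimensional K V] (hp : IsEvenOfRank q R p)
    (hf : IsAMFunctional f) (hf1 : f unit = 1) (hf_top : f (basic (column p)) = 1)
    (hg : IsAMFunctional g) (hg1 : g unit = 1) (hg_top : g (basic (column p)) = 1)
    (h : ∀ k : ℕ, 1 ≤ k → k ≤ p - 1 → g (basic (column k)) = f (basic (column k)))
    (U : SW hR p) : g U = f U := by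
  have e : (fun k => g (basic (column k))) = fun k => f (basic (column k)) := by
    funext k
    rcases Nat.eq_zero_or_pos k with rfl | hk
    · rw [column_zero, hf.map_basic_bot hf1, hg.map_basic_bot hg1]
    · rcases lt_trichotomy k p with hlt | rfl | hgt
      · exact h k hk (by omega)
      · rw [hf_top, hg_top]
      · rw [hf.map_column_eq_zero (hp.component_eq_bot k hgt),
          hg.map_column_eq_zero (hp.component_eq_bot k hgt)]
  have e1 := hg.isPieri p
  rw [e] at e1
  exact hf.eq_of_basic hg (hg1.trans hf1.symm)
    (congrFun (e1.unique (hf.isPieri p) (by rw [hf.map_basic_bot hf1, hg.map_basic_bot hg1]))) U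

end SW

end Main

end SchurWeyl

theorem mainTheorem2 {K : Type*} {V : Type*} [Field K] [AddCommGroup V] [Module K V]
    [FiniteDimensional K V] {q : K} {R : V ⊗[K] V →ₗ[K] V ⊗[K] V} {p : ℕ}
    (hR : SchurWeyl.IsHeckeSymmetry q R) (hp : SchurWeyl.IsEvenOfRank q R p)
    (hNM : SchurWeyl.IsBalanced hR p)
    (f : SchurWeyl.SW hR p → K) (hf : SchurWeyl.SW.IsAMFunctional f)
    (hf_unit : f SchurWeyl.SW.unit = 1)
    (hf_top : f (SchurWeyl.SW.basic (SchurWeyl.column p)) = 1) :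
    (∀ (L : Type*) [Field L] [Algebra K L] (α : Fin p → L),
      (SchurWeyl.SW.charPoly f).aroots L = Finset.univ.val.map (fun i => -α i) →
      ∀ (lam : YoungDiagram) (T : SchurWeyl.StdTableau lam),
        algebraMap K L (f (SchurWeyl.SW.basicAt T)) =
          MvPolynomial.aeval α (SchurWeyl.schur p lam)) ∧
    (∀ g : SchurWeyl.SW hR p → K, SchurWeyl.SW.IsAMFunctional g →
      g SchurWeyl.SW.unit = 1 → g (SchurWeyl.SW.basic (SchurWeyl.column p)) = 1 →
      (∀ k : ℕ, 1 ≤ k → k ≤ p - 1 →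
        g (SchurWeyl.SW.basic (SchurWeyl.column k)) =
          f (SchurWeyl.SW.basic (SchurWeyl.column k))) →
      ∀ U : SchurWeyl.SW hR p, g U = f U) := by
  refine ⟨fun L _ _ α hα lam T => ?_, fun g hg hg_unit hg_top h U => ?_⟩
  · rw [hf.map_basicAt T]
    exact hf.map_basic hp hf_unit hf_top α hα lam
  · exact hf.unique hp hf_unit hf_top hg hg_unit hg_top h U
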